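/- **Setting.** In the I/O-model an internal memory holds $M$ records, data on disk is moved in blocks of $B$ consecutive records, one block transfer is one I/O, and time counts elementary internal steps (record moves and comparisons; a block transfer counts $B$ steps). Write $\mathrm{sort}_{\mathrm{IO}}(N)=\frac NB\log_{M/B}\frac NB$ and $\mathrm{sort}_{\mathrm{time}}(N)=N\log_2 N$. **The outer Reduce sweep.** The input is a singly rooted, not necessarily reduced OBDD $f$ with $N'$ internal nodes in transposed form (internal arcs sorted by target, arcs to terminals sorted by source), and a set $X$ of levels that need a nested sweep (only those occurring in $f$ matter). The levels of $f$ are processed bottom-up. On each level the nodes' outgoing arcs are collected from a priority queue $Q_{\mathrm{outer}}$ (together with the arcs to terminals); redundant nodes are suppressed, the remaining nodes are sorted by their children, duplicates are merged, and the reduced nodes are output; then the pairs (unreduced node, reduced target $t'$) are sorted by unreduced node and matched with the incoming arcs $s\to t$. Let $x_j$ be the deepest level of $X$ not yet finished. If the level of $s$ is at least $x_j$ (or no such level is left), the arc $s\to t'$ is placed in $Q_{\mathrm{outer}}$; otherwise it becomes a request in a second priority queue $Q_{\mathrm{inner}}$, and, if $t'$ is a reduced node of level $x_j$ itself, this request is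 for the pair $(t'.\mathrm{low},t'.\mathrm{high})$. After level $x_j$ an inner sweep is invoked. It may be any procedure that takes all pending requests and all nodes reduced so far, replaces the nodes by new ones, and answers each request of a parent $s$ by one new target for $s$; the answers return to $Q_{\mathrm{outer}}$, or are kept for the next inner sweep if $s$ lies above the next nested level. Sorting is done by insertion into and deletion from a priority queue, and all priority queues are one concrete external-memory priority queue with in-memory insertion buffer and $\Theta(M/B)$-way merging of sorted files on disk. Costs exclude the I/Os and steps made by the inner sweeps, including their insertions into $Q_{\mathrm{outer}}$, and space excludes the files made by them. **Lemma.** The outer Reduce sweep costs $\Theta(\mathrm{sort}(N'))$ I/Os and time in the worst case and $O(N')$ space. Precisely, there are absolute constants $c,C>0$ such that for all $B\ge 1$, $M\ge 32B$ and $N'>M$: 1. for every such OBDD $f$ with $N'$ nodes, every $X$, and all inner sweeps, the outer Reduce sweep uses at most $C\,\mathrm{sort}_{\mathrm{IO}}(N')$ I/Os, at most $C\,\mathrm{sort}_{\mathrm{time}}(N')$ time, disk space for at most $C N'$ records (the number of blocks in use at any time, times $B$), and never more than $M$ records of internal memory; 2. there is such an OBDD $f$ with $N'$ nodes on which, for every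 $X$ and all inner sweeps, it uses at least $c\,\mathrm{sort}_{\mathrm{IO}}(N')$ I/Os and at least $c\,\mathrm{sort}_{\mathrm{time}}(N')$ time. -/

import Mathlib

/-!
The I/O-model with a cost meter, an external-memory priority queue, and the outer Reduce sweep of
nested sweeping, executed on metered primitives.

Records live either on disk (type `Run`, a list of blocks) or in internal memory. Programs touch
disk data only through `readBlock` and `writeBlock`; each internal elementary step (one comparison or
one record move) is a `tick`; each internal buffer is paid for by `alloc`.
-/

namespace NestedSweep

/-! ### Cost meter -/

/-- `io`: block transfers; `time`: elementary steps; `disk`: blocks currently stored on disk;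
`mem`: records of internal memory currently reserved; with the peaks of the last two. -/
structure Meter where
  io : ℕ
  time : ℕ
  disk : ℤ
  diskPeak : ℤ
  mem : ℤ
  memPeak : ℤ

abbrev Prog (α : Type) : Type := StateM Meter α

/-- Elementary internal steps. -/
def tick (n : ℕ) : Prog Unit := fun s => ((), { s with time := s.time + n })

/-- Reserve (for negative `n`: give back) internal memory for `n` records. -/
def alloc (n : ℤ) : Prog Unit := fun s =>
  ((), { s with mem := s.mem + n, memPeak := max s.memPeak (s.mem + n) })

/-- Read a block from disk, after which its place on disk is free again: one I/O, `B` steps. -/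
def readBlock {α : Type} (B : ℕ) (b : List α) : Prog (List α) := fun s =>
  (b, { s with io := s.io + 1, time := s.time + B, disk := s.disk - 1 })

/-- Write a block to disk: one I/O, `B` steps. A block has room for `B` records only. -/
def writeBlock {α : Type} (B : ℕ) (l : List α) : Prog (List α) := fun s =>
  (l.take B, { s with
    io := s.io + 1
    time := s.time + B
    disk := s.disk + 1
    diskPeak := max s.diskPeak (s.disk + 1) })

/-- Forget `n` blocks on disk. -/
def release (n : ℕ) : Prog Unit := fun s => ((), { s with disk := s.disk - n })

/-- Run `p` without charging its I/Os and steps (space is still metered). -/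
def uncharged {α : Type} (p : Prog α) : Prog α := fun s =>
  let r := p s
  (r.1, { r.2 with io := s.io, time := s.time })

/-- Repeat `body` while it asks to go on, at most `n` times. -/
def loopN {σ : Type} : ℕ → (σ → Prog (σ × Bool)) → σ → Prog σ
  | 0, _, s => pure s
  | n + 1, body, s => do
    let r ← body s
    if r.2 then loopN n body r.1 else pure r.1

/-- Block size `B`; multiway merges have `2 ^ d` input streams; an insertion buffer has room for
`2 ^ e` records. -/
structure Params where
  B : ℕ
  d : ℕ
  e : ℕ

/-- The parameters for an internal memory of `M` records and blocks of `B` records. -/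
def Params.ofMemory (M B : ℕ) : Params := ⟨B, Nat.log 2 (M / (8 * B)), Nat.log 2 (M / 32)⟩

/-! ### Files, readers and writers -/

/-- A file on disk: its blocks, in order. -/
abbrev Run (α : Type) : Type := List (List α)

/-- Number of records in a file (kept with the file). -/
def Run.size {α : Type} (r : Run α) : ℕ := (r.map List.length).sum

/-- Split a list of records into consecutive blocks of `B` records. -/
def toBlocks {α : Type} (B : ℕ) (l : List α) : Run α :=
  (List.range ((l.length + B - 1) / B)).map fun i => (l.drop (i * B)).take B

/-- A file that is being read: what is left of the current block, in internal memory, and the blocks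
still on disk. -/
structure Reader (α : Type) where
  cur : List α
  rest : Run α

def Reader.fetch {α : Type} (B : ℕ) : Run α → Prog (Reader α)
  | [] => pure ⟨[], []⟩
  | b :: bs => do
    let b ← readBlock B b
    pure ⟨b, bs⟩

def Reader.next {α : Type} (B : ℕ) (r : Reader α) : Prog (Option α × Reader α) := do
  tick 1
  match r.cur with
  | [] => pure (none, r)
  | [x] => do
    let r' ← Reader.fetch B r.rest
    pure (some x, r')
  | x :: y :: xs => pure (some x, ⟨y :: xs, r.rest⟩)

/-- Stop reading; an unread part of the current block goes back to disk. -/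
def Reader.close {α : Type} (B : ℕ) (r : Reader α) : Prog (Run α) :=
  match r.cur with
  | [] => pure r.rest
  | x :: xs => do
    let b ← writeBlock B (x :: xs)
    pure (b :: r.rest)

/-- A file that is being written: the blocks on disk and the block being filled, in memory. -/
structure Writer (α : Type) where
  done : Run α
  cur : List α

def Writer.put {α : Type} (B : ℕ) (x : α) (w : Writer α) : Prog (Writer α) := do
  tick 1
  if w.cur.length + 1 < B then pure ⟨w.done, w.cur ++ [x]⟩
  else do
    let b ← writeBlock B (w.cur ++ [x])
    pure ⟨w.done ++ [b], []⟩

def Writer.finish {α : Type} (B : ℕ) (w : Writer α) : Prog (Run α) :=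
  match w.cur with
  | [] => pure w.done
  | x :: xs => do
    let b ← writeBlock B (x :: xs)
    pure (w.done ++ [b])

def Writer.contents {α : Type} (w : Writer α) : List α := w.done.flatten ++ w.cur

/-! ### Tournament trees -/

/-- `x` is at least as early as `y` in the order `lt`; `none` comes after everything. -/
def better {α : Type} (lt : α → α → Bool) : Option α → Option α → Bool
  | none, _ => false
  | some _, none => true
  | some x, some y => !(lt y x)

/-- A perfect binary tree over streams. Each inner node stores the first of the records at the heads
of its streams, and whether one of its leaves is vacant. -/
inductive Tree (α : Type) where
  | leaf (r : Reader α) : Tree α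
  | node (w : Option α) (room : Bool) (l r : Tree α) : Tree α

def Tree.top {α : Type} : Tree α → Option α
  | .leaf r => r.cur.head?
  | .node w _ _ _ => w

def Tree.room {α : Type} : Tree α → Bool
  | .leaf r => r.cur.isEmpty
  | .node _ b _ _ => b

def Tree.join {α : Type} (lt : α → α → Bool) (l r : Tree α) : Tree α :=
  .node (if better lt l.top r.top then l.top else r.top) (l.room || r.room) l r

def Tree.empty {α : Type} : ℕ → Tree α
  | 0 => .leaf ⟨[], []⟩
  | n + 1 => .node none true (Tree.empty n) (Tree.empty n)

/-- Put a record into a vacant leaf. -/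
def Tree.insert {α : Type} (lt : α → α → Bool) (x : α) : Tree α → Prog (Tree α)
  | .leaf r => do
    tick 1
    match r.cur with
    | [] => pure (.leaf ⟨[x], r.rest⟩)
    | _ :: _ => pure (.leaf r)
  | .node _ _ l r => do
    tick 1
    if l.room then do
      let l' ← Tree.insert lt x l
      pure (Tree.join lt l' r)
    else do
      let r' ← Tree.insert lt x r
      pure (Tree.join lt l r')

/-- Remove the first record, and replay the matches on its path. -/
def Tree.pop {α : Type} (B : ℕ) (lt : α → α → Bool) : Tree α → Prog (Option α × Tree α)
  | .leaf r => do
    let p ← r.next B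
    pure (p.1, .leaf p.2)
  | .node _ _ l r => do
    tick 1
    if better lt l.top r.top then do
      let p ← Tree.pop B lt l
      pure (p.1, Tree.join lt p.2 r)
    else do
      let p ← Tree.pop B lt r
      pure (p.1, Tree.join lt l p.2)

/-- Start reading up to `2 ^ d` files. -/
def Tree.opened {α : Type} (B : ℕ) (lt : α → α → Bool) : ℕ → List (Run α) → Prog (Tree α)
  | 0, rs => do
    tick 1
    let r ← Reader.fetch B (rs.headD [])
    pure (.leaf r)
  | d + 1, rs => do
    tick 1
    let l ← Tree.opened B lt d (rs.take (2 ^ d))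
    let r ← Tree.opened B lt d (rs.drop (2 ^ d))
    pure (Tree.join lt l r)

def Tree.closed {α : Type} (B : ℕ) : Tree α → Prog (List (Run α))
  | .leaf r => do
    tick 1
    let f ← r.close B
    pure [f]
  | .node _ _ l r => do
    tick 1
    let fl ← Tree.closed B l
    let fr ← Tree.closed B r
    pure (fl ++ fr)

/-- Move the first `n` records of the tree, in order, to a file. -/
def Tree.drain {α : Type} (B : ℕ) (lt : α → α → Bool) :
    ℕ → Tree α → Writer α → Prog (Tree α × Writer α)
  | 0, t, w => pure (t, w)
  | n + 1, t, w => do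
    let p ← t.pop B lt
    match p.1 with
    | none => pure (p.2, w)
    | some x => do
      let w' ← w.put B x
      Tree.drain B lt n p.2 w'

/-- Multiway merge: merge the first `n` records of at most `2 ^ d` sorted files into a new sorted
file; also return what is left of the files. Uses `2 ^ d + 1` block buffers. -/
def mergeRuns {α : Type} (P : Params) (lt : α → α → Bool) (n : ℕ) (rs : List (Run α)) :
    Prog (Run α × List (Run α)) := do
  alloc (2 ^ P.d * P.B + 2 ^ P.d + P.B)
  let t ← Tree.opened P.B lt P.d rs
  let p ← t.drain P.B lt n ⟨[], []⟩
  let out ← p.2.finish P.B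
  let left ← p.1.closed P.B
  alloc (-(2 ^ P.d * P.B + 2 ^ P.d + P.B))
  pure (out, left)

/-! ### External-memory priority queue -/

/-- A level of the external part of a priority queue: fewer than `2 ^ d - 1` sorted files, and a sorted
file `out` of records that come before all other records of this and all deeper levels. -/
structure Lvl (α : Type) where
  out : Run α
  runs : List (Run α)

/-- `ins` (in memory): tournament tree with the `cnt` most recent insertions; `lvls`: external part;
`del` (in memory): the first records of the external part, at most one block; `ext`: number of records
in `lvls`. -/
structure PQ (α : Type) where
  ins : Tree α
  cnt : ℕ
  del : List α
  lvls : List (Lvl α)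
  ext : ℕ

def PQ.size {α : Type} (q : PQ α) : ℕ := q.cnt + q.del.length + q.ext

/-- Number of disk blocks used. -/
def PQ.blocks {α : Type} (q : PQ α) : ℕ :=
  (q.lvls.map fun l => l.out.length + (l.runs.map List.length).sum).sum

def Tree.contents {α : Type} : Tree α → List α
  | .leaf r => r.cur ++ r.rest.flatten
  | .node _ _ l r => l.contents ++ r.contents

def PQ.contents {α : Type} (q : PQ α) : List α :=
  q.ins.contents ++ q.del ++ q.lvls.flatMap fun l => l.out.flatten ++ l.runs.flatMap List.flatten

def PQ.empty {α : Type} (P : Params) : PQ α := ⟨Tree.empty P.e, 0, [], [], 0⟩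

def PQ.new {α : Type} (P : Params) : Prog (PQ α) := do
  alloc (2 ^ (P.e + 1) + P.B)
  tick (2 ^ (P.e + 1))
  pure (PQ.empty P)

/-- Merge the files `inc` and the `out` file of the first level into one file of the first level; when
that level is full, its files are merged into the next level. -/
def addRuns {α : Type} (P : Params) (lt : α → α → Bool) :
    List (Run α) → List (Lvl α) → Prog (List (Lvl α))
  | inc, [] => do
    let p ← mergeRuns P lt (inc.map Run.size).sum inc
    pure [⟨[], [p.1]⟩]
  | inc, l :: ls => do
    let p ← mergeRuns P lt ((l.out :: inc).map Run.size).sum (l.out :: inc)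
    if l.runs.length + 1 < 2 ^ P.d - 1 then pure (⟨[], p.1 :: l.runs⟩ :: ls)
    else do
      let ls' ← addRuns P lt (p.1 :: l.runs) ls
      pure (⟨[], []⟩ :: ls')

/-- Append the next `2 ^ d` blocks of records of the external part to the `out` file of its first
level. -/
def refill {α : Type} (P : Params) (lt : α → α → Bool) : List (Lvl α) → Prog (List (Lvl α))
  | [] => pure []
  | [l] => do
    let p ← mergeRuns P lt (2 ^ P.d * P.B) ([] :: l.runs)
    pure [⟨l.out ++ p.1, p.2.tail.take l.runs.length⟩]
  | l :: l₁ :: ls => do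
    let ls' ← if l₁.out.size < 2 ^ P.d * P.B then refill P lt (l₁ :: ls) else pure (l₁ :: ls)
    match ls' with
    | [] => pure [l]
    | n :: ns => do
      let p ← mergeRuns P lt (2 ^ P.d * P.B) (n.out :: l.runs)
      pure (⟨l.out ++ p.1, p.2.tail.take l.runs.length⟩ :: { n with out := p.2.headD [] } :: ns)

/-- Move the full insertion buffer, and `del`, to the external part. -/
def PQ.flush {α : Type} (P : Params) (lt : α → α → Bool) (q : PQ α) : Prog (PQ α) := do
  alloc P.B
  let p ← q.ins.drain P.B lt q.cnt ⟨[], []⟩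
  let r ← p.2.finish P.B
  alloc (-P.B)
  let d ← Reader.close P.B ⟨q.del, []⟩
  let lvls ← addRuns P lt [r, d] q.lvls
  pure ⟨p.1, 0, [], lvls, q.ext + q.cnt + q.del.length⟩

def PQ.push {α : Type} (P : Params) (lt : α → α → Bool) (x : α) (q : PQ α) : Prog (PQ α) := do
  tick 1
  let q ← if q.cnt < 2 ^ P.e then pure q else q.flush P lt
  let t ← q.ins.insert lt x
  pure { q with ins := t, cnt := q.cnt + 1 }

/-- Make sure that `del` is not empty unless the external part is. -/
def PQ.load {α : Type} (P : Params) (lt : α → α → Bool) (q : PQ α) : Prog (PQ α) := do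
  tick 1
  if q.del.isEmpty && decide (0 < q.ext) then do
    let lvls ← match q.lvls with
      | [] => pure []
      | l :: ls => if l.out.isEmpty then refill P lt (l :: ls) else pure (l :: ls)
    match lvls with
    | [] => pure { q with lvls := lvls }
    | l :: ls => do
      let r ← Reader.fetch P.B l.out
      pure { q with
        del := r.cur
        lvls := { l with out := r.rest } :: ls
        ext := q.ext - r.cur.length }
  else pure q

/-- The first record, which stays in the queue. -/
def PQ.peek {α : Type} (P : Params) (lt : α → α → Bool) (q : PQ α) : Prog (Option α × PQ α) := do
  let q ← q.load P lt
  tick 1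
  pure (if better lt q.ins.top q.del.head? then q.ins.top else q.del.head?, q)

/-- Remove the first record. -/
def PQ.pop {α : Type} (P : Params) (lt : α → α → Bool) (q : PQ α) : Prog (Option α × PQ α) := do
  let q ← q.load P lt
  tick 1
  if better lt q.ins.top q.del.head? then do
    let p ← q.ins.pop P.B lt
    pure (p.1, { q with ins := p.2, cnt := q.cnt - 1 })
  else pure (q.del.head?, { q with del := q.del.tail })

/-! ### Ordered binary decision diagrams -/

/-- Unique identifier of a node: its level and its index on that level. -/
abbrev Uid : Type := ℕ × ℕ

def Uid.lt (a b : Uid) : Bool := decide (a.1 < b.1) || (decide (a.1 = b.1) && decide (a.2 < b.2))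

/-- Target of an arc: a terminal or an internal node. -/
inductive Ptr where
  | term (b : Bool) : Ptr
  | node (u : Uid) : Ptr
  deriving DecidableEq

def Ptr.lt : Ptr → Ptr → Bool
  | .node u, .node v => u.lt v
  | .node _, .term _ => true
  | .term _, .node _ => false
  | .term a, .term b => !a && b

structure Node where
  uid : Uid
  low : Ptr
  high : Ptr

/-- A (not necessarily reduced) OBDD with at least one internal node: internal nodes in levelised order,
children strictly deeper than their parents, a single root (the first node), all nodes reachable. -/
structure OBDD where
  nodes : List Node
  nonempty : nodes ≠ []
  sorted : nodes.Pairwise fun v w => v.uid.lt w.uid = true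
  ordered : ∀ v ∈ nodes, ∀ u : Uid, (v.low = .node u ∨ v.high = .node u) →
    v.uid.1 < u.1 ∧ ∃ w ∈ nodes, w.uid = u
  rooted : ∀ v ∈ nodes.tail, ∃ p ∈ nodes, p.low = .node v.uid ∨ p.high = .node v.uid

/-- Number of internal nodes. -/
def OBDD.size (f : OBDD) : ℕ := f.nodes.length

/-- The levels of `f`, deepest first. -/
def OBDD.levels (f : OBDD) : List ℕ := (f.nodes.map fun v => v.uid.1).dedup.reverse

/-- An arc, solid (`high`) or dashed. The source `none` marks the arc into the root. -/
structure Arc where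
  src : Option Uid
  high : Bool
  tgt : Ptr

/-- The two arcs out of each node, and the arc into the root; deepest source first. -/
def OBDD.arcs (f : OBDD) : List Arc :=
  f.nodes.reverse.flatMap (fun v => [⟨some v.uid, true, v.high⟩, ⟨some v.uid, false, v.low⟩]) ++
    (f.nodes.take 1).map fun v => ⟨none, false, .node v.uid⟩

def Ptr.isTerm : Ptr → Bool
  | .term _ => true
  | .node _ => false

/-- Arcs to terminals, deepest source first. -/
def OBDD.terminalArcs (f : OBDD) : List Arc := f.arcs.filter fun a => a.tgt.isTerm

/-- Transposed internal arcs: deepest target first. -/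
def OBDD.internalArcs (f : OBDD) : List Arc :=
  (f.arcs.filter fun a => !a.tgt.isTerm).mergeSort fun a b => !(a.tgt.lt b.tgt)

/-! ### The outer Reduce sweep -/

/-- Target of a request: a subtree to be preserved, or a pair of subtrees to be combined. -/
inductive Target where
  | keep (t : Ptr) : Target
  | pair (lo hi : Ptr) : Target

/-- Request to the inner Apply sweep on behalf of the unreduced parent `src`. -/
structure Request where
  src : Option Uid
  high : Bool
  tgt : Target

/-- The unreduced node `old` is to be replaced by `new`. -/
structure Redirect where
  old : Uid
  new : Target

/-- Arcs by source, deepest first; the arc into the root last; of two siblings the solid one first. -/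
def arcLt (a b : Arc) : Bool :=
  match a.src, b.src with
  | none, _ => false
  | some _, none => true
  | some u, some v => v.lt u || (decide (u = v) && a.high && !b.high)

/-- Nodes by their children. -/
def nodeLt (v w : Node) : Bool := v.low.lt w.low || (decide (v.low = w.low) && v.high.lt w.high)

/-- Redirections, deepest first. -/
def redirectLt (a b : Redirect) : Bool := b.old.lt a.old

def Target.first : Target → Ptr
  | .keep t => t
  | .pair lo hi => if hi.lt lo then hi else lo

/-- Requests by their topmost target, top-down. -/
def requestLt (a b : Request) : Bool := a.tgt.first.lt b.tgt.first

/-- An inner sweep (Apply and Reduce), as far as the outer sweep can see it: from the nested level, the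
nodes reduced so far and all pending requests, it makes a new list of reduced nodes and answers each
request by a node or terminal of it. -/
abbrev InnerSweep : Type := ℕ → List Node → List Request → List Node × (Request → Ptr)

/-- `arcs`, `terms`: input; `xs`: nested levels still to come, deepest first; `outerQ`: the bottom-up
priority queue; `innerQ`: top-down priority queue of requests made by the outer sweep; `carry`:
requests that the inner sweeps left for the next inner sweep; `byChild`, `byUid`: the sorters of the
current level; the nodes reduced so far are `base`, made by the inner sweeps, and `out`. -/
structure State where
  arcs : Reader Arc
  terms : Reader Arc
  xs : Reader ℕ
  outerQ : PQ Arc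
  innerQ : PQ Request
  carry : List Request
  byChild : PQ Node
  byUid : PQ Redirect
  out : Writer Node
  base : List Node

/-- The next arc out of an unreduced node, from the priority queue or the arcs to terminals. -/
def peekArc (P : Params) (st : State) : Prog (Option Arc × State) := do
  let p ← st.outerQ.peek P arcLt
  tick 1
  pure (if better arcLt p.1 st.terms.cur.head? then p.1 else st.terms.cur.head?,
    { st with outerQ := p.2 })

def popArc (P : Params) (st : State) : Prog (Option Arc × State) := do
  let p ← st.outerQ.peek P arcLt
  tick 1
  if better arcLt p.1 st.terms.cur.head? then do
    let r ← p.2.pop P arcLt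
    pure (r.1, { st with outerQ := r.2 })
  else do
    let r ← st.terms.next P.B
    pure (r.1, { st with outerQ := p.2, terms := r.2 })

/-- Take the two arcs of the next node of level `ℓ`. A redundant node is suppressed, any other node goes
to the sorter for duplicates. -/
def gather (P : Params) (ℓ : ℕ) (st : State) : Prog (State × Bool) := do
  let a ← peekArc P st
  match a.1.bind Arc.src with
  | none => pure (a.2, false)
  | some u =>
    if u.1 = ℓ then do
      let h ← popArc P a.2
      let l ← popArc P h.2
      tick 1
      match h.1, l.1 with
      | some h', some l' =>
        if l'.tgt = h'.tgt then do
          let q ← l.2.byUid.push P redirectLt ⟨u, .keep l'.tgt⟩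
          pure ({ l.2 with byUid := q }, true)
        else do
          let q ← l.2.byChild.push P nodeLt ⟨u, l'.tgt, h'.tgt⟩
          pure ({ l.2 with byChild := q }, true)
      | _, _ => pure (l.2, false)
    else pure (a.2, false)

/-- Take the next node in the order of children. It is merged with the previous reduced node `prev` if
that has the same children, and otherwise output as a new reduced node. The arcs to it will become arcs
to the reduced node or, on a nested level, requests for the pair of its children. -/
def dedupe (P : Params) (ℓ : ℕ) (nested : Bool) (s : State × Option Node × ℕ) :
    Prog ((State × Option Node × ℕ) × Bool) := do
  let (st, prev, i) := s
  let p ← st.byChild.pop P nodeLt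
  tick 1
  match p.1 with
  | none => pure (({ st with byChild := p.2 }, prev, i), false)
  | some v => do
    let st := { st with byChild := p.2 }
    let same := match prev with
      | none => false
      | some t => decide (t.low = v.low) && decide (t.high = v.high)
    let t : Node := if same then prev.getD v else ⟨(ℓ, i - 1), v.low, v.high⟩
    let out ← if same then pure st.out else st.out.put P.B t
    let q ← st.byUid.push P redirectLt
      ⟨v.uid, if nested then .pair t.low t.high else .keep (.node t.uid)⟩
    pure (({ st with out := out, byUid := q }, some t, if same then i else i - 1), true)

/-- The parent `src` is not above the next nested level. -/
def stays (x : Option ℕ) (src : Option Uid) : Bool :=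
  match x, src with
  | none, _ => true
  | some _, none => false
  | some j, some s => decide (j ≤ s.1)

/-- Forward one reduced target to the unreduced parent `src`. -/
def route (P : Params) (src : Option Uid) (high : Bool) (tgt : Target) (st : State) :
    Prog State := do
  tick 1
  match tgt with
  | .keep t =>
    if stays st.xs.cur.head? src then do
      let q ← st.outerQ.push P arcLt ⟨src, high, t⟩
      pure { st with outerQ := q }
    else do
      let q ← st.innerQ.push P requestLt ⟨src, high, tgt⟩
      pure { st with innerQ := q }
  | .pair _ _ => do
    let q ← st.innerQ.push P requestLt ⟨src, high, tgt⟩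
    pure { st with innerQ := q }

/-- Forward the new target to the next unreduced parent of `r.old`. -/
def forwardArc (P : Params) (r : Redirect) (st : State) : Prog (State × Bool) := do
  tick 1
  match st.arcs.cur.head? with
  | none => pure (st, false)
  | some a =>
    if a.tgt = .node r.old then do
      let p ← st.arcs.next P.B
      let st' ← route P a.src a.high r.new { st with arcs := p.2 }
      pure (st', true)
    else pure (st, false)

/-- Forward the new target of the next unreduced node to all its parents. -/
def forward (P : Params) (fuel : ℕ) (st : State) : Prog (State × Bool) := do
  let p ← st.byUid.pop P redirectLt
  tick 1
  match p.1 with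
  | none => pure ({ st with byUid := p.2 }, false)
  | some r => do
    let st' ← loopN fuel (forwardArc P r) { st with byUid := p.2 }
    pure (st', true)

/-- The inner sweep gives each answer to `outerQ`, or keeps it for the next inner sweep if the parent is
above the next nested level. -/
def giveBack (P : Params) (f : Request → Ptr) : List Request → State → Prog State
  | [], st => pure st
  | r :: rs, st =>
    if stays st.xs.cur.head? r.src then do
      let q ← st.outerQ.push P arcLt ⟨r.src, r.high, f r⟩
      giveBack P f rs { st with outerQ := q }
    else
      giveBack P f rs { st with carry := ⟨r.src, r.high, .keep (f r)⟩ :: st.carry }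

/-- At the end of the nested level `ℓ`, hand over to the inner sweep: it empties `innerQ`, takes over the
reduced nodes, and gives back its answers. Only advancing to the next nested level is charged. -/
def callInner (P : Params) (inner : InnerSweep) (ℓ : ℕ) (st : State) : Prog State := do
  let x ← st.xs.next P.B
  let reqs := st.innerQ.contents ++ st.carry
  let ans := inner ℓ (st.base ++ st.out.contents) reqs
  release (st.innerQ.blocks + st.out.done.length)
  uncharged (giveBack P ans.2 reqs
    { st with xs := x.2, innerQ := PQ.empty P, carry := [], out := ⟨[], []⟩, base := ans.1 })

/-- Process the deepest level that is left. -/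
def processLevel (P : Params) (inner : InnerSweep) (fuel : ℕ) (st : State) :
    Prog (State × Bool) := do
  let a ← peekArc P st
  match a.1.bind Arc.src with
  | none => pure (a.2, false)
  | some u => do
    let ℓ := u.1
    let nested := decide (a.2.xs.cur.head? = some ℓ)
    let st ← loopN fuel (gather P ℓ) a.2
    let s ← loopN fuel (dedupe P ℓ nested) (st, none, st.byChild.size)
    let st ← loopN fuel (forward P fuel) s.1
    let st ← if nested then callInner P inner ℓ st else pure st
    pure (st, true)

/-- The outer Reduce sweep on the transposed OBDD `f`, with inner sweeps at the levels in `X`. It returns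
the new root and the reduced nodes. Every loop consumes an arc or a node in each round, so the bound on
the number of rounds is never reached. -/
def outerReduce (P : Params) (f : OBDD) (X : Finset ℕ) (inner : InnerSweep) :
    Prog (Option Ptr × List Node) := do
  let fuel := f.arcs.length + 1
  alloc (4 * P.B)
  let arcs ← Reader.fetch P.B (toBlocks P.B f.internalArcs)
  let terms ← Reader.fetch P.B (toBlocks P.B f.terminalArcs)
  let xs ← Reader.fetch P.B (toBlocks P.B (f.levels.filter (· ∈ X)))
  let outerQ ← PQ.new P
  let innerQ ← PQ.new P
  let byChild ← PQ.new P
  let byUid ← PQ.new P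
  let st ← loopN fuel (processLevel P inner fuel)
    ⟨arcs, terms, xs, outerQ, innerQ, [], byChild, byUid, ⟨[], []⟩, []⟩
  let a ← peekArc P st
  let out ← a.2.out.finish P.B
  pure (a.1.map Arc.tgt, a.2.base ++ out.flatten)

/-- The meter before the sweep: only the input is on disk. -/
def Meter.initial (B : ℕ) (f : OBDD) (X : Finset ℕ) : Meter :=
  let n : ℕ := (toBlocks B f.internalArcs).length + (toBlocks B f.terminalArcs).length +
    (toBlocks B (f.levels.filter (· ∈ X))).length
  ⟨0, 0, n, n, 0, 0⟩

/-- The cost of the outer Reduce sweep with internal memory `M` and block size `B`, without the I/Os and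
steps of the inner sweeps. -/
def outerCost (M B : ℕ) (f : OBDD) (X : Finset ℕ) (inner : InnerSweep) : Meter :=
  (outerReduce (Params.ofMemory M B) f X inner (Meter.initial B f X)).2

/-- `sort(N)` for I/Os. -/
noncomputable def sortIO (M B N : ℕ) : ℝ :=
  (N : ℝ) / B * Real.logb ((M : ℝ) / B) ((N : ℝ) / B)

/-- `sort(N)` for time. -/
noncomputable def sortTime (N : ℕ) : ℝ := (N : ℝ) * Real.logb 2 N

end NestedSweep

namespace NestedSweep

/-! ### Running programs, and bounds on the meter -/

/-! The upper bound is an amortised analysis. In `ioPot` and `timePot` every block on disk has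
already paid for being read once, so that reads are free and writes cost double; I/Os are counted in
records, that is, multiplied by `B`. No statement about a priority queue concerns the order of its
records: the costs depend only on numbers of records, files and blocks.

The external part of a priority queue behaves like a counter in base `b = 2 ^ d - 1`. A flush adds
one file to the first level, and `b` files of a level are merged into one file of the next. Hence
`R` insertions create at most about `1 + log_b (R / 2 ^ e)` levels; `L` bounds this number. Three
kinds of savings pay for all merges: `pot` holds one unit for each merge that a record may still
take part in, `credit` saves for the next refill of the first level, and each record in the
insertion buffer holds `rate L`. An operation then costs `O(L)` record transfers and `O(d L + e)`
steps (`PQ.push_spec`, `PQ.peek_spec`, `PQ.pop_spec`).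

In the sweep each pending arc, request, node and redirection carries a constant `weight`, the number
of operations that it can still cause. Each round of an inner loop is paid for by the record that it
consumes, so its bound on the number of rounds does not enter the cost; only the last round of a
loop and the fixed work per level are paid for separately. `Counts` shows that no queue receives
more than `2 N + 1` insertions, whatever the inner sweeps answer, since each arc becomes at most one
request and each request is answered once. This gives `O(N)` operations in total
(`outerReduce_upper`). Disk usage is tracked exactly, and the slack in partly filled blocks is
bounded, so that the files of a queue stay linear in its insertions.

For the lower bound, take a binary tree with at least half of its nodes on the deepest level, all
with arcs to terminals only. Before any inner sweep can run, all these nodes are inserted into the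
sorter for duplicates without a deletion in between. After insertions only, the deepest level of
that queue has at least half of the external records, and each of them was moved once per level
(`InsertOnly.exists_top`, `PQ.Filled.cost`). I/Os and steps are never taken back, so this cost
remains.

Finally the number of levels is compared with `log N / log (M / B)` (`rate_le_log`,
`outerCost_lower`). -/

theorem bind_run {α β : Type} (p : Prog α) (f : α → Prog β) (s : Meter) :
    (p >>= f) s = f (p s).1 (p s).2 := rfl

theorem pure_run {α : Type} (a : α) (s : Meter) : (pure a : Prog α) s = (a, s) := rfl

/-- I/Os, in records, where the blocks on disk have prepaid for being read. -/
def Meter.ioPot (B : ℕ) (s : Meter) : ℤ := B * (s.io + s.disk)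

/-- Steps, where the blocks on disk have prepaid for being read. -/
def Meter.timePot (B : ℕ) (s : Meter) : ℤ := s.time + B * s.disk

/-- Upper bounds for a computation that takes the meter from `s` to `s'`: on the potentials (`j`, `t`),
the change of disk space (`dd`, exact), and the transient disk and memory space (`dp`, `mp`). -/
structure Within (B : ℕ) (s s' : Meter) (j t dd dp mp : ℤ) : Prop where
  io : s'.ioPot B ≤ s.ioPot B + j
  time : s'.timePot B ≤ s.timePot B + t
  disk : s'.disk = s.disk + dd
  le : dd ≤ dp
  diskPeak : s'.diskPeak ≤ max s.diskPeak (s.disk + dp)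
  mem : s'.mem = s.mem
  memPeak : s'.memPeak ≤ max s.memPeak (s.mem + mp)

theorem Within.refl (B : ℕ) (s : Meter) : Within B s s 0 0 0 0 0 := by
  constructor <;> simp

theorem Within.mono {B : ℕ} {s s' : Meter} {j t dd dp mp j' t' dd' dp' mp' : ℤ}
    (h : Within B s s' j t dd dp mp) (hj : j ≤ j') (ht : t ≤ t') (hd : dd = dd') (hp : dp ≤ dp')
    (hm : mp ≤ mp') : Within B s s' j' t' dd' dp' mp' := by
  obtain ⟨h1, h2, h3, h4, h5, h6, h7⟩ := h
  constructor <;> omega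

theorem Within.trans {B : ℕ} {s s' s'' : Meter} {j t dd dp mp j₂ t₂ dd₂ dp₂ mp₂ : ℤ}
    (h : Within B s s' j t dd dp mp) (h' : Within B s' s'' j₂ t₂ dd₂ dp₂ mp₂) :
    Within B s s'' (j + j₂) (t + t₂) (dd + dd₂) (max dp (dd + dp₂)) (max mp mp₂) := by
  obtain ⟨h1, h2, h3, h4, h5, h6, h7⟩ := h
  obtain ⟨k1, k2, k3, k4, k5, k6, k7⟩ := h'
  constructor <;> omega

/-- Lower bounds on the I/Os and steps of a computation. -/
structure AtLeast (s s' : Meter) (i t : ℕ) : Prop where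
  io : s.io + i ≤ s'.io
  time : s.time + t ≤ s'.time

theorem AtLeast.refl (s : Meter) : AtLeast s s 0 0 := ⟨le_rfl, le_rfl⟩

theorem AtLeast.mono {s s' : Meter} {i t i' t' : ℕ} (h : AtLeast s s' i t) (hi : i' ≤ i)
    (ht : t' ≤ t) : AtLeast s s' i' t' := by
  obtain ⟨h1, h2⟩ := h
  constructor <;> omega

theorem AtLeast.trans {s s' s'' : Meter} {i t i₂ t₂ : ℕ} (h : AtLeast s s' i t)
    (h' : AtLeast s' s'' i₂ t₂) : AtLeast s s'' (i + i₂) (t + t₂) := by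
  obtain ⟨h1, h2⟩ := h
  obtain ⟨k1, k2⟩ := h'
  constructor <;> omega

theorem tick_within (B n : ℕ) (s : Meter) : Within B s (tick n s).2 0 n 0 0 0 := by
  constructor <;> simp [tick, Meter.ioPot, Meter.timePot]
  omega

theorem tick_atLeast (n : ℕ) (s : Meter) : AtLeast s (tick n s).2 0 n := by
  constructor <;> simp [tick]

theorem readBlock_within {α : Type} (B : ℕ) (b : List α) (s : Meter) :
    Within B s (readBlock B b s).2 0 0 (-1) 0 0 := by
  constructor <;> simp [readBlock, Meter.ioPot, Meter.timePot]
  · ring_nf; rfl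
  · rfl

/-- One `B` pays for the transfer and the other is stored with the block for the read that will
later remove it. This is why `readBlock_within` charges nothing. -/
theorem writeBlock_within {α : Type} (B : ℕ) (b : List α) (s : Meter) :
    Within B s (writeBlock B b s).2 (2 * B) (2 * B) 1 1 0 := by
  constructor <;> simp [writeBlock, Meter.ioPot, Meter.timePot]
  · ring_nf; rfl
  · ring_nf; rfl

/-- Reserving `x` records of memory during a computation. -/
theorem Within.bracket {B : ℕ} {s s' : Meter} {x : ℤ} {j t dd dp mp : ℤ}
    (h : Within B (alloc x s).2 s' j t dd dp mp) (hx : 0 ≤ x) (hm : 0 ≤ mp) :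
    Within B s (alloc (-x) s').2 j t dd dp (x + mp) := by
  obtain ⟨h1, h2, h3, h4, h5, h6, h7⟩ := h
  simp only [alloc, Meter.ioPot, Meter.timePot] at *
  constructor <;> (try simp only [Meter.ioPot, Meter.timePot]) <;> omega

theorem AtLeast.bracket {s s' : Meter} {x : ℤ} {i t : ℕ} (h : AtLeast (alloc x s).2 s' i t) :
    AtLeast s (alloc (-x) s').2 i t := by
  obtain ⟨h1, h2⟩ := h
  exact ⟨h1, h2⟩

/-! ### Files, readers and writers -/

section Files

variable {α : Type} {B : ℕ}

/-- No block is empty or longer than `B`. -/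
def RunOK (B : ℕ) (r : Run α) : Prop := ∀ b ∈ r, b ≠ [] ∧ b.length ≤ B

/-- Unused space in the blocks of a file. -/
def Run.slack (B : ℕ) (r : Run α) : ℕ := (r.map fun b => B - b.length).sum

@[simp] theorem Run.size_nil : Run.size ([] : Run α) = 0 := rfl
@[simp] theorem Run.size_cons (b : List α) (r : Run α) :
    Run.size (b :: r) = b.length + Run.size r := by simp [Run.size]
@[simp] theorem Run.size_append (r r' : Run α) :
    Run.size (r ++ r') = Run.size r + Run.size r' := by simp [Run.size]
@[simp] theorem Run.slack_nil : Run.slack B ([] : Run α) = 0 := rfl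
@[simp] theorem Run.slack_cons (b : List α) (r : Run α) :
    Run.slack B (b :: r) = (B - b.length) + Run.slack B r := by simp [Run.slack]
@[simp] theorem Run.slack_append (r r' : Run α) :
    Run.slack B (r ++ r') = Run.slack B r + Run.slack B r' := by simp [Run.slack]

theorem Run.length_flatten (r : Run α) : r.flatten.length = Run.size r := by
  simp [Run.size, List.length_flatten]

theorem RunOK.nil : RunOK B ([] : Run α) := by simp [RunOK]

theorem RunOK.cons {b : List α} {r : Run α} :
    RunOK B (b :: r) ↔ (b ≠ [] ∧ b.length ≤ B) ∧ RunOK B r := by simp [RunOK]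

theorem RunOK.append {r r' : Run α} (h : RunOK B r) (h' : RunOK B r') : RunOK B (r ++ r') := by
  intro b hb
  rcases List.mem_append.1 hb with hb | hb
  exacts [h b hb, h' b hb]

/-- This identity is the exchange rate between blocks and records: once the slack is bounded, block
counts follow from record counts. -/
theorem RunOK.mul_length {r : Run α} (h : RunOK B r) :
    B * r.length = Run.size r + Run.slack B r := by
  induction r with
  | nil => simp
  | cons b r ih =>
    rw [RunOK.cons] at h
    have := ih h.2
    simp only [List.length_cons, Run.size_cons, Run.slack_cons, mul_add]
    omega

theorem RunOK.length_le_size {r : Run α} (h : RunOK B r) : r.length ≤ Run.size r := by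
  induction r with
  | nil => simp
  | cons b r ih =>
    rw [RunOK.cons] at h
    have := ih h.2
    have := List.length_pos_iff.2 h.1.1
    simp only [List.length_cons, Run.size_cons]
    omega

theorem RunOK.eq_nil {r : Run α} (h : RunOK B r) (h0 : Run.size r = 0) : r = [] := by
  have := h.length_le_size
  exact List.length_eq_zero_iff.1 (by omega)

theorem Run.slack_suffix {r r' : Run α} (hs : r' <:+ r) : Run.slack B r' ≤ Run.slack B r := by
  obtain ⟨t, rfl⟩ := hs
  simp

theorem Run.slack_tail_le (r : Run α) : Run.slack B r.tail ≤ Run.slack B r :=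
  Run.slack_suffix (List.tail_suffix r)

/-- A partly read block that goes back to disk becomes the first block of its file. Invariants
therefore bound the slack of the tail only, and the first block costs at most one more `B`. -/
theorem Run.slack_le_tail (r : Run α) : Run.slack B r ≤ Run.slack B r.tail + B := by
  cases r with
  | nil => simp
  | cons b r => simp; omega

/-- Number of records that are left. -/
def Reader.size (r : Reader α) : ℕ := r.cur.length + Run.size r.rest

/-- `rest_nil` records that blocks are fetched eagerly: the current block is empty only at the end
of the file, so its head is always the head of the stream. -/
structure ReaderOK (B : ℕ) (r : Reader α) : Prop where
  rest_nil : r.cur = [] → r.rest = []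
  cur_le : r.cur.length ≤ B
  rest : RunOK B r.rest

theorem ReaderOK.empty : ReaderOK B (⟨[], []⟩ : Reader α) := ⟨fun _ => rfl, by simp, RunOK.nil⟩

theorem ReaderOK.size_eq_zero {r : Reader α} (h : ReaderOK B r) : r.size = 0 ↔ r.cur = [] := by
  constructor
  · intro h0
    exact List.length_eq_zero_iff.1 (by simp only [Reader.size] at h0; omega)
  · intro h0
    simp [Reader.size, h0, h.rest_nil h0]

theorem fetch_spec {f : Run α} (h : RunOK B f) (s : Meter) :
    ∃ r s', Reader.fetch B f s = (r, s') ∧ ReaderOK B r ∧ r.cur = f.headD [] ∧ r.rest = f.tail ∧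
      r.size = Run.size f ∧ Within B s s' 0 0 (r.rest.length - f.length) 0 0 ∧
      AtLeast s s' 0 0 := by
  cases f with
  | nil =>
    refine ⟨⟨[], []⟩, s, rfl, ReaderOK.empty, rfl, rfl, rfl, ?_, AtLeast.refl s⟩
    simpa using Within.refl B s
  | cons b f =>
    rw [RunOK.cons] at h
    refine ⟨⟨b, f⟩, _, rfl, ⟨fun hb => absurd hb h.1.1, h.1.2, h.2⟩, rfl, rfl, by simp [Reader.size],
      (readBlock_within B b s).mono le_rfl le_rfl ?_ le_rfl le_rfl, ?_⟩
    · simp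
    · constructor <;> simp

theorem next_spec {r : Reader α} (h : ReaderOK B r) (s : Meter) :
    ∃ r' s', r.next B s = ((r.cur.head?, r'), s') ∧ ReaderOK B r' ∧ r'.rest <:+ r.rest ∧
      r.size = r'.size + r.cur.head?.toList.length ∧
      r.cur.tail ++ r.rest.flatten = r'.cur ++ r'.rest.flatten ∧
      Within B s s' 0 1 (r'.rest.length - r.rest.length) 0 0 ∧ AtLeast s s' 0 1 := by
  obtain ⟨cur, rest⟩ := r
  obtain ⟨h1, h2, h3⟩ := h
  match cur, h1, h2, h3 with
  | [], h1, h2, h3 =>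
    refine ⟨⟨[], rest⟩, (tick 1 s).2, rfl, ⟨h1, h2, h3⟩, List.suffix_rfl, by simp [Reader.size], by simp,
      ?_, tick_atLeast 1 s⟩
    simpa using tick_within B 1 s
  | [x], h1, h2, h3 =>
    obtain ⟨r', s', e, ok, hc, hr, hs, hw, ha⟩ := fetch_spec h3 (tick 1 s).2
    refine ⟨r', s', ?_, ok, ?_, ?_, ?_, ?_, ?_⟩
    · simp only [Reader.next, bind_run, pure_run, e]; rfl
    · rw [hr]; exact List.tail_suffix _
    · simp only [Reader.size] at hs ⊢; simp; omega
    · cases rest with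
      | nil => simp_all
      | cons b rest => simp_all
    · exact ((tick_within B 1 s).trans hw).mono (by simp) (by simp) (by simp) (by simp) (by simp)
    · exact ((tick_atLeast 1 s).trans ha).mono (by simp) (by simp)
  | x :: y :: xs, h1, h2, h3 =>
    refine ⟨⟨y :: xs, rest⟩, (tick 1 s).2, rfl, ⟨by simp, by simp at h2 ⊢; omega, h3⟩,
      List.suffix_rfl, by simp [Reader.size]; omega, by simp, ?_, tick_atLeast 1 s⟩
    simpa using tick_within B 1 s

theorem close_spec {r : Reader α} (h : ReaderOK B r) (s : Meter) :
    ∃ f s', r.close B s = (f, s') ∧ RunOK B f ∧ f.tail <:+ r.rest ∧ Run.size f = r.size ∧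
      f.length ≤ r.rest.length + 1 ∧
      Within B s s' (2 * B) (2 * B) (f.length - r.rest.length) 1 0 ∧ AtLeast s s' 0 0 := by
  obtain ⟨cur, rest⟩ := r
  obtain ⟨h1, h2, h3⟩ := h
  cases cur with
  | nil =>
    refine ⟨rest, s, rfl, h3, List.tail_suffix _, by simp [Reader.size], by simp, ?_, AtLeast.refl s⟩
    exact (Within.refl B s).mono (by positivity) (by positivity) (by simp) (by simp) (by simp)
  | cons x xs =>
    have e : (x :: xs).take B = x :: xs := List.take_of_length_le h2
    refine ⟨(x :: xs) :: rest, (writeBlock B (x :: xs) s).2, ?_, ?_, by simp, by simp [Reader.size], by simp, ?_, ?_⟩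
    · simp only [Reader.close, bind_run, pure_run, writeBlock, e]
    · rw [RunOK.cons]; exact ⟨⟨by simp, h2⟩, h3⟩
    · exact (writeBlock_within B _ s).mono le_rfl le_rfl (by simp) le_rfl le_rfl
    · constructor <;> simp [writeBlock]

/-- Number of records that have been put. -/
def Writer.size (w : Writer α) : ℕ := Run.size w.done + w.cur.length

structure WriterOK (B : ℕ) (w : Writer α) : Prop where
  cur_lt : w.cur.length < B
  done : ∀ b ∈ w.done, b.length = B

theorem WriterOK.empty (hB : 1 ≤ B) : WriterOK B (⟨[], []⟩ : Writer α) := ⟨hB, by simp⟩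

theorem WriterOK.runOK {w : Writer α} (h : WriterOK B w) : RunOK B w.done := by
  intro b hb
  have := h.done b hb
  have := h.cur_lt
  refine ⟨?_, by omega⟩
  rintro rfl
  simp at *; omega

theorem WriterOK.slack {w : Writer α} (h : WriterOK B w) : Run.slack B w.done = 0 := by
  simp only [Run.slack, List.sum_eq_zero_iff, List.mem_map]
  rintro x ⟨b, hb, rfl⟩
  simp [h.done b hb]

theorem WriterOK.size_eq {w : Writer α} (h : WriterOK B w) :
    w.size = B * w.done.length + w.cur.length := by
  rw [h.runOK.mul_length, h.slack, Writer.size, add_zero]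

theorem put_spec {w : Writer α} (h : WriterOK B w) (x : α) (s : Meter) :
    ∃ w' s', w.put B x s = (w', s') ∧ WriterOK B w' ∧ w'.size = w.size + 1 ∧
      w.done.length ≤ w'.done.length ∧
      Within B s s' (2 * B * (w'.done.length - w.done.length))
        (1 + 2 * B * (w'.done.length - w.done.length)) (w'.done.length - w.done.length)
        (w'.done.length - w.done.length) 0 ∧
      AtLeast s s' (w'.done.length - w.done.length) 0 := by
  have hc := h.cur_lt
  by_cases hlt : w.cur.length + 1 < B
  · refine ⟨⟨w.done, w.cur ++ [x]⟩, (tick 1 s).2, ?_, ⟨by simpa using hlt, h.done⟩,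
      by simp [Writer.size]; omega, le_rfl, ?_, ?_⟩
    · simp only [Writer.put, bind_run, pure_run, if_pos hlt]
    · simpa using tick_within B 1 s
    · simpa using (tick_atLeast 1 s).mono le_rfl (Nat.zero_le _)
  · have e : (w.cur ++ [x]).take B = w.cur ++ [x] := List.take_of_length_le (by simp; omega)
    refine ⟨⟨w.done ++ [w.cur ++ [x]], []⟩, (writeBlock B (w.cur ++ [x]) (tick 1 s).2).2, ?_, ?_, ?_, ?_, ?_, ?_⟩
    · simp only [Writer.put, bind_run, pure_run, if_neg hlt, writeBlock, e]
    · refine ⟨by simp; omega, ?_⟩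
      intro b hb
      rcases List.mem_append.1 hb with hb | hb
      · exact h.done b hb
      · simp only [List.mem_singleton] at hb
        subst hb; simp; omega
    · simp [Writer.size]; omega
    · simp
    · refine ((tick_within B 1 s).trans (writeBlock_within B _ _)).mono ?_ ?_ ?_ ?_ ?_ <;> simp
    · constructor <;> simp [writeBlock, tick]; omega

theorem finish_spec {w : Writer α} (h : WriterOK B w) (s : Meter) :
    ∃ f s', w.finish B s = (f, s') ∧ RunOK B f ∧ Run.size f = w.size ∧ Run.slack B f < B ∧
      (B ∣ w.size → Run.slack B f = 0) ∧ w.done.length ≤ f.length ∧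
      Within B s s' (2 * B * (f.length - w.done.length)) (2 * B * (f.length - w.done.length))
        (f.length - w.done.length) (f.length - w.done.length) 0 ∧
      AtLeast s s' (f.length - w.done.length) 0 := by
  have hs := h.slack
  have hr := h.runOK
  have hz := h.size_eq
  obtain ⟨done, cur⟩ := w
  cases cur with
  | nil =>
    refine ⟨done, s, rfl, hr, by simp [Writer.size], ?_, fun _ => hs, le_rfl, ?_, ?_⟩
    · rw [hs]; exact h.cur_lt
    · simpa using Within.refl B s
    · simpa using AtLeast.refl s
  | cons x xs =>
    have hc := h.cur_lt
    have e : (x :: xs).take B = x :: xs := List.take_of_length_le hc.le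
    refine ⟨done ++ [x :: xs], (writeBlock B (x :: xs) s).2, ?_, ?_, ?_, ?_, ?_, ?_, ?_, ?_⟩
    · simp only [Writer.finish, bind_run, pure_run, writeBlock, e]
    · exact hr.append (RunOK.cons.2 ⟨⟨by simp, hc.le⟩, RunOK.nil⟩)
    · simp [Writer.size]
    · simp only [Run.slack_append, hs, Run.slack_cons, Run.slack_nil, List.length_cons] at hc ⊢
      omega
    -- The block in memory has between `1` and `B - 1` records, so the total cannot be a multiple of
    -- `B`.
    · intro hd
      rw [hz] at hd
      have := (Nat.dvd_add_right (Nat.dvd_mul_right B done.length)).1 hd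
      have := Nat.le_of_dvd (by simp) this
      simp only at hc this
      omega
    · simp
    · exact (writeBlock_within B _ s).mono (by simp) (by simp) (by simp) (by simp) le_rfl
    · constructor <;> simp [writeBlock]

end Files

/-! ### Tournament trees -/

section Trees

variable {α : Type} {B : ℕ}

def Tree.leaves : Tree α → List (Reader α)
  | .leaf r => [r]
  | .node _ _ l r => l.leaves ++ r.leaves

/-- Number of records in the streams of a tree. -/
def Tree.recs (t : Tree α) : ℕ := (t.leaves.map Reader.size).sum

/-- Number of blocks on disk of the streams of a tree. -/
def Tree.blocks (t : Tree α) : ℕ := (t.leaves.map fun r => r.rest.length).sum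

/-- A perfect tree of the given height with correct labels. -/
def Tree.OK (B : ℕ) : ℕ → Tree α → Prop
  | 0, .leaf r => ReaderOK B r
  | 0, .node _ _ _ _ => False
  | _ + 1, .leaf _ => False
  | n + 1, .node w b l r => (w = none ↔ l.top = none ∧ r.top = none) ∧ b = (l.room || r.room) ∧
      Tree.OK B n l ∧ Tree.OK B n r

@[simp] theorem Tree.recs_leaf (r : Reader α) : (Tree.leaf r).recs = r.size := by
  simp [recs, leaves]
@[simp] theorem Tree.recs_node (w : Option α) (b : Bool) (l r : Tree α) :
    (Tree.node w b l r).recs = l.recs + r.recs := by simp [recs, leaves]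
@[simp] theorem Tree.blocks_leaf (r : Reader α) : (Tree.leaf r).blocks = r.rest.length := by
  simp [blocks, leaves]
@[simp] theorem Tree.blocks_node (w : Option α) (b : Bool) (l r : Tree α) :
    (Tree.node w b l r).blocks = l.blocks + r.blocks := by simp [blocks, leaves]

theorem Tree.length_contents (t : Tree α) : t.contents.length = t.recs := by
  induction t with
  | leaf r => simp [contents, Reader.size, Run.size]
  | node w b l r ihl ihr => simp [contents, ihl, ihr]

/-- Height and shape are recursed on together, so this principle replaces the case analysis that
discards trees of the wrong height. -/
theorem Tree.OK.induction {motive : ∀ (n : ℕ) (t : Tree α), Tree.OK B n t → Prop}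
    (leaf : ∀ r (h : ReaderOK B r), motive 0 (.leaf r) h)
    (node : ∀ n w b l r (hw : w = none ↔ l.top = none ∧ r.top = none) (hb : b = (l.room || r.room))
      (hl : Tree.OK B n l) (hr : Tree.OK B n r), motive n l hl → motive n r hr →
      motive (n + 1) (.node w b l r) ⟨hw, hb, hl, hr⟩) :
    ∀ {n : ℕ} {t : Tree α} (h : Tree.OK B n t), motive n t h := by
  intro n
  induction n with
  | zero =>
    intro t h
    cases t with
    | leaf r => exact leaf r h
    | node => exact h.elim
  | succ n ih =>
    intro t h
    cases t with
    | leaf r => exact h.elim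
    | node w b l r => exact node n w b l r h.1 h.2.1 h.2.2.1 h.2.2.2 (ih _) (ih _)

theorem Tree.OK.leaves {n : ℕ} {t : Tree α} (h : t.OK B n) : ∀ r ∈ t.leaves, ReaderOK B r := by
  induction h using Tree.OK.induction with
  | leaf r h => simpa [Tree.leaves] using h
  | node n w b l r hw hb hl hr ihl ihr =>
    intro x hx
    simp only [Tree.leaves, List.mem_append] at hx
    exact hx.elim (ihl x) (ihr x)

theorem Tree.OK.top_eq_none {n : ℕ} {t : Tree α} (h : t.OK B n) : t.top = none ↔ t.recs = 0 := by
  induction h using Tree.OK.induction with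
  | leaf r h => simp [Tree.top, h.size_eq_zero]
  | node n w b l r hw hb hl hr ihl ihr =>
    rw [recs_node, Nat.add_eq_zero_iff, ← ihl, ← ihr, ← hw]
    rfl

theorem Tree.OK.join {n : ℕ} {l r : Tree α} (lt : α → α → Bool) (hl : l.OK B n) (hr : r.OK B n) :
    (Tree.join lt l r).OK B (n + 1) := by
  refine ⟨?_, rfl, hl, hr⟩
  cases hl : l.top <;> cases hr : r.top <;> simp [better]
  split <;> simp

@[simp] theorem Tree.recs_join (lt : α → α → Bool) (l r : Tree α) :
    (Tree.join lt l r).recs = l.recs + r.recs := by simp [join]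
@[simp] theorem Tree.blocks_join (lt : α → α → Bool) (l r : Tree α) :
    (Tree.join lt l r).blocks = l.blocks + r.blocks := by simp [join]
@[simp] theorem Tree.leaves_node (w : Option α) (b : Bool) (l r : Tree α) :
    (Tree.node w b l r).leaves = l.leaves ++ r.leaves := rfl

theorem Tree.empty_ok (n : ℕ) : (Tree.empty n : Tree α).OK B n := by
  induction n with
  | zero => exact ReaderOK.empty
  | succ n ih =>
    refine ⟨?_, ?_, ih, ih⟩
    · cases n <;> simp [empty, top]
    · cases n <;> simp [empty, room]

theorem Tree.leaves_empty (n : ℕ) : ∀ r ∈ (Tree.empty n : Tree α).leaves, r = ⟨[], []⟩ := by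
  induction n with
  | zero => simp [empty, leaves]
  | succ n ih =>
    intro r hr
    simp only [empty, leaves_node, List.mem_append, or_self] at hr
    exact ih r hr

@[simp] theorem Tree.recs_empty (n : ℕ) : (Tree.empty n : Tree α).recs = 0 := by
  induction n with
  | zero => rfl
  | succ n ih => simp [empty, ih]

theorem Tree.top_empty (n : ℕ) : (Tree.empty n : Tree α).top = none := by
  cases n <;> rfl

/-- Every stream of the second tree is what is left of that of the first. -/
def Tree.Shrinks (t t' : Tree α) : Prop :=
  List.Forall₂ (fun r r' : Reader α => r'.rest <:+ r.rest ∧ r'.size ≤ r.size) t.leaves t'.leaves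

theorem Tree.Shrinks.refl (t : Tree α) : t.Shrinks t :=
  List.forall₂_same.2 fun _ _ => ⟨List.suffix_rfl, le_rfl⟩

theorem forall₂_trans {β γ δ : Type} {R : β → γ → Prop} {S : γ → δ → Prop} {T : β → δ → Prop}
    (h : ∀ a b c, R a b → S b c → T a c) {l₁ : List β} {l₂ : List γ} {l₃ : List δ}
    (h₁ : List.Forall₂ R l₁ l₂) (h₂ : List.Forall₂ S l₂ l₃) : List.Forall₂ T l₁ l₃ := by
  induction h₁ generalizing l₃ with
  | nil => cases h₂; exact .nil
  | cons hab _ ih =>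
    cases h₂ with
    | cons hbc h₂ => exact .cons (h _ _ _ hab hbc) (ih h₂)

theorem forall₂_exists_left {β γ : Type} {R : β → γ → Prop} {l₁ : List β} {l₂ : List γ}
    (h : List.Forall₂ R l₁ l₂) : ∀ c ∈ l₂, ∃ b ∈ l₁, R b c := by
  induction h with
  | nil => simp
  | cons h _ ih =>
    intro c hc
    rcases List.mem_cons.1 hc with rfl | hc
    · exact ⟨_, List.mem_cons_self, h⟩
    · obtain ⟨b, hb, h⟩ := ih c hc
      exact ⟨b, List.mem_cons_of_mem _ hb, h⟩

theorem Tree.Shrinks.trans {t t' t'' : Tree α} (h : t.Shrinks t') (h' : t'.Shrinks t'') :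
    t.Shrinks t'' :=
  forall₂_trans (fun _ _ _ h h' => ⟨h'.1.trans h.1, h'.2.trans h.2⟩) h h'

/-- The path is followed by labels alone. A label is `none` exactly if both subtrees are exhausted,
so the descent never ends at an empty leaf while another one has records. -/
theorem Tree.pop_spec {lt : α → α → Bool} {n : ℕ} {t : Tree α} (h : t.OK B n) (s : Meter) :
    ∃ o t' s', t.pop B lt s = ((o, t'), s') ∧ t'.OK B n ∧ t.recs = t'.recs + o.toList.length ∧
      (o = none → t.recs = 0) ∧ t.Shrinks t' ∧
      Within B s s' 0 (n + 1) (t'.blocks - t.blocks) 0 0 ∧ AtLeast s s' 0 (n + 1) := by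
  induction h using Tree.OK.induction generalizing s with
  | leaf r h =>
    obtain ⟨r', s', e, ok, hs, hz, -, hw, ha⟩ := next_spec h s
    refine ⟨r.cur.head?, .leaf r', s', ?_, ok, by simpa using hz, ?_, ?_, ?_, ha⟩
    · simp only [Tree.pop, bind_run, pure_run, e]
    · intro h0
      simpa [h.size_eq_zero] using h0
    · exact .cons ⟨hs, by omega⟩ .nil
    · simpa using hw
  | node n w b l r hw hb hl hr ihl ihr =>
    by_cases hc : better lt l.top r.top
    · obtain ⟨o, t', s', e, ok, hz, hn, hs, hw', ha⟩ := ihl (tick 1 s).2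
      refine ⟨o, Tree.join lt t' r, s', ?_, ok.join lt hr, by simp; omega, ?_, ?_, ?_, ?_⟩
      · simp only [Tree.pop, bind_run, pure_run, hc, if_true, e]
      · rintro rfl
        have := hl.top_eq_none.2 (hn rfl)
        simp [this, better] at hc
      · exact List.rel_append hs (Tree.Shrinks.refl r)
      · exact ((tick_within B 1 s).trans hw').mono (by simp) (by push_cast; omega) (by simp)
          (by simp) (by simp)
      · exact ((tick_atLeast 1 s).trans ha).mono (by simp) (by omega)
    · obtain ⟨o, t', s', e, ok, hz, hn, hs, hw', ha⟩ := ihr (tick 1 s).2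
      refine ⟨o, Tree.join lt l t', s', ?_, hl.join lt ok, by simp; omega, ?_, ?_, ?_, ?_⟩
      · simp only [Tree.pop, bind_run, pure_run, if_neg hc, e]
      · rintro rfl
        have h0 := hr.top_eq_none.2 (hn rfl)
        have : l.top = none := by
          cases hl : l.top
          · rfl
          · simp [hl, h0, better] at hc
        simp [hl.top_eq_none.1 this, hn rfl]
      · exact List.rel_append (Tree.Shrinks.refl l) hs
      · exact ((tick_within B 1 s).trans hw').mono (by simp) (by push_cast; omega) (by simp)
          (by simp) (by simp)
      · exact ((tick_atLeast 1 s).trans ha).mono (by simp) (by omega)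

/-- Every stream has at most one record. -/
def Tree.Small (t : Tree α) : Prop := ∀ r ∈ t.leaves, r.size ≤ 1

theorem Tree.Small.shrinks {t t' : Tree α} (h : t.Small) (hs : t.Shrinks t') : t'.Small := by
  intro r' hr'
  obtain ⟨r, hr, hrr⟩ := forall₂_exists_left hs r' hr'
  exact hrr.2.trans (h r hr)

theorem Tree.Small.node {w : Option α} {b : Bool} {l r : Tree α} :
    (Tree.node w b l r).Small ↔ l.Small ∧ r.Small := by
  simp [Tree.Small, or_imp, forall_and]

theorem Tree.empty_small (n : ℕ) : (Tree.empty n : Tree α).Small := by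
  intro r hr
  rw [Tree.leaves_empty n r hr]
  simp [Reader.size]

theorem ReaderOK.rest_of_small {r : Reader α} (h : ReaderOK B r) (hs : r.size ≤ 1) :
    r.rest = [] := by
  by_cases hc : r.cur = []
  · exact h.rest_nil hc
  · have := List.length_pos_iff.2 hc
    exact h.rest.eq_nil (by simp only [Reader.size] at hs; omega)

theorem Tree.Small.recs_le {n : ℕ} {t : Tree α} (h : t.OK B n) (hs : t.Small) :
    t.recs ≤ 2 ^ n := by
  induction h using Tree.OK.induction with
  | leaf r h => simpa using hs r (by simp [leaves])
  | node n w b l r hw hb hl hr ihl ihr =>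
    rw [Tree.Small.node] at hs
    have := ihl hs.1
    have := ihr hs.2
    simp only [recs_node, pow_succ]
    omega

theorem Tree.Small.blocks {n : ℕ} {t : Tree α} (h : t.OK B n) (hs : t.Small) : t.blocks = 0 := by
  simp only [Tree.blocks, List.sum_eq_zero_iff, List.mem_map]
  rintro x ⟨r, hr, rfl⟩
  simp [(h.leaves r hr).rest_of_small (hs r hr)]

/-- With at most one record per leaf, the number of records is the number of occupied leaves. Hence
the `room` bits lead an insertion to a vacant leaf as long as the buffer is not full. -/
theorem Tree.Small.room_iff {n : ℕ} {t : Tree α} (h : t.OK B n) (hs : t.Small) :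
    t.room = true ↔ t.recs < 2 ^ n := by
  induction h using Tree.OK.induction with
  | leaf r h => simp [room, h.size_eq_zero]
  | node n w b l r hw hb hl hr ihl ihr =>
    rw [Tree.Small.node] at hs
    have := hs.1.recs_le hl
    have := hs.2.recs_le hr
    have e : (Tree.node w b l r).room = (l.room || r.room) := hb
    rw [e, Bool.or_eq_true, ihl hs.1, ihr hs.2, recs_node, pow_succ]
    omega

theorem Tree.insert_spec {lt : α → α → Bool} {n : ℕ} {t : Tree α} (hB : 1 ≤ B) (h : t.OK B n)
    (hs : t.Small) (hr : t.recs < 2 ^ n) (x : α) (s : Meter) :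
    ∃ t' s', t.insert lt x s = (t', s') ∧ t'.OK B n ∧ t'.Small ∧ t'.recs = t.recs + 1 ∧
      Within B s s' 0 (n + 1) 0 0 0 ∧ AtLeast s s' 0 (n + 1) := by
  induction h using Tree.OK.induction generalizing s with
  | leaf r h =>
    have hz : r.size = 0 := by simpa using hr
    have hc := h.size_eq_zero.1 hz
    have hn := h.rest_nil hc
    refine ⟨.leaf ⟨[x], r.rest⟩, (tick 1 s).2, ?_, ?_, ?_, ?_, ?_, tick_atLeast 1 s⟩
    · simp only [Tree.insert, bind_run, hc]; rfl
    · exact ⟨by simp, by simpa using hB, h.rest⟩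
    · simp [Tree.Small, leaves, Reader.size, hn]
    · simp [Reader.size, hn, hc]
    · simpa using tick_within B 1 s
  | node n w b l r hw hb hl hr' ihl ihr =>
    rw [Tree.Small.node] at hs
    by_cases hc : l.room
    · obtain ⟨t', s', e, ok, sm, hz, hw', ha⟩ := ihl hs.1 ((hs.1.room_iff hl).1 hc) (tick 1 s).2
      refine ⟨Tree.join lt t' r, s', ?_, ok.join lt hr', ?_, by simp; omega, ?_, ?_⟩
      · simp only [Tree.insert, bind_run, hc, if_true, pure_run, e]
      · exact Tree.Small.node.2 ⟨sm, hs.2⟩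
      · exact ((tick_within B 1 s).trans hw').mono (by simp) (by push_cast; omega) (by simp)
          (by simp) (by simp)
      · exact ((tick_atLeast 1 s).trans ha).mono (by simp) (by omega)
    · have : ¬ l.recs < 2 ^ n := fun hlt => hc ((hs.1.room_iff hl).2 hlt)
      have : r.recs < 2 ^ n := by simp only [recs_node, pow_succ] at hr; omega
      obtain ⟨t', s', e, ok, sm, hz, hw', ha⟩ := ihr hs.2 this (tick 1 s).2
      refine ⟨Tree.join lt l t', s', ?_, hl.join lt ok, ?_, by simp; omega, ?_, ?_⟩
      · simp only [Tree.insert, bind_run, if_neg hc, pure_run, e]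
      · exact Tree.Small.node.2 ⟨hs.1, sm⟩
      · exact ((tick_within B 1 s).trans hw').mono (by simp) (by push_cast; omega) (by simp)
          (by simp) (by simp)
      · exact ((tick_atLeast 1 s).trans ha).mono (by simp) (by omega)

/-- Per record, `n + 1` steps replay the path and one step puts the record into the writer. The
separate `n + 1` pays for one final attempt that finds the tree empty. -/
theorem Tree.drain_spec {lt : α → α → Bool} {n : ℕ} (m : ℕ) {t : Tree α} {w : Writer α}
    (h : t.OK B n) (hw : WriterOK B w) (s : Meter) :
    ∃ t' w' s', t.drain B lt m w s = ((t', w'), s') ∧ t'.OK B n ∧ t.Shrinks t' ∧ WriterOK B w' ∧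
      t.recs = t'.recs + min m t.recs ∧ w'.size = w.size + min m t.recs ∧
      w.done.length ≤ w'.done.length ∧
      Within B s s' (2 * B * (w'.done.length - w.done.length))
        ((n + 2) * (min m t.recs : ℕ) + (n + 1) + 2 * B * (w'.done.length - w.done.length))
        ((t'.blocks - t.blocks) + (w'.done.length - w.done.length))
        (w'.done.length - w.done.length) 0 ∧
      AtLeast s s' (w'.done.length - w.done.length) ((n + 1) * min m t.recs) := by
  induction m generalizing t w s with
  | zero =>
    refine ⟨t, w, s, rfl, h, .refl t, hw, by simp, by simp, le_rfl, ?_, ?_⟩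
    · exact (Within.refl B s).mono (by simp) (by simp; positivity) (by simp) (by simp) le_rfl
    · simpa using AtLeast.refl s
  | succ m ih =>
    obtain ⟨o, t₁, s₁, e₁, ok₁, hz₁, hn, hs₁, hw₁, ha₁⟩ := Tree.pop_spec (lt := lt) h s
    cases o with
    | none =>
      have h0 := hn rfl
      refine ⟨t₁, w, s₁, ?_, ok₁, hs₁, hw, ?_, by simp [h0], le_rfl, ?_, ?_⟩
      · simp only [Tree.drain, bind_run, e₁, pure_run]
      · simp [h0] at hz₁ ⊢; omega
      · exact hw₁.mono (by simp) (by simp [h0]) (by simp) (by simp) le_rfl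
      · exact ha₁.mono (by simp) (by simp [h0])
    | some x =>
      obtain ⟨w₂, s₂, e₂, ok₂, hz₂, hl₂, hw₂, ha₂⟩ := put_spec hw x s₁
      obtain ⟨t₃, w₃, s₃, e₃, ok₃, hs₃, okw₃, hz₃, hz₃', hl₃, hw₃, ha₃⟩ := ih ok₁ ok₂ s₂
      simp only [Option.toList_some, List.length_singleton] at hz₁
      have hmin : min (m + 1) t.recs = min m t₁.recs + 1 := by omega
      refine ⟨t₃, w₃, s₃, ?_, ok₃, hs₁.trans hs₃, okw₃, by omega, by omega, hl₂.trans hl₃, ?_, ?_⟩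
      · simp only [Tree.drain, bind_run, e₁, e₂, e₃]
      · have l1 := hw₁.le
        refine ((hw₁.trans hw₂).trans hw₃).mono ?_ ?_ ?_ ?_ (by simp)
        · apply le_of_eq; ring
        · rw [hmin]; push_cast; apply le_of_eq; ring
        · ring
        · omega
      · refine ((ha₁.trans ha₂).trans ha₃).mono (by omega) ?_
        rw [hmin]; apply le_of_eq; ring

/-- A list of files, filled up with empty files. -/
def padded (n : ℕ) (rs : List (Run α)) : List (Run α) := rs ++ List.replicate (n - rs.length) []

theorem padded_double {n : ℕ} {rs : List (Run α)} (h : rs.length ≤ 2 * n) :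
    padded (2 * n) rs = padded n (rs.take n) ++ padded n (rs.drop n) := by
  rcases le_total rs.length n with hn | hn
  · have : 2 * n - rs.length = (n - rs.length) + n := by omega
    rw [padded, padded, padded, List.take_of_length_le hn, List.drop_of_length_le hn, this,
      List.append_assoc, List.replicate_add]
    simp
  · have : 2 * n - rs.length = n - (rs.length - n) := by omega
    rw [padded, padded, padded, this, List.length_take_of_le hn, List.length_drop, Nat.sub_self,
      List.replicate_zero, List.append_nil, ← List.append_assoc, List.take_append_drop]

theorem Tree.opened_spec {lt : α → α → Bool} (d : ℕ) {rs : List (Run α)} (hl : rs.length ≤ 2 ^ d)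
    (h : ∀ r ∈ rs, RunOK B r) (s : Meter) :
    ∃ t s', Tree.opened B lt d rs s = (t, s') ∧ t.OK B d ∧ t.recs = (rs.map Run.size).sum ∧
      List.Forall₂ (fun f (r : Reader α) => r.rest = f.tail ∧ r.size = Run.size f)
        (padded (2 ^ d) rs) t.leaves ∧
      Within B s s' 0 (2 * 2 ^ d - 1) (t.blocks - (rs.map List.length).sum) 0 0 ∧
      AtLeast s s' 0 0 := by
  induction d generalizing rs s with
  | zero =>
    have hok : RunOK B (rs.headD []) := by
      cases rs with
      | nil => exact RunOK.nil
      | cons r rs => exact h r (by simp)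
    obtain ⟨r, s', e, ok, hc, hr, hz, hw, ha⟩ := fetch_spec hok (tick 1 s).2
    have hrs : padded 1 rs = [rs.headD []] ∧ (rs.map Run.size).sum = Run.size (rs.headD []) ∧
        (rs.map List.length).sum = (rs.headD []).length := by
      match rs, hl with
      | [], _ => simp [padded]
      | [r], _ => simp [padded]
    refine ⟨.leaf r, s', ?_, ok, ?_, ?_, ?_, ?_⟩
    · simp only [Tree.opened, bind_run, pure_run, e]
    · simp [hz, hrs.2.1]
    · simp only [pow_zero, hrs.1, leaves]
      exact .cons ⟨hr, hz⟩ .nil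
    · rw [hrs.2.2]
      exact ((tick_within B 1 s).trans hw).mono (by simp) (by simp) (by simp)
        (by simp) (by simp)
    · exact ((tick_atLeast 1 s).trans ha).mono (by simp) (by simp)
  | succ d ih =>
    obtain ⟨l, s₁, e₁, ok₁, hz₁, hf₁, hw₁, ha₁⟩ := ih (rs := rs.take (2 ^ d)) (by simp)
      (fun r hr => h r (List.mem_of_mem_take hr)) (tick 1 s).2
    obtain ⟨r, s₂, e₂, ok₂, hz₂, hf₂, hw₂, ha₂⟩ := ih (rs := rs.drop (2 ^ d))
      (by rw [pow_succ] at hl; simp; omega) (fun r hr => h r (List.mem_of_mem_drop hr)) s₁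
    refine ⟨Tree.join lt l r, s₂, ?_, ok₁.join lt ok₂, ?_, ?_, ?_, ?_⟩
    · simp only [Tree.opened, bind_run, pure_run, e₁, e₂]
    · rw [recs_join, hz₁, hz₂, ← List.sum_append, ← List.map_append, List.take_append_drop]
    · rw [pow_succ', padded_double (by rw [pow_succ] at hl; omega)]
      exact List.rel_append hf₁ hf₂
    · have hsum : (rs.map List.length).sum =
          ((rs.take (2 ^ d)).map List.length).sum + ((rs.drop (2 ^ d)).map List.length).sum := by
        rw [← List.sum_append, ← List.map_append, List.take_append_drop]
      have := hw₁.le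
      have := hw₂.le
      refine (((tick_within B 1 s).trans hw₁).trans hw₂).mono (by simp) ?_ ?_ (by omega) (by simp)
      · rw [pow_succ]; push_cast; omega
      · rw [hsum, blocks_join]; push_cast; ring
    · exact (((tick_atLeast 1 s).trans ha₁).trans ha₂).mono (by simp) (by simp)

theorem Tree.closed_spec {n : ℕ} {t : Tree α} (h : t.OK B n) (s : Meter) :
    ∃ fs s', t.closed B s = (fs, s') ∧ (fs.map Run.size).sum = t.recs ∧
      List.Forall₂ (fun (r : Reader α) f => Run.size f = r.size ∧ RunOK B f ∧ f.tail <:+ r.rest)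
        t.leaves fs ∧
      Within B s s' (2 * B * 2 ^ n) (2 * 2 ^ n - 1 + 2 * B * 2 ^ n)
        ((fs.map List.length).sum - t.blocks) (2 ^ n) 0 ∧
      AtLeast s s' 0 0 := by
  induction h using Tree.OK.induction generalizing s with
  | leaf r h =>
    obtain ⟨f, s', e, ok, ht, hz, hl, hw, ha⟩ := close_spec h (tick 1 s).2
    refine ⟨[f], s', ?_, by simpa using hz, .cons ⟨hz, ok, ht⟩ .nil, ?_, ?_⟩
    · simp only [Tree.closed, bind_run, pure_run, e]
    · refine ((tick_within B 1 s).trans hw).mono (by simp) (by simp) (by simp) (by simp) (by simp)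
    · exact ((tick_atLeast 1 s).trans ha).mono (by simp) (by simp)
  | node n w b l r hw hb hl hr ihl ihr =>
    obtain ⟨f₁, s₁, e₁, hz₁, hf₁, hw₁, ha₁⟩ := ihl (tick 1 s).2
    obtain ⟨f₂, s₂, e₂, hz₂, hf₂, hw₂, ha₂⟩ := ihr s₁
    refine ⟨f₁ ++ f₂, s₂, ?_, by simp [hz₁, hz₂], List.rel_append hf₁ hf₂, ?_, ?_⟩
    · simp only [Tree.closed, bind_run, pure_run, e₁, e₂]
    · have := hw₁.le
      have := hw₂.le
      have : (0 : ℤ) < 2 ^ n := by positivity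
      refine (((tick_within B 1 s).trans hw₁).trans hw₂).mono ?_ ?_ ?_ ?_ (by simp)
      · apply le_of_eq; ring
      · simp only [pow_succ]
        have : (2 * (B : ℤ) * (2 ^ n * 2)) = 2 * B * 2 ^ n + 2 * B * 2 ^ n := by ring
        omega
      · simp; ring
      · simp only [pow_succ]; omega
    · exact (((tick_atLeast 1 s).trans ha₁).trans ha₂).mono (by simp) (by simp)

end Trees

/-! ### Merging files -/

section Merging

variable {α : Type} {B : ℕ}

/-- Records that one multiway merge reads at least. -/
def Params.cap (P : Params) : ℕ := 2 ^ P.d * P.B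

/-- The parameters that an internal memory of at least `32 B` records gives. -/
structure Params.OK (P : Params) : Prop where
  B_pos : 1 ≤ P.B
  two_le_d : 2 ≤ P.d
  cap_le : P.cap ≤ 8 * 2 ^ P.e
  B_le : P.B ≤ 2 * 2 ^ P.e

/-- Transient internal memory of a multiway merge. -/
def Params.mergeMem (P : Params) : ℕ := 2 ^ P.d * P.B + 2 ^ P.d + P.B

theorem Params.OK.four_le {P : Params} (hP : P.OK) : 4 ≤ 2 ^ P.d :=
  calc 4 = 2 ^ 2 := rfl
    _ ≤ 2 ^ P.d := Nat.pow_le_pow_right (by norm_num) hP.two_le_d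

theorem Params.OK.pow_le_cap {P : Params} (hP : P.OK) : 2 ^ P.d ≤ P.cap :=
  Nat.le_mul_of_pos_right _ hP.B_pos

theorem Params.OK.B_le_cap {P : Params} (hP : P.OK) : 4 * P.B ≤ P.cap :=
  Nat.mul_le_mul_right _ hP.four_le

theorem Params.OK.cap_pos {P : Params} (hP : P.OK) : 0 < P.cap := by
  have := hP.B_le_cap
  have := hP.B_pos
  omega

def runsSize (rs : List (Run α)) : ℕ := (rs.map Run.size).sum
def runsLength (rs : List (Run α)) : ℕ := (rs.map List.length).sum

@[simp] theorem runsSize_nil : runsSize ([] : List (Run α)) = 0 := rfl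
@[simp] theorem runsSize_cons (r : Run α) (rs : List (Run α)) :
    runsSize (r :: rs) = Run.size r + runsSize rs := by simp [runsSize]
@[simp] theorem runsSize_append (rs rs' : List (Run α)) :
    runsSize (rs ++ rs') = runsSize rs + runsSize rs' := by simp [runsSize]
@[simp] theorem runsLength_nil : runsLength ([] : List (Run α)) = 0 := rfl
@[simp] theorem runsLength_cons (r : Run α) (rs : List (Run α)) :
    runsLength (r :: rs) = r.length + runsLength rs := by simp [runsLength]
@[simp] theorem runsLength_append (rs rs' : List (Run α)) :
    runsLength (rs ++ rs') = runsLength rs + runsLength rs' := by simp [runsLength]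

theorem runsSize_le {rs : List (Run α)} (h : ∀ r ∈ rs, RunOK B r) :
    runsSize rs ≤ B * runsLength rs := by
  induction rs with
  | nil => simp
  | cons r rs ih =>
    have := ih fun r hr => h r (List.mem_cons_of_mem _ hr)
    have := (h r List.mem_cons_self).mul_length
    simp only [runsSize_cons, runsLength_cons, mul_add]
    omega

/-- `f'` is what is left of the file `f`. -/
structure Leftover (B : ℕ) (f f' : Run α) : Prop where
  size_le : Run.size f' ≤ Run.size f
  ok : RunOK B f'
  suffix : f'.tail <:+ f.tail

theorem Leftover.nil {f : Run α} (h : Leftover B [] f) : f = [] :=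
  h.ok.eq_nil (Nat.le_zero.1 h.size_le)

/-- The merge pads its inputs with empty files. What is left of a padding file is empty again, so
cutting the result to the original number of files loses neither records nor blocks. -/
theorem Leftover.split {r : Run α} {runs left : List (Run α)} {n : ℕ}
    (h : List.Forall₂ (Leftover B) (padded n (r :: runs)) left) :
    Leftover B r (left.headD []) ∧
      List.Forall₂ (Leftover B) runs (left.tail.take runs.length) ∧
      runsSize left = Run.size (left.headD []) + runsSize (left.tail.take runs.length) ∧
      runsLength left = (left.headD []).length + runsLength (left.tail.take runs.length) := by
  rw [padded, List.cons_append] at h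
  cases h with
  | cons h₁ h₂ =>
    rename_i f left
    have ht := List.forall₂_take runs.length h₂
    have hd := List.forall₂_drop runs.length h₂
    rw [List.take_left] at ht
    rw [List.drop_left] at hd
    have hnil : ∀ f ∈ left.drop runs.length, f = [] := by
      generalize left.drop runs.length = l, n - (r :: runs).length = m at *
      clear h₂ ht
      induction m generalizing l with
      | zero => cases hd; simp
      | succ m ih =>
        cases hd with
        | cons h hd =>
          intro f hf
          rcases List.mem_cons.1 hf with rfl | hf
          · exact h.nil
          · exact ih _ hd f hf
    have e : left = left.take runs.length ++ left.drop runs.length := (List.take_append_drop _ _).symm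
    have z₁ : runsSize (left.drop runs.length) = 0 := by
      simp only [runsSize, List.sum_eq_zero_iff, List.mem_map]
      rintro x ⟨f, hf, rfl⟩
      simp [hnil f hf]
    have z₂ : runsLength (left.drop runs.length) = 0 := by
      simp only [runsLength, List.sum_eq_zero_iff, List.mem_map]
      rintro x ⟨f, hf, rfl⟩
      simp [hnil f hf]
    refine ⟨h₁, ht, ?_, ?_⟩
    · have : runsSize left = runsSize (left.take runs.length) + runsSize (left.drop runs.length) := by
        rw [← runsSize_append, ← e]
      simp [this, z₁]
    · have : runsLength left =
          runsLength (left.take runs.length) + runsLength (left.drop runs.length) := by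
        rw [← runsLength_append, ← e]
      simp [this, z₂]

/-- The term `P.cap` is the overhead of opening and closing `2 ^ d` streams: closing may put back
one partial block per stream, at `2 * B` each. Writing the output costs twice its size plus less
than `2 * B` for a partial last block, and `4 * B ≤ P.cap`; the factor `4` absorbs everything. In
the time bound a record costs `d + 2` steps in the tree and the writer, and `10` leaves room for the
transfers and for the work on the `2 ^ d` leaves. -/
theorem mergeRuns_spec {P : Params} (hP : P.OK) {lt : α → α → Bool} (n : ℕ) {rs : List (Run α)}
    (hl : rs.length ≤ 2 ^ P.d) (h : ∀ r ∈ rs, RunOK P.B r) (s : Meter) :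
    ∃ out left s', mergeRuns P lt n rs s = ((out, left), s') ∧ RunOK P.B out ∧
      Run.size out = min n (runsSize rs) ∧ Run.slack P.B out < P.B ∧
      (P.B ∣ Run.size out → Run.slack P.B out = 0) ∧
      runsSize left + Run.size out = runsSize rs ∧
      List.Forall₂ (Leftover P.B) (padded (2 ^ P.d) rs) left ∧
      Within P.B s s' (4 * (Run.size out + P.cap)) ((P.d + 10) * (Run.size out + P.cap))
        (out.length + runsLength left - runsLength rs) (out.length + 2 ^ P.d) P.mergeMem ∧
      AtLeast s s' out.length ((P.d + 1) * Run.size out) := by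
  obtain ⟨t, s₁, e₁, ok₁, hz₁, hf₁, hw₁, ha₁⟩ := Tree.opened_spec (lt := lt) P.d hl h
    (alloc (2 ^ P.d * P.B + 2 ^ P.d + P.B) s).2
  obtain ⟨t₂, w₂, s₂, e₂, ok₂, hs₂, okw₂, hz₂, hz₂', hl₂, hw₂, ha₂⟩ :=
    Tree.drain_spec (lt := lt) n ok₁ (WriterOK.empty hP.B_pos) s₁
  obtain ⟨out, s₃, e₃, ok₃, hz₃, hsl₃, hd₃, hl₃, hw₃, ha₃⟩ := finish_spec okw₂ s₂
  obtain ⟨left, s₄, e₄, hz₄, hf₄, hw₄, ha₄⟩ := Tree.closed_spec ok₂ s₃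
  have hk : Run.size out = min n t.recs := by
    rw [hz₃, hz₂']; simp [Writer.size]
  have hrs : t.recs = runsSize rs := hz₁
  have hlen := ok₃.mul_length
  refine ⟨out, left, (alloc (-(2 ^ P.d * P.B + 2 ^ P.d + P.B)) s₄).2, ?_, ok₃, by rw [hk, hrs],
    hsl₃, by rwa [hz₃], ?_, ?_, ?_, ?_⟩
  · simp only [mergeRuns, bind_run, pure_run, e₁, e₂, e₃, e₄]
  · have : runsSize left = t₂.recs := hz₄
    omega
  · refine forall₂_trans (S := fun (r : Reader α) f => Run.size f ≤ r.size ∧ RunOK P.B f ∧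
      f.tail <:+ r.rest) (fun f r f' h h' => ⟨h.2 ▸ h'.1, h'.2.1, h.1 ▸ h'.2.2⟩) hf₁ ?_
    exact forall₂_trans (fun r r' f h h' => ⟨h'.1.le.trans h.2, h'.2.1, h'.2.2.trans h.1⟩) hs₂ hf₄
  · have h4 := hP.four_le
    have hc := hP.pow_le_cap
    have hB := hP.B_le_cap
    have hd2 : P.d < 2 ^ P.d := Nat.lt_two_pow_self
    have hcap : (2 : ℤ) * P.B * 2 ^ P.d = 2 * P.cap := by simp [Params.cap]; ring
    have hpow : ((2 ^ P.d : ℕ) : ℤ) = 2 ^ P.d := by push_cast; rfl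
    have hw := ((hw₁.trans hw₂).trans hw₃).trans hw₄
    have hlen' : (P.B : ℤ) * out.length = Run.size out + Run.slack P.B out := by exact_mod_cast hlen
    have := (hw.bracket (by positivity) (by simp)).mono (j' := 4 * (Run.size out + P.cap))
      (t' := (P.d + 10) * (Run.size out + P.cap))
      (dd' := out.length + runsLength left - runsLength rs) (dp' := out.length + 2 ^ P.d)
      (mp' := P.mergeMem) ?_ ?_ ?_ ?_ ?_
    · exact this
    · rw [hcap]
      simp only [List.length_nil]
      have : (2 : ℤ) * P.B * out.length = 2 * (P.B * out.length) := by ring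
      push_cast
      ring_nf at this hlen' ⊢
      zify at hsl₃ hB hc
      omega
    · rw [hcap, ← hk]
      simp only [List.length_nil]
      have : (2 : ℤ) * P.B * out.length = 2 * (P.B * out.length) := by ring
      have h0 : (0 : ℤ) ≤ P.d * P.cap := by positivity
      push_cast
      zify at hsl₃ hB hc h4 hd2
      nlinarith
    · simp only [runsLength, List.length_nil]
      push_cast
      ring
    · have h1 := hw₁.le
      have h2 := hw₂.le
      have h3 : (0 : ℤ) ≤ 2 ^ P.d := by positivity
      simp only [List.length_nil, Nat.cast_zero, sub_zero] at h1 h2 ⊢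
      zify at hl₃
      refine max_le (max_le (max_le ?_ ?_) ?_) ?_ <;> linarith
    · simp [Params.mergeMem]
  · exact ((((ha₁.trans ha₂).trans ha₃).trans ha₄).bracket).mono (by simp; omega)
      (by simp [hk])

theorem merge_length_le {P : Params} (hP : P.OK) {out : Run α} (h : RunOK P.B out)
    (hs : Run.slack P.B out < P.B) : out.length ≤ Run.size out / P.B + 1 := by
  have := h.mul_length
  have hB := hP.B_pos
  have : out.length < Run.size out / P.B + 2 := by
    apply lt_of_mul_lt_mul_left (a := P.B) _ (Nat.zero_le _)
    have := Nat.lt_div_mul_add (a := Run.size out) (b := P.B) (by omega)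
    nlinarith
  omega

/-- Merging files completely. -/
theorem mergeAll_spec {P : Params} (hP : P.OK) {lt : α → α → Bool} {rs : List (Run α)}
    (hl : rs.length ≤ 2 ^ P.d) (h : ∀ r ∈ rs, RunOK P.B r) (s : Meter) :
    ∃ out left s', mergeRuns P lt (runsSize rs) rs s = ((out, left), s') ∧ RunOK P.B out ∧
      Run.size out = runsSize rs ∧ Run.slack P.B out < P.B ∧ out.length ≤ runsLength rs ∧
      Within P.B s s' (4 * (runsSize rs + P.cap)) ((P.d + 10) * (runsSize rs + P.cap))
        (out.length - runsLength rs) ((runsSize rs / P.B : ℕ) + 1 + 2 ^ P.d) P.mergeMem ∧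
      AtLeast s s' out.length ((P.d + 1) * runsSize rs) := by
  obtain ⟨out, left, s', e, ok, hz, hs, -, hsum, hf, hw, ha⟩ :=
    mergeRuns_spec hP (lt := lt) (runsSize rs) hl h s
  rw [min_self] at hz
  have hleft : runsLength left = 0 := by
    have h0 : runsSize left = 0 := by omega
    have hok : ∀ f ∈ left, RunOK P.B f := by
      intro f hf'
      obtain ⟨_, -, h⟩ := forall₂_exists_left hf f hf'
      exact h.ok
    simp only [runsSize, runsLength, List.sum_eq_zero_iff, List.mem_map] at h0 ⊢
    rintro x ⟨f, hf, rfl⟩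
    simp [(hok f hf).eq_nil (h0 _ ⟨f, hf, rfl⟩)]
  have hlen := merge_length_le hP ok hs
  have hlen' : out.length ≤ runsLength rs := by
    have h1 := ok.mul_length
    have h2 := runsSize_le h
    have : out.length < runsLength rs + 1 := by
      apply lt_of_mul_lt_mul_left (a := P.B) _ (Nat.zero_le _)
      rw [mul_add]; omega
    omega
  rw [hz] at hw ha hlen
  refine ⟨out, left, s', e, ok, hz, hs, hlen', ?_, ha⟩
  refine hw.mono le_rfl le_rfl ?_ ?_ le_rfl
  · simp [hleft]
  · zify at hlen; push_cast; omega

/-! ### Levels of the external part of a priority queue -/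

def Lvl.size (l : Lvl α) : ℕ := Run.size l.out + runsSize l.runs
def Lvl.blocks (l : Lvl α) : ℕ := l.out.length + runsLength l.runs
def lvlsSize (ls : List (Lvl α)) : ℕ := (ls.map Lvl.size).sum
def lvlsBlocks (ls : List (Lvl α)) : ℕ := (ls.map Lvl.blocks).sum

@[simp] theorem lvlsSize_nil : lvlsSize ([] : List (Lvl α)) = 0 := rfl
@[simp] theorem lvlsSize_cons (l : Lvl α) (ls : List (Lvl α)) :
    lvlsSize (l :: ls) = Run.size l.out + runsSize l.runs + lvlsSize ls := by
  simp [lvlsSize, Lvl.size]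
@[simp] theorem lvlsBlocks_nil : lvlsBlocks ([] : List (Lvl α)) = 0 := rfl
@[simp] theorem lvlsBlocks_cons (l : Lvl α) (ls : List (Lvl α)) :
    lvlsBlocks (l :: ls) = l.out.length + runsLength l.runs + lvlsBlocks ls := by
  simp [lvlsBlocks, Lvl.blocks]

/-- The number of flushes, which the numbers of files on the levels write in base `b`. -/
def counter (b : ℕ) : List (Lvl α) → ℕ
  | [] => 0
  | l :: ls => l.runs.length + b * counter b ls

/-- Merge steps that the records of the external part have still ahead of them on the levels to the
depth `w`. -/
def pot (w : ℤ) : List (Lvl α) → ℤ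
  | [] => 0
  | l :: ls => w * runsSize l.runs + (w + 1) * Run.size l.out + pot (w - 1) ls

/-- Only the last block of `out` may be partial behind its head, and only if nothing is left to be
appended: a refill moves `P.cap` records, a multiple of `B`, unless it exhausts the files. The bound
on `runs.length` keeps each digit of the counter below its base, and the lower bound on `counter`
makes the number of levels logarithmic. Emptied files stay in `runs`, so that refills do not change
the counter. -/
def LvlsOK (P : Params) : List (Lvl α) → Prop
  | [] => True
  | l :: ls => RunOK P.B l.out ∧ (∀ r ∈ l.runs, RunOK P.B r ∧ Run.slack P.B r.tail ≤ P.B) ∧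
      (Run.slack P.B l.out.tail = 0 ∨
        Run.slack P.B l.out.tail ≤ P.B ∧ runsSize l.runs + lvlsSize ls = 0) ∧
      l.runs.length + 2 ≤ 2 ^ P.d ∧ (2 ^ P.d - 1) ^ ls.length ≤ counter (2 ^ P.d - 1) (l :: ls) ∧
      LvlsOK P ls

/-- The shape of the levels `k`, `k + 1`, … after insertions only. -/
def InsertOnly (P : Params) : ℕ → List (Lvl α) → Prop
  | _, [] => True
  | k, l :: ls => l.out = [] ∧ (∀ r ∈ l.runs, Run.size r = (2 ^ P.d - 1) ^ k * 2 ^ P.e) ∧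
      InsertOnly P (k + 1) ls

theorem runsSize_eq_mul {rs : List (Run α)} {c : ℕ} (h : ∀ r ∈ rs, Run.size r = c) :
    runsSize rs = rs.length * c := by
  simpa [runsSize] using List.sum_eq_card_nsmul (rs.map Run.size) c (by simpa using h)

/-- `m` is the number of records moved by the merges. A record that enters the files of a level
falls by exactly one unit of `pot`, whatever the value of `w`. Therefore the upper bound may use `w
= L` and the lower bound `w = 0` with the same `m`. The term `ls'.length * P.cap` is the overhead of
at most one merge per level. -/
theorem addRuns_spec {P : Params} (hP : P.OK) {lt : α → α → Bool} {ls : List (Lvl α)}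
    {inc : List (Run α)} (hl : inc.length + 1 ≤ 2 ^ P.d) (hinc : ∀ r ∈ inc, RunOK P.B r)
    (h : LvlsOK P ls) (s : Meter) :
    ∃ ls' s', addRuns P lt inc ls s = (ls', s') ∧ LvlsOK P ls' ∧
      counter (2 ^ P.d - 1) ls' = counter (2 ^ P.d - 1) ls + 1 ∧
      lvlsSize ls' = runsSize inc + lvlsSize ls ∧
      (∃ runs tl, ls' = ⟨[], runs⟩ :: tl) ∧
      (∀ k, InsertOnly P k ls → runsSize inc = (2 ^ P.d - 1) ^ k * 2 ^ P.e → InsertOnly P k ls') ∧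
      ∃ m : ℤ, (∀ w : ℤ, m = (w + 1) * runsSize inc + pot w ls - pot w ls') ∧
      Within P.B s s' (4 * (m + ls'.length * P.cap)) ((P.d + 10) * (m + ls'.length * P.cap))
        (lvlsBlocks ls' - lvlsBlocks ls - runsLength inc)
        (((runsSize inc + lvlsSize ls) / P.B : ℕ) + 1 + 2 ^ P.d) P.mergeMem ∧
      ∃ i t : ℕ, m ≤ P.B * i ∧ (P.d + 1) * m ≤ t ∧ AtLeast s s' i t := by
  have h4 := hP.four_le
  induction ls generalizing inc s with
  | nil =>
    obtain ⟨out, left, s', e, ok, hz, hs, hlen, hw, ha⟩ :=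
      mergeAll_spec hP (lt := lt) (rs := inc) (by omega) hinc s
    have hok := ok.mul_length
    refine ⟨[⟨[], [out]⟩], s', ?_, ?_, by simp [counter], by simp [hz], ⟨_, _, rfl⟩, ?_,
      runsSize inc, ?_, ?_, _, _, ?_, ?_, ha⟩
    · simp only [addRuns, bind_run, pure_run]
      rw [show (inc.map Run.size).sum = runsSize inc from rfl, e]
    · refine ⟨RunOK.nil, ?_, by simp, by simp; omega, by simp [counter], trivial⟩
      simpa using ⟨ok, (Run.slack_tail_le out).trans hs.le⟩
    · intro k _ hk
      exact ⟨rfl, by simpa [hz] using hk, trivial⟩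
    · intro w
      simp [pot, hz]; ring
    · refine hw.mono (by simp) (by simp) (by simp) (by simp) le_rfl
    · have : runsSize inc ≤ P.B * out.length := by omega
      exact_mod_cast this
    · push_cast; rfl
  | cons l ls ih =>
    obtain ⟨h1, h2, h3, h5, h6, h7⟩ := h
    obtain ⟨out, left, s', e, ok, hz, hs, hlen, hw, ha⟩ :=
      mergeAll_spec hP (lt := lt) (rs := l.out :: inc) (by simpa using hl)
        (by simpa [h1] using hinc) s
    have hok := ok.mul_length
    have hm : ((runsSize (l.out :: inc) : ℕ) : ℤ) ≤ P.B * out.length := by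
      have : runsSize (l.out :: inc) ≤ P.B * out.length := by omega
      exact_mod_cast this
    have hrun : addRuns P lt inc (l :: ls) s =
        if l.runs.length + 1 < 2 ^ P.d - 1 then (⟨[], out :: l.runs⟩ :: ls, s')
        else (⟨[], []⟩ :: (addRuns P lt (out :: l.runs) ls s').1,
          (addRuns P lt (out :: l.runs) ls s').2) := by
      simp only [addRuns, bind_run]
      rw [show ((l.out :: inc).map Run.size).sum = runsSize (l.out :: inc) from rfl, e]
      split <;> rfl
    have hdiv : ((runsSize (l.out :: inc) / P.B : ℕ) : ℤ) ≤
        ((runsSize inc + lvlsSize (l :: ls)) / P.B : ℕ) := by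
      exact_mod_cast Nat.div_le_div_right (by simp; omega)
    have hnew : ∀ r ∈ out :: l.runs, RunOK P.B r ∧ Run.slack P.B r.tail ≤ P.B := by
      intro r hr
      rcases List.mem_cons.1 hr with rfl | hr
      · exact ⟨ok, (Run.slack_tail_le r).trans hs.le⟩
      · exact h2 r hr
    have hcap : (0 : ℤ) ≤ P.cap := by positivity
    by_cases hfull : l.runs.length + 1 < 2 ^ P.d - 1
    · rw [if_pos hfull] at hrun
      refine ⟨_, _, hrun, ⟨RunOK.nil, hnew, by simp, by simp; omega, ?_, h7⟩,
        by simp [counter]; omega, by simp [hz]; omega, ⟨_, _, rfl⟩, ?_,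
        runsSize (l.out :: inc), ?_, ?_, _, _, hm, ?_, ha⟩
      · simp only [counter] at h6 ⊢; simp; omega
      · rintro k ⟨hk1, hk2, hk3⟩ hk
        refine ⟨rfl, ?_, hk3⟩
        intro r hr
        rcases List.mem_cons.1 hr with rfl | hr
        · simp [hz, hk1, hk]
        · exact hk2 r hr
      · intro w
        simp [pot, hz]; ring
      -- One merge was made and there is at least one level, so its overhead fits.
      · have hx : (runsSize (l.out :: inc) + P.cap : ℤ) ≤ runsSize (l.out :: inc) +
            (((⟨[], out :: l.runs⟩ :: ls : List (Lvl α)).length : ℕ) : ℤ) * P.cap := by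
          simp only [List.length_cons]; push_cast; nlinarith [Nat.zero_le ls.length]
        refine hw.mono (mul_le_mul_of_nonneg_left hx (by norm_num))
          (mul_le_mul_of_nonneg_left hx (by positivity)) ?_ ?_ le_rfl
        · simp; ring
        · linarith
      · push_cast; rfl
    · rw [if_neg hfull] at hrun
      obtain ⟨ls', s₂, e₂, ok₂, hc₂, hz₂, ⟨runs₂, tl₂, hls₂⟩, hp₂, m₂, hm₂, hw₂, i₂, t₂, hi₂, ht₂, ha₂⟩ :=
        ih (inc := out :: l.runs) (by simp; omega) (fun r hr => (hnew r hr).1) h7 s'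
      rw [e₂] at hrun
      refine ⟨_, _, hrun, ⟨RunOK.nil, by simp, by simp, by simp; omega, ?_, ok₂⟩, ?_,
        by simp [hz, hz₂]; omega, ⟨_, _, rfl⟩, ?_, runsSize (l.out :: inc) + m₂, ?_, ?_,
        out.length + i₂, (P.d + 1) * runsSize (l.out :: inc) + t₂, ?_, ?_, ha.trans ha₂⟩
      -- The overflow makes the deeper part nonempty, so its own lower bound on the counter applies;
      -- multiplication by the base accounts for the emptied digit in front.
      · rw [hls₂] at ok₂ ⊢
        have := ok₂.2.2.2.2.1
        simp only [List.length_cons, counter, pow_succ, List.length_nil, zero_add]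
        rw [mul_comm]
        exact Nat.mul_le_mul_left _ this
      · simp only [counter, hc₂, List.length_nil, mul_add]; omega
      · rintro k ⟨hk1, hk2, hk3⟩ hk
        -- The full level contributes `b - 1` files of the common size and the merged one is the
        -- `b`-th; together they have the size of one file of the next level.
        refine ⟨rfl, by simp, hp₂ _ hk3 ?_⟩
        have hr := runsSize_eq_mul hk2
        have hl : l.runs.length + 1 = 2 ^ P.d - 1 := by omega
        rw [runsSize_cons, hz, runsSize_cons, hk1, hk, hr, pow_succ, Run.size_nil]
        calc _ = (l.runs.length + 1) * ((2 ^ P.d - 1) ^ k * 2 ^ P.e) := by ring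
          _ = _ := by rw [hl]; ring
      · intro w
        rw [hm₂ (w - 1)]
        simp [pot, hz]; ring
      · have hx : (runsSize (l.out :: inc) + P.cap : ℤ) + (m₂ + ls'.length * P.cap) =
            runsSize (l.out :: inc) + m₂ +
            (((⟨[], []⟩ :: ls' : List (Lvl α)).length : ℕ) : ℤ) * P.cap := by
          simp only [List.length_cons]; push_cast; ring
        rw [← hx]
        refine (hw.trans hw₂).mono (by linarith) (by linarith) ?_ ?_ (by simp)
        · simp; ring
        · have : runsSize (out :: l.runs) + lvlsSize ls = runsSize inc + lvlsSize (l :: ls) := by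
            simp [hz]; omega
          rw [this]
          zify at hlen
          refine max_le (by linarith) (by linarith)
      · push_cast at hm ⊢; rw [mul_add]; linarith
      · push_cast; linarith

theorem Run.slack_tail_append_le (r r' : Run α) :
    Run.slack B (r ++ r').tail ≤ Run.slack B r.tail + Run.slack B r' := by
  cases r with
  | nil => simpa using Run.slack_tail_le r'
  | cons b r => simp

/-- Moving records to the `out` file of a level `l`, from its other files and a file `r₀`; there are `D`
records in the files behind. -/
theorem refill_step {P : Params} (hP : P.OK) {lt : α → α → Bool} {l : Lvl α} {r₀ : Run α} {D : ℕ}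
    (h₀ : RunOK P.B r₀) (hout : RunOK P.B l.out)
    (hruns : ∀ r ∈ l.runs, RunOK P.B r ∧ Run.slack P.B r.tail ≤ P.B)
    (hslack : Run.slack P.B l.out.tail = 0 ∨
      Run.slack P.B l.out.tail ≤ P.B ∧ runsSize l.runs + (Run.size r₀ + D) = 0)
    (hlen : l.runs.length + 2 ≤ 2 ^ P.d) (hD : P.cap ≤ Run.size r₀ ∨ D = 0) (s : Meter) :
    ∃ out left s' r₁ runs, mergeRuns P lt (2 ^ P.d * P.B) (r₀ :: l.runs) s = ((out, left), s') ∧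
      r₁ = left.headD [] ∧ runs = left.tail.take l.runs.length ∧ RunOK P.B r₁ ∧
      Run.slack P.B r₁.tail ≤ Run.slack P.B r₀.tail ∧
      (∀ r ∈ runs, RunOK P.B r ∧ Run.slack P.B r.tail ≤ P.B) ∧
      runs.length = l.runs.length ∧ RunOK P.B (l.out ++ out) ∧
      (Run.slack P.B (l.out ++ out).tail = 0 ∨
        Run.slack P.B (l.out ++ out).tail ≤ P.B ∧ runsSize runs + (Run.size r₁ + D) = 0) ∧
      (P.cap ≤ Run.size (l.out ++ out) ∨ runsSize runs + (Run.size r₁ + D) = 0) ∧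
      runsSize runs + Run.size r₁ + Run.size out = runsSize l.runs + Run.size r₀ ∧
      Run.size out ≤ P.cap ∧ Run.size r₁ ≤ Run.size r₀ ∧
      Within P.B s s' (4 * (2 * P.cap)) ((P.d + 10) * (2 * P.cap))
        (out.length + (r₁.length + runsLength runs) - (r₀.length + runsLength l.runs))
        (2 * 2 ^ P.d) P.mergeMem := by
  obtain ⟨out, left, s', e, ok, hz, hs, hdvd, hsum, hf, hw, -⟩ :=
    mergeRuns_spec hP (lt := lt) P.cap (rs := r₀ :: l.runs) (by simp; omega)
      (by simpa [h₀] using fun r hr => (hruns r hr).1) s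
  obtain ⟨hh, ht, hsz, hln⟩ := Leftover.split hf
  have hB := hP.B_pos
  have hcp := hP.cap_pos
  rw [runsSize_cons] at hz hsum
  rw [hsz] at hsum
  have htail := Run.slack_tail_append_le (B := P.B) l.out out
  have hfull : Run.size out = P.cap → Run.slack P.B out = 0 := fun hc =>
    hdvd (hc ▸ Dvd.intro_left _ rfl)
  have hempty : Run.size out = 0 → Run.slack P.B out = 0 := fun hc => hdvd (hc ▸ dvd_zero _)
  refine ⟨out, left, s', _, _, e, rfl, rfl, hh.ok, Run.slack_suffix hh.suffix, ?_,
    ht.length_eq.symm, hout.append ok, ?_, ?_, by omega, by omega, hh.size_le, ?_⟩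
  · intro f hf
    obtain ⟨r, hr, h⟩ := forall₂_exists_left ht f hf
    exact ⟨h.ok, (Run.slack_suffix h.suffix).trans (hruns r hr).2⟩
  -- If fewer than `P.cap` records came out, the merged files were exhausted, and by `hD` so was
  -- everything behind them. If the old `out` already ended in a partial block, there was nothing to
  -- append.
  · omega
  · rw [Run.size_append]; omega
  · have hl : out.length ≤ 2 ^ P.d := by
      have h1 := ok.mul_length
      have h2 : Run.size out ≤ P.cap := by omega
      have : out.length < 2 ^ P.d + 1 := by
        apply lt_of_mul_lt_mul_left (a := P.B) _ (Nat.zero_le _)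
        rw [mul_add, mul_comm P.B (2 ^ P.d)]
        simp only [Params.cap] at h2
        omega
      omega
    have hx : (Run.size out + P.cap : ℤ) ≤ 2 * P.cap := by
      have : Run.size out ≤ P.cap := by omega
      zify at this; linarith
    refine hw.mono (mul_le_mul_of_nonneg_left hx (by norm_num))
      (mul_le_mul_of_nonneg_left hx (by positivity)) ?_ ?_ le_rfl
    · rw [hln]; simp
    · zify at hl; linarith

/-- Each level is refilled by one merge of at most `P.cap` records, at a cost of at most `2 * P.cap`
units. A record moved to `out` rises by one in `pot`, because a later insertion may merge it back
into a file of this level; this explains the added `P.cap` per level. -/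
theorem refill_spec {P : Params} (hP : P.OK) {lt : α → α → Bool} {l : Lvl α} {ls : List (Lvl α)}
    (h : LvlsOK P (l :: ls)) (s : Meter) :
    ∃ l' ls' s', refill P lt (l :: ls) s = (l' :: ls', s') ∧ LvlsOK P (l' :: ls') ∧
      counter (2 ^ P.d - 1) (l' :: ls') = counter (2 ^ P.d - 1) (l :: ls) ∧
      l'.runs.length = l.runs.length ∧
      ls'.length = ls.length ∧ lvlsSize (l' :: ls') = lvlsSize (l :: ls) ∧
      (P.cap ≤ Run.size l'.out ∨ runsSize l'.runs + lvlsSize ls' = 0) ∧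
      (∀ w, pot w (l' :: ls') ≤ pot w (l :: ls) + (ls.length + 1) * P.cap) ∧
      Within P.B s s' (4 * (2 * (ls.length + 1) * P.cap))
        ((P.d + 10) * (2 * (ls.length + 1) * P.cap))
        (lvlsBlocks (l' :: ls') - lvlsBlocks (l :: ls)) (2 * (ls.length + 1) * 2 ^ P.d)
        P.mergeMem := by
  induction ls generalizing l s with
  | nil =>
    obtain ⟨h1, h2, h3, h5, h6, -⟩ := h
    obtain ⟨out, left, s', r₁, runs, e, he1, he2, ok₁, sl₁, okr, hlr, oko, hsl, hpost, hsum, hcap,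
      hle, hw⟩ := refill_step hP (lt := lt) (D := 0) (r₀ := []) RunOK.nil h1 h2 (by simpa using h3)
        h5 (Or.inr rfl) s
    have hr₁ : r₁ = [] := ok₁.eq_nil (by simpa using hle)
    subst hr₁
    simp only [Run.size_nil, add_zero] at hsl hpost hsum
    refine ⟨⟨l.out ++ out, runs⟩, [], s', ?_, ⟨oko, okr, by simpa using hsl, by simp [hlr, h5], ?_,
      trivial⟩, by simp [counter, hlr], hlr, rfl, by simp; omega, by simpa using hpost, ?_, ?_⟩
    · simp only [refill, bind_run, pure_run, e, he2]
    · simpa [counter, hlr] using h6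
    · intro w
      zify at hsum hcap
      simp only [pot, Run.size_append, List.length_nil]
      push_cast
      have : (w * runsSize runs + (w + 1) * (Run.size l.out + Run.size out) : ℤ) =
        w * runsSize l.runs + (w + 1) * Run.size l.out + Run.size out := by
        linear_combination w * hsum
      linarith
    · refine hw.mono ?_ ?_ ?_ ?_ le_rfl
      · simp
      · simp
      · simp; ring
      · simp
  | cons l₁ ls ih =>
    obtain ⟨h1, h2, h3, h5, h6, h7⟩ := h
    -- In both branches the next level now offers `P.cap` records in `out` or has nothing behind it,
    -- which is the hypothesis `hD` of the single step.
    have hrec : ∃ n ns s₁, (if l₁.out.size < 2 ^ P.d * P.B then refill P lt (l₁ :: ls) else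
          (pure (l₁ :: ls) : Prog (List (Lvl α)))) s = (n :: ns, s₁) ∧ LvlsOK P (n :: ns) ∧
        counter (2 ^ P.d - 1) (n :: ns) = counter (2 ^ P.d - 1) (l₁ :: ls) ∧
        ns.length = ls.length ∧ lvlsSize (n :: ns) = lvlsSize (l₁ :: ls) ∧
        (P.cap ≤ Run.size n.out ∨ runsSize n.runs + lvlsSize ns = 0) ∧
        (∀ w, pot w (n :: ns) ≤ pot w (l₁ :: ls) + (ls.length + 1) * P.cap) ∧
        Within P.B s s₁ (4 * (2 * (ls.length + 1) * P.cap))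
          ((P.d + 10) * (2 * (ls.length + 1) * P.cap))
          (lvlsBlocks (n :: ns) - lvlsBlocks (l₁ :: ls)) (2 * (ls.length + 1) * 2 ^ P.d)
          P.mergeMem := by
      by_cases hc : l₁.out.size < 2 ^ P.d * P.B
      · rw [if_pos hc]
        obtain ⟨n, ns, s₁, e, ok, hct, -, hr⟩ := ih h7 s
        exact ⟨n, ns, s₁, e, ok, hct, hr⟩
      · rw [if_neg hc]
        refine ⟨l₁, ls, s, rfl, h7, rfl, rfl, rfl, Or.inl (not_lt.1 hc), ?_, ?_⟩
        · intro w
          have : (0 : ℤ) ≤ (ls.length + 1) * P.cap := by positivity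
          linarith
        · exact (Within.refl _ _).mono (by positivity) (by positivity) (by simp) (by positivity)
            (by simp)
    obtain ⟨n, ns, s₁, e₁, ok, hct, hlen, hsz, hD, hpot, hw₁⟩ := hrec
    have ok' := ok
    obtain ⟨k1, k2, k3, k5, k6, k7⟩ := ok'
    rw [← hsz, lvlsSize_cons, add_assoc] at h3
    obtain ⟨out, left, s', r₁, runs, e, he1, he2, ok₁, sl₁, okr, hlr, oko, hsl, hpost, hsum, hcap,
      hle, hw⟩ := refill_step hP (lt := lt) (D := runsSize n.runs + lvlsSize ns) (r₀ := n.out) k1 h1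
        h2 (by simpa using h3) h5 hD s₁
    refine ⟨⟨l.out ++ out, runs⟩, { n with out := r₁ } :: ns, s', ?_, ⟨oko, okr, ?_,
      by simp [hlr, h5], ?_, ok₁, k2, ?_, k5, k6, k7⟩, ?_, hlr, by simp [hlen], ?_, ?_, ?_, ?_⟩
    · by_cases hc : l₁.out.size < 2 ^ P.d * P.B
      · rw [if_pos hc] at e₁
        simp only [refill, bind_run, if_pos hc, e₁, pure_run, e, he1, he2]
      · rw [if_neg hc] at e₁
        simp only [refill, bind_run, if_neg hc, e₁]
        simp only [pure_run, e, he1, he2]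
    · simpa only [lvlsSize_cons, add_assoc] using hsl
    · have : counter (2 ^ P.d - 1) ({ n with out := r₁ } :: ns) = counter (2 ^ P.d - 1) (n :: ns) :=
        rfl
      rw [counter, this, hct]
      simpa [hlr, hlen, counter] using h6
    · simp only
      rcases k3 with k3 | k3
      · left; omega
      · right; exact ⟨by omega, k3.2⟩
    · have : counter (2 ^ P.d - 1) ({ n with out := r₁ } :: ns) = counter (2 ^ P.d - 1) (n :: ns) :=
        rfl
      rw [counter, this, hct]
      simp [hlr, counter]
    · simp only [lvlsSize_cons, Run.size_append] at hsz ⊢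
      omega
    · simpa only [lvlsSize_cons, add_assoc] using hpost
    · intro w
      zify at hsum hcap
      have hp := hpot (w - 1)
      simp only [pot, Run.size_append, List.length_cons] at hp ⊢
      push_cast
      have : (w * runsSize runs + (w + 1) * (Run.size l.out + Run.size out) +
          ((w - 1 + 1) * Run.size r₁) : ℤ) =
        w * runsSize l.runs + (w + 1) * Run.size l.out + Run.size out + 
          ((w - 1 + 1) * Run.size n.out) := by
        linear_combination w * hsum
      nlinarith
    · refine (hw₁.trans hw).mono ?_ ?_ ?_ ?_ (by simp)
      · simp only [List.length_cons]; push_cast; apply le_of_eq; ring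
      · simp only [List.length_cons]; push_cast; apply le_of_eq; ring
      · simp; ring
      · have := hw₁.le
        simp only [List.length_cons]; push_cast
        refine max_le ?_ ?_
        · nlinarith [show (0 : ℤ) < 2 ^ P.d by positivity]
        · nlinarith

/-- The files of the deepest level have weight `w - (ls.length - 1)`, which the hypothesis keeps
nonnegative. -/
theorem pot_nonneg {ls : List (Lvl α)} {w : ℤ} (h : ls.length ≤ w + 1) : 0 ≤ pot w ls := by
  induction ls generalizing w with
  | nil => simp [pot]
  | cons l ls ih =>
    simp only [List.length_cons] at h
    push_cast at h
    have h1 : 0 ≤ pot (w - 1) ls := ih (by linarith)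
    have h2 : 0 ≤ w := by linarith [Int.natCast_nonneg ls.length]
    simp only [pot]
    positivity

end Merging

/-! ### The priority queue -/

section Queue

variable {α : Type}

/-- The number of insertions so far is at least this. -/
def PQ.age (P : Params) (q : PQ α) : ℕ := counter (2 ^ P.d - 1) q.lvls * 2 ^ P.e + q.cnt

/-- In `total` the counter is never decreased by deletions, so it bounds the records from above even
when most of them have left. -/
structure PQ.WF (P : Params) (q : PQ α) : Prop where
  ins : q.ins.OK P.B P.e
  small : q.ins.Small
  cnt : q.ins.recs = q.cnt
  del : q.del.length ≤ P.B
  lvls : LvlsOK P q.lvls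
  ext : q.ext = lvlsSize q.lvls
  total : q.del.length + q.ext ≤ counter (2 ^ P.d - 1) q.lvls * 2 ^ P.e

/-- Prepaid work for the next refills of the first of at most `L` levels, when `n` of its records are in
internal memory. -/
def credit (P : Params) (L n : ℕ) : List (Lvl α) → ℤ
  | [] => 0
  | l :: ls => 3 * L * ((P.cap - (Run.size l.out + n) : ℕ) : ℤ) +
      (if runsSize l.runs + lvlsSize ls = 0 then (0 : ℤ) else 3 * L * P.cap)

/-- Work that an operation on a priority queue with `L` levels pays for. -/
def rate (L : ℕ) : ℕ := 60 * (L + 1)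

/-- Prepaid work of a priority queue with at most `L` levels. -/
def PQ.potential (P : Params) (L : ℕ) (q : PQ α) : ℤ :=
  pot L q.lvls + (L + 1) * q.del.length + rate L * q.cnt + credit P L q.del.length q.lvls

/-- Transient disk space, in blocks, of an operation on a priority queue. -/
def transient (P : Params) (L R : ℕ) : ℕ :=
  R / P.B + 2 ^ P.e / P.B + 4 + 2 * (L + 1) * 2 ^ P.d

/-- The amortised cost of an operation on a priority queue. -/
def PQ.Paid (P : Params) (L R : ℕ) (q q' : PQ α) (s s' : Meter) : Prop :=
  Within P.B s s' (4 * (rate L - (q'.potential P L - q.potential P L)))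
    ((P.d + 10) * (rate L - (q'.potential P L - q.potential P L)) +
      (P.e + 2) * (3 - ((q'.cnt : ℤ) - q.cnt)))
    (q'.blocks - q.blocks) (transient P L R) P.mergeMem

theorem credit_nonneg (P : Params) (L n : ℕ) (ls : List (Lvl α)) : 0 ≤ credit P L n ls := by
  cases ls with
  | nil => simp [credit]
  | cons l ls => unfold credit; split <;> positivity

theorem credit_le (P : Params) (L n : ℕ) (ls : List (Lvl α)) : credit P L n ls ≤ 6 * L * P.cap := by
  cases ls with
  | nil => simp [credit]; positivity
  | cons l ls =>
    have h : ((P.cap - (Run.size l.out + n) : ℕ) : ℤ) ≤ P.cap := by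
      exact_mod_cast Nat.sub_le _ _
    have h' : 3 * (L : ℤ) * ((P.cap - (Run.size l.out + n) : ℕ) : ℤ) ≤ 3 * L * P.cap :=
      mul_le_mul_of_nonneg_left h (by positivity)
    have h0 : 0 ≤ 3 * (L : ℤ) * P.cap := by positivity
    simp only [credit]
    split <;> linarith

theorem PQ.blocks_eq (q : PQ α) : q.blocks = lvlsBlocks q.lvls := rfl

theorem PQ.WF.length_contents {P : Params} {q : PQ α} (h : q.WF P) :
    q.contents.length = q.size := by
  have hrs : ∀ rs : List (Run α), (rs.flatMap List.flatten).length = runsSize rs := by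
    intro rs
    induction rs with
    | nil => rfl
    | cons r rs ih => simp only [List.flatMap_cons, List.length_append, ih, runsSize_cons,
        Run.length_flatten]
  have : ∀ ls : List (Lvl α),
      (ls.flatMap fun l => l.out.flatten ++ l.runs.flatMap List.flatten).length = lvlsSize ls := by
    intro ls
    induction ls with
    | nil => rfl
    | cons l ls ih => simp only [List.flatMap_cons, List.length_append, ih, lvlsSize_cons,
        Run.length_flatten, hrs]
  rw [PQ.contents, List.length_append, List.length_append, this, Tree.length_contents, h.cnt,
    PQ.size, h.ext]

theorem PQ.WF.cnt_le {P : Params} {q : PQ α} (h : q.WF P) : q.cnt ≤ 2 ^ P.e :=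
  h.cnt ▸ h.small.recs_le h.ins

theorem PQ.WF.size_le_age {P : Params} {q : PQ α} (h : q.WF P) : q.size ≤ q.age P := by
  have := h.total
  unfold PQ.size PQ.age
  omega

theorem length_le_of_counter {P : Params} {L R : ℕ}
    (hL : ∀ n, (2 ^ P.d - 1) ^ n * 2 ^ P.e ≤ R → n + 1 ≤ L) {ls : List (Lvl α)} (h : LvlsOK P ls)
    (hR : counter (2 ^ P.d - 1) ls * 2 ^ P.e ≤ R) : ls.length ≤ L := by
  cases ls with
  | nil => simp
  | cons l ls => exact hL _ ((Nat.mul_le_mul_right _ h.2.2.2.2.1).trans hR)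

theorem PQ.WF.length_le {P : Params} {L R : ℕ}
    (hL : ∀ n, (2 ^ P.d - 1) ^ n * 2 ^ P.e ≤ R → n + 1 ≤ L) {q : PQ α} (h : q.WF P)
    (hR : q.age P ≤ R) : q.lvls.length ≤ L :=
  length_le_of_counter hL h.lvls ((Nat.le_add_right _ _).trans hR)

theorem PQ.WF.potential_nonneg {P : Params} {L : ℕ} {q : PQ α} (h : q.lvls.length ≤ L) :
    0 ≤ q.potential P L := by
  have h1 := credit_nonneg P L q.del.length q.lvls
  have h2 : 0 ≤ pot (L : ℤ) q.lvls := pot_nonneg (by zify at h; linarith)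
  unfold PQ.potential
  positivity

theorem PQ.empty_wf (P : Params) : (PQ.empty P : PQ α).WF P :=
  ⟨Tree.empty_ok _, Tree.empty_small _, Tree.recs_empty _, by simp [PQ.empty], trivial, rfl,
    by simp [PQ.empty]⟩

@[simp] theorem PQ.potential_empty (P : Params) (L : ℕ) :
    (PQ.empty P : PQ α).potential P L = 0 := by
  simp [PQ.potential, PQ.empty, pot, credit]

@[simp] theorem PQ.age_empty (P : Params) : (PQ.empty P : PQ α).age P = 0 := by
  simp [PQ.age, PQ.empty, counter]

@[simp] theorem PQ.size_empty (P : Params) : (PQ.empty P : PQ α).size = 0 := rfl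
@[simp] theorem PQ.cnt_empty (P : Params) : (PQ.empty P : PQ α).cnt = 0 := rfl
@[simp] theorem PQ.blocks_empty (P : Params) : (PQ.empty P : PQ α).blocks = 0 := rfl

/-- A file wastes at most one block's worth of space in its first block and one in the rest. A level
has fewer than `2 ^ d` files, hence at most `2 * P.cap` of waste. -/
theorem lvlsBlocks_le {P : Params} {ls : List (Lvl α)} (h : LvlsOK P ls) :
    P.B * lvlsBlocks ls ≤ lvlsSize ls + 2 * ls.length * P.cap := by
  induction ls with
  | nil => simp
  | cons l ls ih =>
    obtain ⟨h1, h2, h3, h5, h6, h7⟩ := h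
    have hout := h1.mul_length
    have hsl := Run.slack_le_tail (B := P.B) l.out
    have hruns : P.B * runsLength l.runs ≤ runsSize l.runs + 2 * P.B * l.runs.length := by
      clear * - h2
      generalize l.runs = rs at *
      induction rs with
      | nil => simp
      | cons r rs ih =>
        have := ih fun r hr => h2 r (List.mem_cons_of_mem _ hr)
        obtain ⟨ok, hs⟩ := h2 r List.mem_cons_self
        have := ok.mul_length
        have := Run.slack_le_tail (B := P.B) r
        simp only [runsLength_cons, runsSize_cons, List.length_cons, mul_add]
        omega
    have := ih h7
    have hc : 2 * P.B * (l.runs.length + 2) ≤ 2 * P.cap := by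
      rw [Params.cap, mul_comm (2 ^ P.d), ← mul_assoc]
      exact Nat.mul_le_mul_left _ h5
    simp only [lvlsBlocks_cons, lvlsSize_cons, List.length_cons]
    have hs : Run.slack P.B l.out.tail ≤ P.B := by omega
    simp only [mul_add, add_mul] at *
    omega

/-- The counter times `2 ^ e` bounds the records once, and the waste of all levels `16` times: there
are at most as many levels as flushes, and `P.cap ≤ 8 * 2 ^ e`. -/
theorem PQ.WF.blocks_le {P : Params} (hP : P.OK) {q : PQ α} (h : q.WF P) :
    P.B * q.blocks ≤ 17 * q.age P := by
  have h1 := lvlsBlocks_le h.lvls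
  have h2 := h.total
  have h3 : q.lvls.length ≤ counter (2 ^ P.d - 1) q.lvls := by
    cases hq : q.lvls with
    | nil => simp
    | cons l ls =>
      have := h.lvls
      rw [hq] at this
      refine le_trans ?_ this.2.2.2.2.1
      have h4 := hP.four_le
      exact Nat.lt_pow_self (by omega)
  have h4 : 2 * q.lvls.length * P.cap ≤ 2 * counter (2 ^ P.d - 1) q.lvls * (8 * 2 ^ P.e) :=
    Nat.mul_le_mul (Nat.mul_le_mul_left _ h3) hP.cap_le
  rw [PQ.blocks_eq, PQ.age]
  rw [h.ext] at h2
  have : 2 * counter (2 ^ P.d - 1) q.lvls * (8 * 2 ^ P.e) =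
    16 * (counter (2 ^ P.d - 1) q.lvls * 2 ^ P.e) := by ring
  omega

/-! ### Amortised cost of the operations of a priority queue. -/

theorem PQ.flush_spec {P : Params} (hP : P.OK) {lt : α → α → Bool} {q : PQ α} (h : q.WF P)
    (hc : q.cnt = 2 ^ P.e) (s : Meter) :
    ∃ q' s', q.flush P lt s = (q', s') ∧ q'.ins.OK P.B P.e ∧ q'.ins.Small ∧ q'.ins.recs = 0 ∧
      q'.cnt = 0 ∧ q'.del = [] ∧ q'.ext = q.ext + q.cnt + q.del.length ∧ LvlsOK P q'.lvls ∧
      q'.ext = lvlsSize q'.lvls ∧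
      counter (2 ^ P.d - 1) q'.lvls = counter (2 ^ P.d - 1) q.lvls + 1 ∧
      (q.del = [] → InsertOnly P 0 q.lvls → InsertOnly P 0 q'.lvls) ∧
      ∃ m : ℤ, (∀ w : ℤ, m = (w + 1) * (2 ^ P.e + q.del.length) + pot w q.lvls - pot w q'.lvls) ∧
      Within P.B s s' (4 * (m + q'.lvls.length * P.cap + 3 * 2 ^ P.e))
        ((P.d + 10) * (m + q'.lvls.length * P.cap + 3 * 2 ^ P.e) + (P.e + 2) * (2 ^ P.e + 1))
        (q'.blocks - q.blocks)
        (((q.ext + q.cnt + q.del.length) / P.B + 2 ^ P.e / P.B + 4 + 2 ^ P.d : ℕ)) P.mergeMem ∧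
      ∃ i t : ℕ, m ≤ P.B * i ∧ (P.d + 1) * m ≤ t ∧ AtLeast s s' i t := by
  obtain ⟨t, w, s₁, e₁, ok₁, hs₁, okw₁, hz₁, hz₁', hl₁, hw₁, ha₁⟩ :=
    Tree.drain_spec (lt := lt) q.cnt h.ins (WriterOK.empty hP.B_pos) (alloc P.B s).2
  obtain ⟨r, s₂, e₂, ok₂, hz₂, hsl₂, -, hl₂, hw₂, ha₂⟩ := finish_spec okw₁ s₁
  obtain ⟨f, s₃, e₃, ok₃, -, hz₃, hl₃, hw₃, ha₃⟩ := close_spec (B := P.B) (r := ⟨q.del, []⟩)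
    ⟨fun _ => rfl, h.del, RunOK.nil⟩ (alloc (-P.B) s₂).2
  obtain ⟨ls, s₄, e₄, ok₄, hc₄, hz₄, ⟨runs, tl, hls⟩, hp₄, m, hm, hw₄, i, t₄, hi, ht, ha₄⟩ :=
    addRuns_spec hP (lt := lt) (inc := [r, f]) (by have := hP.four_le; simp; omega)
      (by simp [ok₂, ok₃]) h.lvls s₃
  rw [h.cnt, min_self] at hz₁ hz₁' hw₁
  have hr : Run.size r = 2 ^ P.e := by
    rw [hz₂, hz₁', hc]; simp [Writer.size]
  have hf : Run.size f = q.del.length := by simp [hz₃, Reader.size]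
  have hlen := ok₂.mul_length
  have hdiv := merge_length_le hP ok₂ hsl₂
  have hinc : runsSize [r, f] = 2 ^ P.e + q.del.length := by simp [hr, hf]
  have hT : runsSize [r, f] + lvlsSize q.lvls = q.ext + q.cnt + q.del.length := by
    rw [hinc, h.ext, hc]; omega
  rw [hinc] at hm
  refine ⟨⟨t, 0, [], ls, q.ext + q.cnt + q.del.length⟩, s₄, ?_, ok₁, h.small.shrinks hs₁,
    by simp only; omega, rfl, rfl, rfl, ok₄, by simp only; omega, hc₄, ?_, m, ?_, ?_, i, t₄, hi, ht, ?_⟩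
  · simp only [PQ.flush, bind_run, pure_run, e₁, e₂, e₃, e₄]
  · intro hd hp
    refine hp₄ 0 hp ?_
    simp [hinc, hd]
  · intro w
    rw [hm w]
    push_cast
    ring
  · have hE := hP.B_le
    have h1 := (hw₁.trans hw₂).bracket (by positivity) (by simp)
    have h2 := (h1.trans hw₃).trans hw₄
    have hb₁ := h.small.blocks h.ins
    have hb₂ := (h.small.shrinks hs₁).blocks ok₁
    have hlen' : (P.B : ℤ) * r.length = Run.size r + Run.slack P.B r := by exact_mod_cast hlen
    have e1 : (2 : ℤ) * P.B * (w.done.length - (([] : List (List α)).length : ℕ)) +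
        2 * P.B * (r.length - w.done.length) = 2 * (P.B * r.length) := by
      simp only [List.length_nil]; push_cast; ring
    rw [hr] at hlen'
    zify at hsl₂ hE hdiv hl₁ hl₂ hl₃
    simp only [hT, hr] at h2 hdiv
    push_cast at h2 hlen' hE
    -- Besides the merges, a flush writes the buffer, at most `2 * (2 ^ e + B)`, and puts back
    -- `del`, at most `2 * B`. Since `B ≤ 2 * 2 ^ e`, this is at most `10 * 2 ^ e`, within `4 * (3 *
    -- 2 ^ e)`.
    refine h2.mono ?_ ?_ ?_ ?_ ?_
    · linarith
    · have : (0 : ℤ) ≤ P.d * (3 * 2 ^ P.e) := by positivity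
      rw [hc]
      push_cast
      have : (0 : ℤ) < 2 ^ P.e := by positivity
      linarith
    · rw [hb₁, hb₂]
      simp [PQ.blocks_eq]
    · rw [hb₁, hb₂]
      simp only [List.length_nil] at hl₁ hl₃ ⊢
      push_cast at hl₁ hl₃ hdiv ⊢
      simp only [sub_zero, zero_add] at hl₁ hl₃ ⊢
      have q1 : (0 : ℤ) ≤ (q.ext + q.cnt + q.del.length) / P.B := by positivity
      have q2 : (0 : ℤ) ≤ (2 ^ P.e) / P.B := by positivity
      have q3 : (0 : ℤ) < 2 ^ P.d := by positivity
      refine max_le (max_le (max_le ?_ ?_) ?_) ?_ <;> linarith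
    · simp [Params.mergeMem]
      positivity
  · have := (((ha₁.trans ha₂).bracket).trans ha₃).trans ha₄
    exact this.mono (by omega) (by omega)

theorem PQ.push_spec {P : Params} (hP : P.OK) {L R : ℕ}
    (hL : ∀ n, (2 ^ P.d - 1) ^ n * 2 ^ P.e ≤ R → n + 1 ≤ L) {lt : α → α → Bool} {q : PQ α}
    (h : q.WF P) (hR : q.age P + 1 ≤ R) (x : α) (s : Meter) :
    ∃ q' s', q.push P lt x s = (q', s') ∧ q'.WF P ∧ q'.size = q.size + 1 ∧
      q'.age P = q.age P + 1 ∧ PQ.Paid P L R q q' s s' := by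
  by_cases hc : q.cnt < 2 ^ P.e
  · obtain ⟨t, s', e, ok, sm, hz, hw, ha⟩ :=
      Tree.insert_spec (lt := lt) hP.B_pos h.ins h.small (h.cnt ▸ hc) x (tick 1 s).2
    refine ⟨{ q with ins := t, cnt := q.cnt + 1 }, s', ?_, ?_, by simp [PQ.size]; omega,
      by simp [PQ.age]; omega, ?_⟩
    · simp only [PQ.push, bind_run, if_pos hc, pure_run, e]
    · exact ⟨ok, sm, by simp [hz, h.cnt], h.del, h.lvls, h.ext, h.total⟩
    · refine ((tick_within P.B 1 s).trans hw).mono ?_ ?_ ?_ (by simp) (by simp)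
      · simp [PQ.potential]; ring_nf; simp
      · simp [PQ.potential]; ring_nf; linarith [Int.natCast_nonneg P.e]
      · simp [PQ.blocks]
  · have hcnt : q.cnt = 2 ^ P.e := le_antisymm h.cnt_le (not_lt.1 hc)
    obtain ⟨q₁, s₁, e₁, ok₁, sm₁, hr₁, hc₁, hd₁, hx₁, hl₁, hz₁, hct, -, m, hm, hw₁, -⟩ :=
      PQ.flush_spec hP (lt := lt) h hcnt (tick 1 s).2
    obtain ⟨t, s', e, ok, sm, hz, hw, ha⟩ :=
      Tree.insert_spec (lt := lt) hP.B_pos ok₁ sm₁ (by rw [hr₁]; positivity) x s₁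
    have hT : q.ext + q.cnt + q.del.length ≤ R := by
      have := h.size_le_age
      unfold PQ.size at this
      omega
    have hlen : q₁.lvls.length ≤ L := by
      refine length_le_of_counter hL hl₁ ?_
      rw [hct, add_mul, one_mul]
      unfold PQ.age at hR
      omega
    refine ⟨{ q₁ with ins := t, cnt := q₁.cnt + 1 }, s', ?_, ?_, ?_, ?_, ?_⟩
    · simp only [PQ.push, bind_run, if_neg hc, e₁, pure_run, e]
    · refine ⟨ok, sm, by simp [hz, hr₁, hc₁], by simp [hd₁], hl₁, hz₁, ?_⟩
      have := h.total
      simp only [hd₁, hx₁, hct, add_mul, List.length_nil]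
      omega
    · simp [PQ.size, hc₁, hd₁, hx₁]; omega
    · simp only [PQ.age, hct, hc₁, add_mul, hcnt]; omega
    · have hcap := hP.cap_le
      have hE : (0 : ℤ) < 2 ^ P.e := by positivity
      -- Each of the `2 ^ e` buffered records releases `rate L = 60 * (L + 1)`. This covers its `L +
      -- 1` units of `pot`, `8 * L` for the overhead of the merges, `3` for writing the buffer, and
      -- `48 * L` for the credit of at most `6 * L * P.cap` that the new first level may need.
      have hwork : m + q₁.lvls.length * P.cap + 3 * 2 ^ P.e ≤ rate L -
          (PQ.potential P L { q₁ with ins := t, cnt := q₁.cnt + 1 } - q.potential P L) := by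
        have c1 := credit_le P L q₁.del.length q₁.lvls
        have c2 := credit_nonneg P L q.del.length q.lvls
        simp only [PQ.potential, hm L, hc₁, hcnt, rate]
        simp only [hd₁] at c1 ⊢
        push_cast
        have hLz : (q₁.lvls.length : ℤ) * P.cap ≤ L * (8 * 2 ^ P.e) := by
          exact_mod_cast Nat.mul_le_mul hlen hcap
        have hLz' : (L : ℤ) * P.cap ≤ L * (8 * 2 ^ P.e) := by
          exact_mod_cast Nat.mul_le_mul_left L hcap
        have hLE : (0 : ℤ) ≤ L * 2 ^ P.e := by positivity
        simp only [List.length_nil, Nat.cast_zero, mul_zero, add_zero] at c1 ⊢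
        nlinarith
      have hdiv : (q.ext + q.cnt + q.del.length) / P.B ≤ R / P.B := Nat.div_le_div_right hT
      refine (((tick_within P.B 1 s).trans hw₁).trans hw).mono ?_ ?_ ?_ ?_ ?_
      · linarith
      · have h1 := mul_le_mul_of_nonneg_left hwork (show (0 : ℤ) ≤ P.d + 10 by positivity)
        have hc1 : ((q₁.cnt + 1 : ℕ) : ℤ) = 1 := by simp [hc₁]
        have hc2 : (q.cnt : ℤ) = 2 ^ P.e := by simp [hcnt]
        simp only [hc1, hc2, Nat.cast_one]
        linarith [Int.natCast_nonneg P.e]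
      · simp [PQ.blocks]
      · have hle := hw₁.le
        have h2 : (2 : ℤ) ^ P.d ≤ 2 * (L + 1) * 2 ^ P.d := by
          have : (0 : ℤ) < 2 ^ P.d := by positivity
          have : (0 : ℤ) ≤ L * 2 ^ P.d := by positivity
          linarith
        zify at hdiv
        unfold transient
        push_cast at hdiv hle ⊢
        have q0 : (0 : ℤ) ≤ (q.ext + q.cnt + q.del.length) / P.B := by positivity
        have q2 : (0 : ℤ) ≤ (2 ^ P.e) / P.B := by positivity
        have q3 : (0 : ℤ) < 2 ^ P.d := by positivity
        refine max_le (max_le ?_ ?_) ?_ <;> linarith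
      · simp

/-- A refill takes place only when `out` and `del` are empty while records remain, so the credit is
at its maximum `6 * L * P.cap`. Afterwards either `out` has `P.cap` records or nothing is behind it,
so one of the two terms vanishes. The released `3 * L * P.cap` pays for `2 * L * P.cap` units of
merging and for the rise of `pot` by at most `L * P.cap`. Fetching a block into `del` changes no
credit, since `credit` counts `out` and `del` together. -/
theorem PQ.load_spec {P : Params} (hP : P.OK) {L R : ℕ}
    (hL : ∀ n, (2 ^ P.d - 1) ^ n * 2 ^ P.e ≤ R → n + 1 ≤ L) {lt : α → α → Bool} {q : PQ α}
    (h : q.WF P) (hR : q.age P ≤ R) (s : Meter) :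
    ∃ q' s', q.load P lt s = (q', s') ∧ q'.WF P ∧ q'.size = q.size ∧ q'.age P = q.age P ∧
      q'.ins = q.ins ∧ q'.cnt = q.cnt ∧
      Within P.B s s' (4 * (q.potential P L - q'.potential P L))
        ((P.d + 10) * (q.potential P L - q'.potential P L) + 1) (q'.blocks - q.blocks)
        (2 * (L + 1) * 2 ^ P.d) P.mergeMem := by
  have hlen := h.length_le hL hR
  by_cases hc : (q.del.isEmpty && decide (0 < q.ext)) = true
  · obtain ⟨ins, cnt, del, lvls, ext⟩ := q
    obtain ⟨w1, w2, w3, w4, w5, w6, w7⟩ := h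
    simp only [Bool.and_eq_true, List.isEmpty_iff, decide_eq_true_eq] at hc w1 w2 w3 w4 w5 w6 w7 hlen
    obtain ⟨rfl, hext⟩ := hc
    cases lvls with
    | nil => simp only [lvlsSize_nil] at w6; omega
    | cons l ls =>
    have hrec : ∃ l' ls' s₁, (if l.out.isEmpty then refill P lt (l :: ls) else
          (pure (l :: ls) : Prog (List (Lvl α)))) (tick 1 s).2 = (l' :: ls', s₁) ∧
        LvlsOK P (l' :: ls') ∧
        counter (2 ^ P.d - 1) (l' :: ls') = counter (2 ^ P.d - 1) (l :: ls) ∧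
        lvlsSize (l' :: ls') = lvlsSize (l :: ls) ∧
        ∃ m : ℤ, m ≤ pot L (l :: ls) + credit P L 0 (l :: ls) -
          (pot L (l' :: ls') + credit P L 0 (l' :: ls')) ∧
        Within P.B (tick 1 s).2 s₁ (4 * m) ((P.d + 10) * m)
          (lvlsBlocks (l' :: ls') - lvlsBlocks (l :: ls)) (2 * (L + 1) * 2 ^ P.d) P.mergeMem := by
      by_cases he : l.out.isEmpty
      · rw [if_pos he]
        rw [List.isEmpty_iff] at he
        obtain ⟨l', ls', s₁, e, ok, hct, -, hln, hsz, hpost, hpot, hw⟩ :=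
          refill_spec hP (lt := lt) w5 (tick 1 s).2
        refine ⟨l', ls', s₁, e, ok, hct, hsz, _, ?_, hw.mono le_rfl le_rfl rfl ?_ le_rfl⟩
        · have hp := hpot L
          -- The external part is nonempty but `out` is empty, so there are records behind it.
          have hdeep : runsSize l.runs + lvlsSize ls ≠ 0 := by
            rw [lvlsSize_cons, he, Run.size_nil] at w6
            omega
          have hlen' : ((ls.length : ℤ) + 1) * P.cap ≤ L * P.cap :=
            mul_le_mul_of_nonneg_right (by exact_mod_cast hlen) (by positivity)
          have h0 : (0 : ℤ) ≤ L * P.cap := by positivity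
          have hcr : credit P L 0 (l' :: ls') + 3 * L * P.cap ≤ credit P L 0 (l :: ls) := by
            simp only [credit, if_neg hdeep, he, Run.size_nil, add_zero, Nat.sub_zero]
            have hs : ((P.cap - Run.size l'.out : ℕ) : ℤ) ≤ P.cap := by
              exact_mod_cast Nat.sub_le _ _
            have hs' : 3 * (L : ℤ) * ((P.cap - Run.size l'.out : ℕ) : ℤ) ≤ 3 * L * P.cap :=
              mul_le_mul_of_nonneg_left hs (by positivity)
            rcases hpost with hpost | hpost
            · rw [Nat.sub_eq_zero_of_le hpost]
              split <;> push_cast <;> linarith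
            · rw [if_pos hpost]
              linarith
          linarith
        · have : ((ls.length : ℤ) + 1) ≤ L + 1 := by
            have : ls.length + 1 ≤ L := hlen
            zify at this; linarith
          have := mul_le_mul_of_nonneg_right this (show (0 : ℤ) ≤ 2 ^ P.d by positivity)
          linarith
      · rw [if_neg he]
        refine ⟨l, ls, _, rfl, w5, rfl, rfl, 0, by simp, ?_⟩
        exact (Within.refl _ _).mono (by simp) (by simp) (by simp) (by positivity) (by simp)
    obtain ⟨l', ls', s₁, e₁, ok, hct, hsz, m, hm, hw₁⟩ := hrec
    obtain ⟨k1, k2, k3, k5, k6, k7⟩ := ok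
    obtain ⟨r, s₂, e₂, ok₂, hcur, hrest, hz₂, hw₂, -⟩ := fetch_spec k1 s₁
    have hz₂' : Run.size l'.out = r.cur.length + Run.size r.rest := hz₂.symm
    have hle : r.cur.length ≤ ext := by
      rw [w6, ← hsz, lvlsSize_cons, hz₂']; omega
    refine ⟨⟨ins, cnt, r.cur, { l' with out := r.rest } :: ls', ext - r.cur.length⟩, s₂, ?_, ?_, ?_, ?_,
      rfl, rfl, ?_⟩
    · have hx : (([] : List α).isEmpty && decide (0 < ext)) = true := by simp [hext]
      by_cases he : l.out.isEmpty
      · rw [if_pos he] at e₁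
        simp only [PQ.load, bind_run, if_pos hx, if_pos he, e₁, e₂, pure_run]
      · rw [if_neg he] at e₁
        simp only [PQ.load, bind_run, if_pos hx, if_neg he, e₁]
        simp only [e₂, pure_run]
    · refine ⟨w1, w2, w3, ok₂.cur_le, ⟨ok₂.rest, k2, ?_, k5, k6, k7⟩, ?_, ?_⟩
      · simp only
        have := Run.slack_tail_le (B := P.B) r.rest
        rw [← hrest] at k3
        omega
      · simp only [lvlsSize_cons] at hsz w6 ⊢
        omega
      · have : counter (2 ^ P.d - 1) ({ l' with out := r.rest } :: ls') =
          counter (2 ^ P.d - 1) (l' :: ls') := rfl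
        simp only [this, hct]
        simp only [List.length_nil] at w7
        omega
    · simp only [PQ.size, List.length_nil]; omega
    · have : counter (2 ^ P.d - 1) ({ l' with out := r.rest } :: ls') =
          counter (2 ^ P.d - 1) (l' :: ls') := rfl
      simp only [PQ.age, this, hct]
    · have hΦ : m ≤ PQ.potential P L ⟨ins, cnt, [], l :: ls, ext⟩ - PQ.potential P L
          ⟨ins, cnt, r.cur, { l' with out := r.rest } :: ls', ext - r.cur.length⟩ := by
        simp only [PQ.potential, List.length_nil, Nat.cast_zero, mul_zero, add_zero]
        simp only [pot, credit, add_zero] at hm ⊢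
        rw [hz₂', add_comm r.cur.length] at hm
        push_cast at hm ⊢
        linarith
      refine (((tick_within P.B 1 s).trans hw₁).trans hw₂).mono ?_ ?_ ?_ ?_ ?_
      · linarith
      · have := mul_le_mul_of_nonneg_left hΦ (show (0 : ℤ) ≤ P.d + 10 by positivity)
        push_cast
        linarith
      · simp [PQ.blocks_eq]; ring
      · have := hw₁.le
        have h0 : (0 : ℤ) ≤ 2 * (L + 1) * 2 ^ P.d := by positivity
        refine max_le (max_le ?_ ?_) ?_ <;> linarith
      · simp
  · refine ⟨q, (tick 1 s).2, ?_, h, rfl, rfl, rfl, rfl, ?_⟩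
    · simp only [PQ.load, bind_run, if_neg hc, pure_run]
    · exact (tick_within P.B 1 s).mono (by simp) (by simp) (by simp) (by positivity) (by simp)

theorem transient_ge (P : Params) (L R : ℕ) :
    (2 * (L + 1) * 2 ^ P.d : ℤ) ≤ transient P L R := by
  unfold transient
  push_cast
  have q0 : (0 : ℤ) ≤ R / P.B := by positivity
  have q2 : (0 : ℤ) ≤ (2 ^ P.e) / P.B := by positivity
  linarith

theorem PQ.peek_spec {P : Params} (hP : P.OK) {L R : ℕ}
    (hL : ∀ n, (2 ^ P.d - 1) ^ n * 2 ^ P.e ≤ R → n + 1 ≤ L) {lt : α → α → Bool} {q : PQ α}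
    (h : q.WF P) (hR : q.age P ≤ R) (s : Meter) :
    ∃ o q' s', q.peek P lt s = ((o, q'), s') ∧ q'.WF P ∧ q'.size = q.size ∧
      q'.age P = q.age P ∧ PQ.Paid P L R q q' s s' := by
  obtain ⟨q', s', e, wf, hz, hag, -, hc, hw⟩ := PQ.load_spec hP hL (lt := lt) h hR s
  refine ⟨if better lt q'.ins.top q'.del.head? then q'.ins.top else q'.del.head?, q', (tick 1 s').2,
    by simp only [PQ.peek, bind_run, e, pure_run], wf, hz, hag, ?_⟩
  have ht := transient_ge P L R
  have h0 : (0 : ℤ) ≤ 2 * (L + 1) * 2 ^ P.d := by positivity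
  have hX : (0 : ℤ) ≤ rate L := by positivity
  refine (hw.trans (tick_within P.B 1 s')).mono (by linarith) ?_ (by simp) ?_ (by simp)
  · rw [hc]
    have : (0 : ℤ) ≤ (P.d + 10) * rate L := by positivity
    push_cast
    linarith [Int.natCast_nonneg P.e]
  · have := hw.le
    refine max_le ?_ ?_ <;> linarith

theorem PQ.pop_spec {P : Params} (hP : P.OK) {L R : ℕ}
    (hL : ∀ n, (2 ^ P.d - 1) ^ n * 2 ^ P.e ≤ R → n + 1 ≤ L) {lt : α → α → Bool} {q : PQ α}
    (h : q.WF P) (hR : q.age P ≤ R) (s : Meter) :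
    ∃ o q' s', q.pop P lt s = ((o, q'), s') ∧ q'.WF P ∧ q.size = q'.size + o.toList.length ∧
      q'.age P ≤ q.age P ∧ PQ.Paid P L R q q' s s' := by
  obtain ⟨q', s', e, wf, hz, hag, -, hc, hw⟩ := PQ.load_spec hP hL (lt := lt) h hR s
  have ht := transient_ge P L R
  have h0 : (0 : ℤ) ≤ 2 * (L + 1) * 2 ^ P.d := by positivity
  have hle := hw.le
  by_cases hb : better lt q'.ins.top q'.del.head? = true
  · obtain ⟨o, t, s₂, e₂, ok₂, hz₂, hn₂, hs₂, hw₂, -⟩ :=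
      Tree.pop_spec (lt := lt) wf.ins (tick 1 s').2
    have hpos : q'.ins.recs ≠ 0 := by
      rw [Ne, ← wf.ins.top_eq_none]
      intro h0
      simp [h0, better] at hb
    have ho : o.toList.length = 1 := by
      cases o with
      | none => exact absurd (hn₂ rfl) hpos
      | some x => rfl
    have hcnt := wf.cnt
    refine ⟨o, { q' with ins := t, cnt := q'.cnt - 1 }, s₂, ?_, ?_, ?_, ?_, ?_⟩
    · simp only [PQ.pop, bind_run, e, if_pos hb, e₂, pure_run]
    · exact ⟨ok₂, wf.small.shrinks hs₂, by simp only; omega, wf.del, wf.lvls, wf.ext, wf.total⟩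
    · simp only [PQ.size] at hz ⊢; omega
    · simp only [PQ.age] at hag ⊢; omega
    · have hb₁ := wf.small.blocks wf.ins
      have hb₂ := (wf.small.shrinks hs₂).blocks ok₂
      have hcz : ((q'.cnt - 1 : ℕ) : ℤ) = q'.cnt - 1 := by omega
      have hcz' : (q'.cnt : ℤ) = q.cnt := by rw [hc]
      -- A record that leaves through the insertion buffer never reaches the external part, and its
      -- deposit is returned.
      have hΦ : PQ.potential P L { q' with ins := t, cnt := q'.cnt - 1 } =
          q'.potential P L - rate L := by
        simp only [PQ.potential, hcz]; ring
      rw [PQ.Paid, hΦ]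
      simp only [hcz, hcz']
      have hX : (0 : ℤ) ≤ rate L := by positivity
      have hX' : (0 : ℤ) ≤ (P.d + 10) * rate L := by positivity
      refine ((hw.trans (tick_within P.B 1 s')).trans hw₂).mono (by linarith) ?_ ?_ ?_ (by simp)
      · push_cast
        linarith [Int.natCast_nonneg P.e]
      · simp [hb₁, hb₂, PQ.blocks]
      · refine max_le (max_le ?_ ?_) ?_ <;> linarith
  · refine ⟨q'.del.head?, { q' with del := q'.del.tail }, (tick 1 s').2, ?_, ?_, ?_, ?_, ?_⟩
    · simp only [PQ.pop, bind_run, e, if_neg hb, pure_run]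
    · refine ⟨wf.ins, wf.small, wf.cnt, ?_, wf.lvls, wf.ext, ?_⟩
      · have := wf.del; simp only [List.length_tail]; omega
      · have := wf.total; simp only [List.length_tail]; omega
    · have : q'.del.length = q'.del.tail.length + q'.del.head?.toList.length := by
        cases q'.del <;> simp
      simp only [PQ.size] at hz ⊢; omega
    · simp only [PQ.age] at hag ⊢; omega
    · have hX : (rate L : ℤ) = 60 * (L + 1) := by simp [rate]
      -- Taking a record from `del` widens the gap to `P.cap` by at most one, which adds at most `3
      -- * L` to the credit; the rate covers this.
      have hΦ : PQ.potential P L { q' with del := q'.del.tail } ≤ q'.potential P L + rate L := by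
        rw [hX]
        have hd : ((q'.del.tail.length : ℕ) : ℤ) ≤ q'.del.length := by
          simp
        have hd' : (L + 1 : ℤ) * q'.del.tail.length ≤ (L + 1) * q'.del.length :=
          mul_le_mul_of_nonneg_left hd (by positivity)
        have hcr : credit P L q'.del.tail.length q'.lvls ≤
            credit P L q'.del.length q'.lvls + 3 * L := by
          cases q'.lvls with
          | nil => simp [credit]
          | cons l ls =>
            simp only [credit]
            have : ((P.cap - (Run.size l.out + q'.del.tail.length) : ℕ) : ℤ) ≤
                ((P.cap - (Run.size l.out + q'.del.length) : ℕ) : ℤ) + 1 := by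
              rw [List.length_tail]; omega
            have := mul_le_mul_of_nonneg_left this (show (0 : ℤ) ≤ 3 * L by positivity)
            linarith
        simp only [PQ.potential]
        linarith [Int.natCast_nonneg L]
      have hX' := mul_le_mul_of_nonneg_left hΦ (show (0 : ℤ) ≤ P.d + 10 by positivity)
      refine (hw.trans (tick_within P.B 1 s')).mono (by linarith) ?_ (by simp [PQ.blocks]) ?_ (by simp)
      · have hcz : (q'.cnt : ℤ) = q.cnt := by rw [hc]
        simp only [hcz]
        push_cast
        linarith [Int.natCast_nonneg P.e]
      · refine max_le ?_ ?_ <;> linarith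

end Queue

/-! ### I/Os and steps are never taken back -/

section Monotone

variable {α β σ : Type}

/-- The lower bound follows only a prefix of the sweep, and monotonicity keeps the cost of that
prefix until the end. It also serves the upper bound where the cost of returning answers is dropped.
-/
def Mono (p : Prog α) : Prop := ∀ s, AtLeast s (p s).2 0 0

theorem Mono.pure (a : α) : Mono (pure a : Prog α) := fun s => AtLeast.refl s

theorem Mono.bind {p : Prog α} {f : α → Prog β} (hp : Mono p) (hf : ∀ a, Mono (f a)) :
    Mono (p >>= f) := fun s => (hp s).trans (hf _ _)

theorem Mono.tick (n : ℕ) : Mono (tick n) := fun s =>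
  (tick_atLeast n s).mono le_rfl (Nat.zero_le n)

theorem Mono.alloc (n : ℤ) : Mono (alloc n) := fun _ => ⟨le_rfl, le_rfl⟩

theorem Mono.release (n : ℕ) : Mono (release n) := fun _ => ⟨le_rfl, le_rfl⟩

theorem Mono.uncharged (p : Prog α) : Mono (uncharged p) := fun _ => ⟨le_rfl, le_rfl⟩

theorem Mono.readBlock (B : ℕ) (b : List α) : Mono (readBlock B b) := fun s =>
  ⟨by simp [NestedSweep.readBlock], by simp [NestedSweep.readBlock]⟩

theorem Mono.writeBlock (B : ℕ) (b : List α) : Mono (writeBlock B b) := fun s =>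
  ⟨by simp [NestedSweep.writeBlock], by simp [NestedSweep.writeBlock]⟩

theorem Mono.loopN {body : σ → Prog (σ × Bool)} (h : ∀ x, Mono (body x)) (n : ℕ) :
    ∀ x, Mono (loopN n body x) := by
  induction n with
  | zero => exact fun x => .pure x
  | succ n ih =>
    intro x
    refine .bind (h x) fun r => ?_
    split
    exacts [ih _, .pure _]

theorem Mono.fetch (B : ℕ) (r : Run α) : Mono (Reader.fetch B r) := by
  cases r with
  | nil => exact .pure _
  | cons b r => exact .bind (.readBlock B b) fun _ => .pure _

theorem Mono.next (B : ℕ) (r : Reader α) : Mono (r.next B) := by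
  refine .bind (.tick 1) fun _ => ?_
  split
  exacts [.pure _, .bind (.fetch B _) fun _ => .pure _, .pure _]

theorem Mono.close (B : ℕ) (r : Reader α) : Mono (r.close B) := by
  unfold Reader.close
  split
  exacts [.pure _, .bind (.writeBlock B _) fun _ => .pure _]

theorem Mono.put (B : ℕ) (x : α) (w : Writer α) : Mono (w.put B x) := by
  refine .bind (.tick 1) fun _ => ?_
  split
  exacts [.pure _, .bind (.writeBlock B _) fun _ => .pure _]

theorem Mono.finish (B : ℕ) (w : Writer α) : Mono (w.finish B) := by
  unfold Writer.finish
  split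
  exacts [.pure _, .bind (.writeBlock B _) fun _ => .pure _]

variable (lt : α → α → Bool) (P : Params)

theorem Mono.treeInsert (x : α) (t : Tree α) : Mono (t.insert lt x) := by
  induction t with
  | leaf r =>
    refine .bind (.tick 1) fun _ => ?_
    split
    exacts [.pure _, .pure _]
  | node w b l r ihl ihr =>
    refine .bind (.tick 1) fun _ => ?_
    split
    exacts [.bind ihl fun _ => .pure _, .bind ihr fun _ => .pure _]

theorem Mono.treePop (B : ℕ) (t : Tree α) : Mono (t.pop B lt) := by
  induction t with
  | leaf r => exact .bind (.next B r) fun _ => .pure _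
  | node w b l r ihl ihr =>
    refine .bind (.tick 1) fun _ => ?_
    split
    exacts [.bind ihl fun _ => .pure _, .bind ihr fun _ => .pure _]

theorem Mono.opened (B d : ℕ) : ∀ rs : List (Run α), Mono (Tree.opened B lt d rs) := by
  induction d with
  | zero => exact fun rs => .bind (.tick 1) fun _ => .bind (.fetch B _) fun _ => .pure _
  | succ d ih =>
    exact fun rs => .bind (.tick 1) fun _ => .bind (ih _) fun _ => .bind (ih _) fun _ => .pure _

theorem Mono.closed (B : ℕ) (t : Tree α) : Mono (t.closed B) := by
  induction t with
  | leaf r => exact .bind (.tick 1) fun _ => .bind (.close B r) fun _ => .pure _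
  | node w b l r ihl ihr =>
    exact .bind (.tick 1) fun _ => .bind ihl fun _ => .bind ihr fun _ => .pure _

theorem Mono.drain (B n : ℕ) : ∀ (t : Tree α) (w : Writer α), Mono (t.drain B lt n w) := by
  induction n with
  | zero => exact fun t w => .pure _
  | succ n ih =>
    intro t w
    refine .bind (.treePop lt B t) fun p => ?_
    split
    exacts [.pure _, .bind (.put B _ w) fun _ => ih _ _]

theorem Mono.mergeRuns (n : ℕ) (rs : List (Run α)) : Mono (mergeRuns P lt n rs) :=
  .bind (.alloc _) fun _ => .bind (.opened lt _ _ _) fun _ => .bind (.drain lt _ _ _ _) fun _ =>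
    .bind (.finish _ _) fun _ => .bind (.closed _ _) fun _ => .bind (.alloc _) fun _ => .pure _

theorem Mono.addRuns (ls : List (Lvl α)) : ∀ inc, Mono (addRuns P lt inc ls) := by
  induction ls with
  | nil => exact fun inc => .bind (.mergeRuns lt P _ _) fun _ => .pure _
  | cons l ls ih =>
    intro inc
    refine .bind (.mergeRuns lt P _ _) fun _ => ?_
    split
    exacts [.pure _, .bind (ih _) fun _ => .pure _]

theorem Mono.refill (ls : List (Lvl α)) : Mono (refill P lt ls) := by
  induction ls with
  | nil => exact .pure _
  | cons l ls ih =>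
    cases ls with
    | nil => exact .bind (.mergeRuns lt P _ _) fun _ => .pure _
    | cons l₁ ls =>
      -- The continuation is common to both branches of the test, so it is treated for an arbitrary
      -- list of levels.
      have h : ∀ ls' : List (Lvl α), Mono (match ls' with
          | [] => (Pure.pure [l] : Prog (List (Lvl α)))
          | n :: ns => do
            let p ← NestedSweep.mergeRuns P lt (2 ^ P.d * P.B) (n.out :: l.runs)
            Pure.pure (⟨l.out ++ p.1, p.2.tail.take l.runs.length⟩ ::
              { n with out := p.2.headD [] } :: ns)) := by
        intro ls'
        split
        exacts [.pure _, .bind (.mergeRuns lt P _ _) fun _ => .pure _]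
      unfold NestedSweep.refill
      dsimp only
      split
      exacts [.bind ih h, .bind (.pure _) h]

theorem Mono.flush (q : PQ α) : Mono (q.flush P lt) :=
  .bind (.alloc _) fun _ => .bind (.drain lt _ _ _ _) fun _ => .bind (.finish _ _) fun _ =>
    .bind (.alloc _) fun _ => .bind (.close _ _) fun _ => .bind (.addRuns lt P _ _) fun _ => .pure _

theorem Mono.push (x : α) (q : PQ α) : Mono (q.push P lt x) := by
  refine .bind (.tick 1) fun _ => ?_
  split
  exacts [.bind (.pure _) fun _ => .bind (.treeInsert lt x _) fun _ => .pure _,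
    .bind (.flush lt P q) fun _ => .bind (.treeInsert lt x _) fun _ => .pure _]

theorem Mono.load (q : PQ α) : Mono (q.load P lt) := by
  refine .bind (.tick 1) fun _ => ?_
  have h : ∀ ls' : List (Lvl α), Mono (match ls' with
      | [] => (Pure.pure { q with lvls := ls' } : Prog (PQ α))
      | l :: ls => do
        let r ← Reader.fetch P.B l.out
        Pure.pure { q with
          del := r.cur
          lvls := { l with out := r.rest } :: ls
          ext := q.ext - r.cur.length }) := by
    intro ls'
    split
    exacts [.pure _, .bind (.fetch _ _) fun _ => .pure _]
  split
  · dsimp only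
    split
    · exact .bind (.pure _) h
    · split
      exacts [.bind (.refill lt P _) h, .bind (.pure _) h]
  · exact .pure _

theorem Mono.peek (q : PQ α) : Mono (q.peek P lt) :=
  .bind (.load lt P q) fun _ => .bind (.tick 1) fun _ => .pure _

theorem Mono.pop (q : PQ α) : Mono (q.pop P lt) := by
  refine .bind (.load lt P q) fun q => .bind (.tick 1) fun _ => ?_
  split
  exacts [.bind (.treePop lt _ _) fun _ => .pure _, .pure _]

/-! ### Monotonicity of the steps of the outer sweep. -/

theorem Mono.peekArc (st : State) : Mono (peekArc P st) :=
  .bind (.peek _ P _) fun _ => .bind (.tick 1) fun _ => .pure _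

theorem Mono.popArc (st : State) : Mono (popArc P st) := by
  refine .bind (.peek _ P _) fun _ => .bind (.tick 1) fun _ => ?_
  split
  exacts [.bind (.pop _ P _) fun _ => .pure _, .bind (.next _ _) fun _ => .pure _]

theorem Mono.gather (ℓ : ℕ) (st : State) : Mono (gather P ℓ st) := by
  refine .bind (.peekArc P st) fun a => ?_
  split
  · exact .pure _
  · split
    · refine .bind (.popArc P _) fun _ => .bind (.popArc P _) fun _ => .bind (.tick 1) fun _ => ?_
      split
      · split
        exacts [.bind (.push _ P _ _) fun _ => .pure _, .bind (.push _ P _ _) fun _ => .pure _]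
      · exact .pure _
    · exact .pure _

theorem Mono.dedupe (ℓ : ℕ) (nested : Bool) (x : State × Option Node × ℕ) :
    Mono (dedupe P ℓ nested x) := by
  refine .bind (.pop _ P _) fun _ => .bind (.tick 1) fun _ => ?_
  split
  · exact .pure _
  · dsimp only
    repeat' first
      | exact .bind (.pure _) fun _ => .bind (.push _ P _ _) fun _ => .pure _
      | exact .bind (.put _ _ _) fun _ => .bind (.push _ P _ _) fun _ => .pure _
      | split

theorem Mono.route (src : Option Uid) (high : Bool) (tgt : Target) (st : State) :
    Mono (route P src high tgt st) := by
  refine .bind (.tick 1) fun _ => ?_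
  split
  · split
    exacts [.bind (.push _ P _ _) fun _ => .pure _, .bind (.push _ P _ _) fun _ => .pure _]
  · exact .bind (.push _ P _ _) fun _ => .pure _

theorem Mono.forwardArc (r : Redirect) (st : State) : Mono (forwardArc P r st) := by
  refine .bind (.tick 1) fun _ => ?_
  split
  · exact .pure _
  · split
    exacts [.bind (.next _ _) fun _ => .bind (.route P _ _ _ _) fun _ => .pure _, .pure _]

theorem Mono.forward (fuel : ℕ) (st : State) : Mono (forward P fuel st) := by
  refine .bind (.pop _ P _) fun _ => .bind (.tick 1) fun _ => ?_
  split
  · exact .pure _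
  · exact .bind (.loopN (fun _ => .forwardArc P _ _) _ _) fun _ => .pure _

theorem Mono.giveBack (f : Request → Ptr) (rs : List Request) :
    ∀ st : State, Mono (giveBack P f rs st) := by
  induction rs with
  | nil => exact fun st => .pure _
  | cons r rs ih =>
    intro st
    unfold NestedSweep.giveBack
    split
    exacts [.bind (.push _ P _ _) fun _ => ih _, ih _]

theorem Mono.callInner (inner : InnerSweep) (ℓ : ℕ) (st : State) :
    Mono (callInner P inner ℓ st) :=
  .bind (.next _ _) fun _ => .bind (.release _) fun _ => .uncharged _

theorem Mono.processLevel (inner : InnerSweep) (fuel : ℕ) (st : State) :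
    Mono (processLevel P inner fuel st) := by
  refine .bind (.peekArc P st) fun a => ?_
  split
  · exact .pure _
  · refine .bind (.loopN (fun _ => .gather P _ _) _ _) fun _ =>
      .bind (.loopN (fun _ => .dedupe P _ _ _) _ _) fun _ =>
      .bind (.loopN (fun _ => .forward P _ _) _ _) fun _ => ?_
    split
    exacts [.bind (.callInner P _ _ _) fun _ => .pure _, .bind (.pure _) fun _ => .pure _]

end Monotone

/-! ### Upper bounds for the outer sweep -/

/-- Bounds for a run of the outer sweep: on the levels of a priority queue, the arcs, the blocks of
input, on the potentials at the start, on disk space, and on internal memory, reserved and in total. -/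
structure Limits where
  P : Params
  L : ℕ
  R : ℕ
  input : ℕ
  io : ℤ
  time : ℤ
  disk : ℤ
  mem : ℤ
  memMax : ℤ

/-- In `disk`, the three summands are the input, the transient space of one operation, and the
blocks of the four queues and of the output. -/
structure Limits.OK (S : Limits) : Prop where
  params : S.P.OK
  levels : ∀ n, (2 ^ S.P.d - 1) ^ n * 2 ^ S.P.e ≤ S.R → n + 1 ≤ S.L
  disk : S.P.B * (S.input + transient S.P S.L S.R) + 69 * S.R ≤ S.P.B * S.disk
  mem : S.mem + S.P.mergeMem ≤ S.memMax

def State.potential (S : Limits) (st : State) : ℤ :=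
  st.outerQ.potential S.P S.L + st.innerQ.potential S.P S.L + st.byChild.potential S.P S.L +
    st.byUid.potential S.P S.L

def State.cnt (st : State) : ℤ :=
  st.outerQ.cnt + st.innerQ.cnt + st.byChild.cnt + st.byUid.cnt

def State.blocks (st : State) : ℤ :=
  st.arcs.rest.length + st.terms.rest.length + st.xs.rest.length + st.outerQ.blocks +
    st.innerQ.blocks + st.byChild.blocks + st.byUid.blocks + st.out.done.length

structure State.WF (S : Limits) (st : State) : Prop where
  arcs : ReaderOK S.P.B st.arcs
  terms : ReaderOK S.P.B st.terms
  xs : ReaderOK S.P.B st.xs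
  outerQ : st.outerQ.WF S.P
  innerQ : st.innerQ.WF S.P
  byChild : st.byChild.WF S.P
  byUid : st.byUid.WF S.P
  out : WriterOK S.P.B st.out
  outerAge : st.outerQ.age S.P ≤ S.R
  innerAge : st.innerQ.age S.P ≤ S.R
  byChildAge : st.byChild.age S.P ≤ S.R
  byUidAge : st.byUid.age S.P ≤ S.R
  outSize : st.out.size ≤ S.R
  input : st.arcs.rest.length + st.terms.rest.length + st.xs.rest.length ≤ S.input

/-- The state and the meter after at most `k` operations. -/
structure Inv (S : Limits) (st : State) (s : Meter) (k : ℤ) : Prop where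
  wf : st.WF S
  io : s.ioPot S.P.B + 4 * st.potential S + 2 * st.out.cur.length ≤ S.io + 4 * rate S.L * k
  time : s.timePot S.P.B + (S.P.d + 10) * st.potential S + (S.P.e + 2) * st.cnt +
    2 * st.out.cur.length ≤ S.time + ((S.P.d + 10) * rate S.L + 3 * (S.P.e + 2)) * k
  disk : s.disk = st.blocks
  diskPeak : s.diskPeak ≤ S.disk
  mem : s.mem = S.mem
  memPeak : s.memPeak ≤ S.memMax

section Operations

variable {S : Limits} {st st' : State} {s s' : Meter} {k κ : ℤ}

theorem Inv.mono (h : Inv S st s k) {k' : ℤ} (hk : k ≤ k') : Inv S st s k' := by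
  obtain ⟨h1, h2, h3, h4, h5, h6, h7⟩ := h
  refine ⟨h1, h2.trans ?_, h3.trans ?_, h4, h5, h6, h7⟩ <;> gcongr

/-- The factor `69` is `17` for each of the four queues plus `1` for the full blocks of output. -/
theorem State.WF.blocks_le (hS : S.OK) (h : st.WF S) :
    S.P.B * st.blocks ≤ S.P.B * S.input + 69 * S.R := by
  have h1 := h.outerQ.blocks_le hS.params
  have h2 := h.innerQ.blocks_le hS.params
  have h3 := h.byChild.blocks_le hS.params
  have h4 := h.byUid.blocks_le hS.params
  have h5 := h.out.size_eq
  have h6 := h.outerAge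
  have h7 := h.innerAge
  have h8 := h.byChildAge
  have h9 := h.byUidAge
  have h10 := h.outSize
  have h11 := Nat.mul_le_mul_left S.P.B h.input
  simp only [State.blocks, mul_add] at h11 ⊢
  zify at *
  linarith

/-- The peaks need no history: before each operation the blocks in use are bounded by the invariant,
and the operation adds at most the transient allowance. -/
theorem Inv.step (hS : S.OK) (h : Inv S st s k) {j t dd dp mp : ℤ}
    (hw : Within S.P.B s s' j t dd dp mp) (wf : st'.WF S) (hd : st'.blocks = st.blocks + dd)
    (hj : j + 4 * (st'.potential S - st.potential S) +
      2 * ((st'.out.cur.length : ℤ) - st.out.cur.length) ≤ 4 * rate S.L)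
    (ht : t + (S.P.d + 10) * (st'.potential S - st.potential S) + (S.P.e + 2) * (st'.cnt - st.cnt) +
      2 * ((st'.out.cur.length : ℤ) - st.out.cur.length) ≤
        (S.P.d + 10) * rate S.L + 3 * (S.P.e + 2))
    (hp : dp ≤ transient S.P S.L S.R) (hm : mp ≤ S.P.mergeMem) : Inv S st' s' (k + 1) := by
  obtain ⟨h1, h2, h3, h4, h5, h6, h7⟩ := h
  obtain ⟨w1, w2, w3, w4, w5, w6, w7⟩ := hw
  have hB := hS.params.B_pos
  have hdisk : s.disk + transient S.P S.L S.R ≤ S.disk := by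
    have e1 := h1.blocks_le hS
    have e2 := hS.disk
    rw [← h4] at e1
    refine le_of_mul_le_mul_left (a := (S.P.B : ℤ)) ?_ (by exact_mod_cast hB)
    linarith
  have hmem := hS.mem
  refine ⟨wf, by linarith, by linarith, by linarith, ?_, by linarith, ?_⟩
  · refine w5.trans (max_le h5 (by linarith))
  · refine w7.trans (max_le h7 (by linarith))

theorem rate_ge (L : ℕ) : (60 : ℤ) ≤ rate L := by
  simp only [rate]; push_cast; linarith [Int.natCast_nonneg L]

theorem Inv.step_small (hS : S.OK) (h : Inv S st s k) {dd : ℤ}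
    (hw : Within S.P.B s s' 0 1 dd 0 0) (wf : st'.WF S) (hd : st'.blocks = st.blocks + dd)
    (hp : st'.potential S = st.potential S) (hc : st'.cnt = st.cnt) (ho : st'.out = st.out) :
    Inv S st' s' (k + 1) := by
  have hr := rate_ge S.L
  have hr' : (0 : ℤ) ≤ S.P.d * rate S.L := by positivity
  refine h.step hS hw wf hd ?_ ?_ (by positivity) (by positivity)
  · rw [hp, ho]; linarith
  · rw [hp, hc, ho]; linarith [Int.natCast_nonneg S.P.e]

theorem Inv.tick (hS : S.OK) (h : Inv S st s k) : Inv S st (tick 1 s).2 (k + 1) :=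
  h.step_small hS (by simpa using tick_within S.P.B 1 s) h.wf (by simp) rfl rfl rfl

/-! ### Single operations on the components of the state. -/

theorem Inv.setOuterQ (hS : S.OK) (h : Inv S st s k) {q : PQ Arc} (wf : q.WF S.P)
    (ha : q.age S.P ≤ S.R) (hp : PQ.Paid S.P S.L S.R st.outerQ q s s') :
    Inv S { st with outerQ := q } s' (k + 1) := by
  refine h.step hS hp { h.wf with outerQ := wf, outerAge := ha } ?_ ?_ ?_ le_rfl le_rfl
  · simp only [State.blocks]; ring
  · simp only [State.potential]; apply le_of_eq; ring
  · simp only [State.potential, State.cnt]; apply le_of_eq; ring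

theorem Inv.setInnerQ (hS : S.OK) (h : Inv S st s k) {q : PQ Request} (wf : q.WF S.P)
    (ha : q.age S.P ≤ S.R) (hp : PQ.Paid S.P S.L S.R st.innerQ q s s') :
    Inv S { st with innerQ := q } s' (k + 1) := by
  refine h.step hS hp { h.wf with innerQ := wf, innerAge := ha } ?_ ?_ ?_ le_rfl le_rfl
  · simp only [State.blocks]; ring
  · simp only [State.potential]; apply le_of_eq; ring
  · simp only [State.potential, State.cnt]; apply le_of_eq; ring

theorem Inv.setByChild (hS : S.OK) (h : Inv S st s k) {q : PQ Node} (wf : q.WF S.P)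
    (ha : q.age S.P ≤ S.R) (hp : PQ.Paid S.P S.L S.R st.byChild q s s') :
    Inv S { st with byChild := q } s' (k + 1) := by
  refine h.step hS hp { h.wf with byChild := wf, byChildAge := ha } ?_ ?_ ?_ le_rfl le_rfl
  · simp only [State.blocks]; ring
  · simp only [State.potential]; apply le_of_eq; ring
  · simp only [State.potential, State.cnt]; apply le_of_eq; ring

theorem Inv.setByUid (hS : S.OK) (h : Inv S st s k) {q : PQ Redirect} (wf : q.WF S.P)
    (ha : q.age S.P ≤ S.R) (hp : PQ.Paid S.P S.L S.R st.byUid q s s') :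
    Inv S { st with byUid := q } s' (k + 1) := by
  refine h.step hS hp { h.wf with byUid := wf, byUidAge := ha } ?_ ?_ ?_ le_rfl le_rfl
  · simp only [State.blocks]; ring
  · simp only [State.potential]; apply le_of_eq; ring
  · simp only [State.potential, State.cnt]; apply le_of_eq; ring

/-- Each record in the unfinished block has saved two units. A full block thus has the `2 * B` that
its writing costs, although the write happens only once in `B` calls. -/
theorem Inv.setOut (hS : S.OK) (h : Inv S st s k) {x : Node} (hR : st.out.size + 1 ≤ S.R) :
    ∃ w s', st.out.put S.P.B x s = (w, s') ∧ w.size = st.out.size + 1 ∧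
      Inv S { st with out := w } s' (k + 1) := by
  obtain ⟨w, s', e, ok, hz, hl, hw, -⟩ := put_spec h.wf.out x s
  refine ⟨w, s', e, hz, ?_⟩
  have h1 := h.wf.out.size_eq
  have h2 := ok.size_eq
  have h3 := h.wf.out.cur_lt
  have hB := hS.params.B_pos
  have h4 : w.done.length ≤ st.out.done.length + 1 := by
    by_contra hcon
    have := Nat.mul_le_mul_left S.P.B (show st.out.done.length + 2 ≤ w.done.length by omega)
    rw [mul_add] at this
    omega
  have hr := rate_ge S.L
  have hr' : (0 : ℤ) ≤ S.P.d * rate S.L := by positivity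
  zify at h1 h2 h4 hl hz
  have hT : ((w.done.length : ℤ) - st.out.done.length) ≤ transient S.P S.L S.R := by
    have : (4 : ℤ) ≤ transient S.P S.L S.R := by
      unfold transient
      exact_mod_cast le_add_right (Nat.le_add_left 4 _)
    linarith
  refine h.step hS hw { h.wf with out := ok, outSize := by simp only; omega } ?_ ?_ ?_ hT (by positivity)
  · simp only [State.blocks]; ring
  · simp only [State.potential]
    nlinarith
  · simp only [State.potential, State.cnt]
    nlinarith [Int.natCast_nonneg S.P.e]

theorem suffix_length {α : Type} {l l' : List α} (h : l' <:+ l) : l'.length ≤ l.length :=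
  h.sublist.length_le

theorem Inv.nextArc (hS : S.OK) (h : Inv S st s k) :
    ∃ r s', st.arcs.next S.P.B s = ((st.arcs.cur.head?, r), s') ∧
      st.arcs.size = r.size + st.arcs.cur.head?.toList.length ∧
      Inv S { st with arcs := r } s' (k + 1) := by
  obtain ⟨r, s', e, ok, hs, hz, -, hw, -⟩ := next_spec h.wf.arcs s
  refine ⟨r, s', e, hz, h.step_small hS hw { h.wf with arcs := ok, input := ?_ } ?_ rfl rfl rfl⟩
  · have := suffix_length hs
    have := h.wf.input
    simp only; omega
  · simp only [State.blocks]; ring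

theorem Inv.nextTerm (hS : S.OK) (h : Inv S st s k) :
    ∃ r s', st.terms.next S.P.B s = ((st.terms.cur.head?, r), s') ∧
      st.terms.size = r.size + st.terms.cur.head?.toList.length ∧
      Inv S { st with terms := r } s' (k + 1) := by
  obtain ⟨r, s', e, ok, hs, hz, -, hw, -⟩ := next_spec h.wf.terms s
  refine ⟨r, s', e, hz, h.step_small hS hw { h.wf with terms := ok, input := ?_ } ?_ rfl rfl rfl⟩
  · have := suffix_length hs
    have := h.wf.input
    simp only; omega
  · simp only [State.blocks]; ring

theorem Inv.nextX (hS : S.OK) (h : Inv S st s k) :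
    ∃ o r s', st.xs.next S.P.B s = ((o, r), s') ∧ Inv S { st with xs := r } s' (k + 1) := by
  obtain ⟨r, s', e, ok, hs, hz, -, hw, -⟩ := next_spec h.wf.xs s
  refine ⟨_, r, s', e, h.step_small hS hw { h.wf with xs := ok, input := ?_ } ?_ rfl rfl rfl⟩
  · have := suffix_length hs
    have := h.wf.input
    simp only; omega
  · simp only [State.blocks]; ring

/-- Arcs and requests that are not yet consumed. -/
def State.pending (st : State) : ℕ :=
  st.arcs.size + st.terms.size + st.outerQ.size + st.innerQ.size + st.carry.length

/-- The numbers of insertions, when `n` more requests are about to be answered. -/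
structure Counts (S : Limits) (st : State) (n : ℕ) : Prop where
  outerQ : st.outerQ.age S.P + st.arcs.size + st.innerQ.size + st.carry.length + n ≤ S.R
  innerQ : st.innerQ.age S.P + st.arcs.size ≤ S.R
  byChild : st.byChild.age S.P + st.pending + n ≤ S.R
  byUid : st.byUid.age S.P + st.byChild.size + st.pending + n ≤ S.R
  out : st.out.size + st.byChild.size + st.pending + n ≤ S.R

/-- Operations that the pending records still give rise to. -/
def State.weight (st : State) : ℤ :=
  14 * st.arcs.size + 10 * (st.innerQ.size + st.carry.length) +
    9 * (st.outerQ.size + st.terms.size) + 7 * st.byChild.size + 3 * st.byUid.size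

/-- The state and the meter between two operations, when `κ` operations are paid for. -/
def Good (S : Limits) (st : State) (s : Meter) (κ : ℤ) : Prop :=
  Inv S st s (κ - st.weight) ∧ Counts S st 0

theorem Good.mono (h : Good S st s κ) {κ' : ℤ} (hk : κ ≤ κ') : Good S st s κ' :=
  ⟨h.1.mono (by linarith), h.2⟩

/-! ### The steps of the sweep, paid for by the weights of the records they consume. -/

theorem peekArc_spec (hS : S.OK) (h : Inv S st s k) :
    ∃ o q s', peekArc S.P st s = ((o, { st with outerQ := q }), s') ∧
      q.size = st.outerQ.size ∧ q.age S.P = st.outerQ.age S.P ∧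
      Inv S { st with outerQ := q } s' (k + 2) := by
  obtain ⟨o, q, s₁, e, wf, hz, ha, hp⟩ :=
    PQ.peek_spec hS.params hS.levels (lt := arcLt) h.wf.outerQ h.wf.outerAge s
  have h₁ := (h.setOuterQ hS wf (ha ▸ h.wf.outerAge) hp).tick hS
  refine ⟨if better arcLt o st.terms.cur.head? then o else st.terms.cur.head?, q, _, ?_, hz, ha,
    h₁.mono (by linarith)⟩
  simp only [peekArc, bind_run, e, pure_run]

theorem popArc_spec (hS : S.OK) (h : Inv S st s k) :
    ∃ o q r s', popArc S.P st s = ((o, { st with outerQ := q, terms := r }), s') ∧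
      st.outerQ.size + st.terms.size = q.size + r.size + o.toList.length ∧
      q.age S.P ≤ st.outerQ.age S.P ∧ Inv S { st with outerQ := q, terms := r } s' (k + 3) := by
  obtain ⟨o, q, s₁, e, wf, hz, ha, hp⟩ :=
    PQ.peek_spec hS.params hS.levels (lt := arcLt) h.wf.outerQ h.wf.outerAge s
  have h₁ := (h.setOuterQ hS wf (ha ▸ h.wf.outerAge) hp).tick hS
  by_cases hb : better arcLt o st.terms.cur.head?
  · obtain ⟨o', q', s₂, e₂, wf₂, hz₂, ha₂, hp₂⟩ :=
      PQ.pop_spec hS.params hS.levels (lt := arcLt) wf (ha ▸ h.wf.outerAge) (tick 1 s₁).2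
    refine ⟨o', q', st.terms, s₂, ?_, by omega, by omega,
      (h₁.setOuterQ hS wf₂ (by have := h.wf.outerAge; omega) hp₂).mono
        (by linarith)⟩
    simp only [popArc, bind_run, e, if_pos hb, e₂, pure_run]
  · obtain ⟨r, s₂, e₂, hz₂, h₂⟩ := h₁.nextTerm hS
    refine ⟨st.terms.cur.head?, q, r, s₂, ?_, ?_, by omega, h₂.mono (by linarith)⟩
    · simp only at e₂
      simp only [popArc, bind_run, e, if_neg hb, e₂, pure_run]
    · simp only at hz₂
      omega

/-- Two arcs release `18`. Looking ahead, two removals, the comparison and one insertion are `2 + 3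
+ 3 + 1 + 1` operations, and the new record in a sorter needs `7` or `3`. A round that stops the
loop performs no insertion and is covered by the extra `10`. -/
theorem gather_spec (hS : S.OK) (ℓ : ℕ) (h : Good S st s κ) :
    ∃ st' b s', gather S.P ℓ st s = ((st', b), s') ∧
      Good S st' s' (κ + if b then 0 else 10) := by
  obtain ⟨h, c1, c2, c3, c4, c5⟩ := h
  obtain ⟨o, q, s₁, e₁, hz₁, ha₁, h₁⟩ := peekArc_spec hS h
  simp only [State.pending] at c3 c4 c5
  have hfail : Good S { st with outerQ := q } s₁ (κ + 10) := by
    refine ⟨h₁.mono ?_, ?_, c2, ?_, ?_, ?_⟩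
    · simp only [State.weight, hz₁]; linarith
    all_goals simp only [State.pending]; omega
  cases hu : o.bind Arc.src with
  | none =>
    refine ⟨_, false, s₁, ?_, hfail⟩
    simp only [gather, bind_run, e₁, hu, pure_run]
  | some u =>
    by_cases hℓ : u.1 = ℓ
    · obtain ⟨o₂, q₂, r₂, s₂, e₂, hz₂, ha₂, h₂⟩ := popArc_spec hS h₁
      obtain ⟨o₃, q₃, r₃, s₃, e₃, hz₃, ha₃, h₃⟩ := popArc_spec hS h₂
      have h₄ := h₃.tick hS
      simp only at hz₂ hz₃ ha₂ ha₃ h₄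
      have hfail' : Good S { st with outerQ := q₃, terms := r₃ } (tick 1 s₃).2 (κ + 10) := by
        refine ⟨h₄.mono ?_, ?_, c2, ?_, ?_, ?_⟩
        · simp only [State.weight]; omega
        all_goals simp only [State.pending]; omega
      cases o₂ with
      | none =>
        refine ⟨_, false, _, ?_, hfail'⟩
        simp only [gather, bind_run, e₁, hu, if_pos hℓ, e₂, e₃, pure_run]
      | some a =>
        cases o₃ with
        | none =>
          refine ⟨_, false, _, ?_, hfail'⟩
          simp only [gather, bind_run, e₁, hu, if_pos hℓ, e₂, e₃, pure_run]
        | some b =>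
          simp only [Option.toList_some, List.length_singleton] at hz₂ hz₃
          by_cases hab : b.tgt = a.tgt
          · obtain ⟨q₅, s₅, e₅, wf₅, hz₅, ha₅, hp₅⟩ :=
              PQ.push_spec hS.params hS.levels (lt := redirectLt) h₃.wf.byUid
                (by simp only; omega) ⟨u, .keep b.tgt⟩ (tick 1 s₃).2
            simp only at hz₅ ha₅
            have h₅ := h₄.setByUid hS wf₅ (by omega) hp₅
            refine ⟨_, true, s₅, ?_, h₅.mono ?_, ?_, c2, ?_, ?_, ?_⟩
            · simp only [gather, bind_run, e₁, hu, if_pos hℓ, e₂, e₃, if_pos hab, e₅, pure_run]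
            · simp only [State.weight, if_true]; omega
            all_goals simp only [State.pending]; omega
          · obtain ⟨q₅, s₅, e₅, wf₅, hz₅, ha₅, hp₅⟩ :=
              PQ.push_spec hS.params hS.levels (lt := nodeLt) h₃.wf.byChild
                (by simp only; omega) ⟨u, b.tgt, a.tgt⟩ (tick 1 s₃).2
            simp only at hz₅ ha₅
            have h₅ := h₄.setByChild hS wf₅ (by omega) hp₅
            refine ⟨_, true, s₅, ?_, h₅.mono ?_, ?_, c2, ?_, ?_, ?_⟩
            · simp only [gather, bind_run, e₁, hu, if_pos hℓ, e₂, e₃, if_neg hab, e₅, pure_run]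
            · simp only [State.weight, if_true]; omega
            all_goals simp only [State.pending]; omega
    · refine ⟨_, false, s₁, ?_, hfail⟩
      simp only [gather, bind_run, e₁, hu, if_neg hℓ, pure_run]

/-- The weight `7` of a node pays for its removal, a comparison, the output, an insertion into
`byUid`, and the weight `3` of that record. -/
theorem dedupe_spec (hS : S.OK) (ℓ : ℕ) (nested : Bool) {prev : Option Node} {i : ℕ}
    (h : Good S st s κ) :
    ∃ x b s', dedupe S.P ℓ nested (st, prev, i) s = ((x, b), s') ∧
      Good S x.1 s' (κ + if b then 0 else 2) := by
  obtain ⟨h, c1, c2, c3, c4, c5⟩ := h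
  simp only [State.pending] at c3 c4 c5
  obtain ⟨o, q, s₁, e₁, wf₁, hz₁, ha₁, hp₁⟩ :=
    PQ.pop_spec hS.params hS.levels (lt := nodeLt) h.wf.byChild h.wf.byChildAge s
  have h₁ := (h.setByChild hS wf₁ (by omega) hp₁).tick hS
  cases o with
  | none =>
    refine ⟨({ st with byChild := q }, prev, i), false, _, ?_, h₁.mono ?_, c1, c2, ?_, ?_, ?_⟩
    · simp only [dedupe, bind_run, e₁, pure_run]
    · simp only [State.weight]; simp; omega
    all_goals simp only [State.pending]; omega
  | some v =>
    simp only [Option.toList_some, List.length_singleton] at hz₁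
    -- A duplicate is not output. Both cases are given the same bound, so that the insertion into
    -- `byUid` is treated only once.
    have hput : ∀ (same : Bool) (t : Node), ∃ w s₂, (if same then (pure st.out : Prog (Writer Node))
        else st.out.put S.P.B t) (tick 1 s₁).2 = (w, s₂) ∧ w.size ≤ st.out.size + 1 ∧
        Inv S { st with byChild := q, out := w } s₂ (κ - st.weight + 3) := by
      intro same t
      cases same
      · obtain ⟨w, s₂, e₂, hz₂, h₂⟩ := h₁.setOut hS (x := t) (by simp only; omega)
        exact ⟨w, s₂, e₂, hz₂.le, h₂.mono (by linarith)⟩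
      · exact ⟨st.out, _, rfl, by omega, h₁.mono (by linarith)⟩
    have hend : ∀ (w : Writer Node) (s₂ : Meter) (r : Redirect), w.size ≤ st.out.size + 1 →
        Inv S { st with byChild := q, out := w } s₂ (κ - st.weight + 3) →
        ∃ q' s', st.byUid.push S.P redirectLt r s₂ = (q', s') ∧
          Good S { st with byChild := q, out := w, byUid := q' } s' κ := by
      intro w s₂ r hzw h₂
      obtain ⟨q', s', e₃, wf₃, hz₃, ha₃, hp₃⟩ :=
        PQ.push_spec hS.params hS.levels (lt := redirectLt) h.wf.byUid (by omega) r s₂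
      refine ⟨q', s', e₃, (h₂.setByUid hS wf₃ (by omega) hp₃).mono ?_, c1, c2, ?_, ?_, ?_⟩
      · simp only [State.weight]; omega
      all_goals simp only [State.pending]; omega
    let same := match prev with
      | none => false
      | some t => decide (t.low = v.low) && decide (t.high = v.high)
    let t : Node := if same then prev.getD v else ⟨(ℓ, i - 1), v.low, v.high⟩
    obtain ⟨w, s₂, e₂, hz₂, h₂⟩ := hput same t
    obtain ⟨q', s', e₃, h₃⟩ := hend w s₂
      ⟨v.uid, if nested then .pair t.low t.high else .keep (.node t.uid)⟩ hz₂ h₂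
    refine ⟨({ st with byChild := q, out := w, byUid := q' }, some t, if same then i else i - 1),
      true, s', ?_, by simpa using h₃⟩
    -- Both branches of the output test end in this same continuation.
    let F : Writer Node → Prog ((State × Option Node × ℕ) × Bool) := fun out => do
      let q' ← st.byUid.push S.P redirectLt
        ⟨v.uid, if nested then .pair t.low t.high else .keep (.node t.uid)⟩
      pure (({ st with byChild := q, out := out, byUid := q' }, some t, if same then i else i - 1),
        true)
    have hF : F w s₂ = ((({ st with byChild := q, out := w, byUid := q' }, some t,
        if same then i else i - 1), true), s') := by
      simp only [F, bind_run, e₃, pure_run]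
    simp only [dedupe, bind_run, e₁]
    change (if same = true then (pure st.out >>= F) else (st.out.put S.P.B t >>= F)) _ = _
    by_cases hs : same = true
    · rw [if_pos hs] at e₂ ⊢
      rw [bind_run, e₂, hF]
    · rw [if_neg hs] at e₂ ⊢
      rw [bind_run, e₂, hF]

/-- `Counts S st 1` stands for the arc in hand, already taken from the input and not yet in a queue.
The count for `innerQ` has no such reserve, so `h2` supplies it separately. -/
theorem route_spec (hS : S.OK) (src : Option Uid) (high : Bool) (tgt : Target)
    (h : Inv S st s k) (hc : Counts S st 1) (h2 : st.innerQ.age S.P + st.arcs.size + 1 ≤ S.R) :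
    ∃ st' s', route S.P src high tgt st s = (st', s') ∧ Inv S st' s' (k + 2) ∧ Counts S st' 0 ∧
      st'.weight ≤ st.weight + 10 := by
  obtain ⟨c1, c2, c3, c4, c5⟩ := hc
  simp only [State.pending] at c3 c4 c5
  have h₁ := h.tick hS
  have houter : ∀ t : Ptr, ∃ q s', st.outerQ.push S.P arcLt ⟨src, high, t⟩ (tick 1 s).2 = (q, s') ∧
      Inv S { st with outerQ := q } s' (k + 2) ∧ Counts S { st with outerQ := q } 0 ∧
      State.weight { st with outerQ := q } ≤ st.weight + 10 := by
    intro t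
    obtain ⟨q, s', e, wf, hz, ha, hp⟩ :=
      PQ.push_spec hS.params hS.levels (lt := arcLt) h.wf.outerQ (by omega) ⟨src, high, t⟩ (tick 1 s).2
    refine ⟨q, s', e, (h₁.setOuterQ hS wf (by omega) hp).mono (by linarith),
      ⟨?_, by simp only; omega, ?_, ?_, ?_⟩, ?_⟩
    · simp only; omega
    iterate 3 · simp only [State.pending]; omega
    · simp only [State.weight]; omega
  have hinner : ∃ q s', st.innerQ.push S.P requestLt ⟨src, high, tgt⟩ (tick 1 s).2 = (q, s') ∧
      Inv S { st with innerQ := q } s' (k + 2) ∧ Counts S { st with innerQ := q } 0 ∧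
      State.weight { st with innerQ := q } ≤ st.weight + 10 := by
    obtain ⟨q, s', e, wf, hz, ha, hp⟩ :=
      PQ.push_spec hS.params hS.levels (lt := requestLt) h.wf.innerQ (by omega) ⟨src, high, tgt⟩
        (tick 1 s).2
    refine ⟨q, s', e, (h₁.setInnerQ hS wf (by omega) hp).mono (by linarith),
      ⟨?_, by simp only; omega, ?_, ?_, ?_⟩, ?_⟩
    · simp only; omega
    iterate 3 · simp only [State.pending]; omega
    · simp only [State.weight]; omega
  cases tgt with
  | keep t =>
    by_cases hst : stays st.xs.cur.head? src
    · obtain ⟨q, s', e, hr⟩ := houter t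
      refine ⟨_, s', ?_, hr⟩
      simp only [route, bind_run, if_pos hst, e, pure_run]
    · obtain ⟨q, s', e, hr⟩ := hinner
      refine ⟨_, s', ?_, hr⟩
      simp only [route, bind_run, if_neg hst, e, pure_run]
  | pair lo hi =>
    obtain ⟨q, s', e, hr⟩ := hinner
    refine ⟨_, s', ?_, hr⟩
    simp only [route, bind_run, e, pure_run]

/-- An input arc has weight `14`: four operations for the test, the read and the routing, and `10`
for the request that it may become. -/
theorem forwardArc_spec (hS : S.OK) (r : Redirect) (h : Good S st s κ) :
    ∃ st' b s', forwardArc S.P r st s = ((st', b), s') ∧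
      Good S st' s' (κ + if b then 0 else 1) := by
  obtain ⟨h, c1, c2, c3, c4, c5⟩ := h
  have h₁ := h.tick hS
  have hfail : Good S st (tick 1 s).2 (κ + 1) := ⟨h₁.mono (by linarith), c1, c2, c3, c4, c5⟩
  cases ha : st.arcs.cur.head? with
  | none =>
    refine ⟨st, false, _, ?_, hfail⟩
    simp only [forwardArc, bind_run, ha, pure_run]
  | some a =>
    by_cases hr : a.tgt = .node r.old
    · obtain ⟨rd, s₂, e₂, hz₂, h₂⟩ := h₁.nextArc hS
      rw [ha] at hz₂ e₂
      simp only [Option.toList_some, List.length_singleton] at hz₂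
      simp only [State.pending] at c3 c4 c5
      obtain ⟨st', s', e₃, h₃, hc₃, hw₃⟩ := route_spec hS a.src a.high r.new h₂
        ⟨by simp only; omega, by simp only; omega, by simp only [State.pending]; omega,
          by simp only [State.pending]; omega, by simp only [State.pending]; omega⟩
        (by simp only; omega)
      refine ⟨st', true, s', ?_, h₃.mono ?_, hc₃⟩
      · simp only [forwardArc, bind_run, ha, if_pos hr, e₂, e₃, pure_run]
      · simp only [State.weight, if_true] at hw₃ ⊢
        omega
    · refine ⟨st, false, _, ?_, hfail⟩
      simp only [forwardArc, bind_run, ha, if_neg hr, pure_run]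

/-- `a` is charged for every round and `c` only for the one that ends the loop. With `a = 0` the
bound does not depend on `n`, so nested loops do not multiply the cost. -/
theorem loopN_spec {σ : Type} {body : σ → Prog (σ × Bool)} {I : σ → Meter → ℤ → Prop} {a c : ℤ}
    (ha : 0 ≤ a) (hc : 0 ≤ c) (hI : ∀ x s κ κ', I x s κ → κ ≤ κ' → I x s κ')
    (hbody : ∀ x s κ, I x s κ → ∃ x' b s', body x s = ((x', b), s') ∧
      I x' s' (κ + a + if b then 0 else c)) (n : ℕ) :
    ∀ x s κ, I x s κ → ∃ x' s', loopN n body x s = (x', s') ∧ I x' s' (κ + a * n + c) := by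
  induction n with
  | zero => exact fun x s κ h => ⟨x, s, rfl, hI _ _ _ _ h (by push_cast; linarith)⟩
  | succ n ih =>
    intro x s κ h
    obtain ⟨x', b, s', e, h'⟩ := hbody x s κ h
    cases b with
    | false =>
      refine ⟨x', s', ?_, hI _ _ _ _ h' ?_⟩
      · simp only [loopN, bind_run, e]
        rfl
      · push_cast
        have : 0 ≤ a * n := by positivity
        simp; linarith
    | true =>
      obtain ⟨x'', s'', e₂, h₂⟩ := ih x' s' _ h'
      refine ⟨x'', s'', ?_, hI _ _ _ _ h₂ ?_⟩
      · simp only [loopN, bind_run, e, if_true, e₂]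
      · push_cast; simp; linarith

/-- A redirection has weight `3`: its removal, a test, and the round of the inner loop that finds no
further parent. -/
theorem forward_spec (hS : S.OK) (fuel : ℕ) (h : Good S st s κ) :
    ∃ st' b s', forward S.P fuel st s = ((st', b), s') ∧
      Good S st' s' (κ + if b then 0 else 2) := by
  obtain ⟨h, c1, c2, c3, c4, c5⟩ := h
  simp only [State.pending] at c3 c4 c5
  obtain ⟨o, q, s₁, e₁, wf₁, hz₁, ha₁, hp₁⟩ :=
    PQ.pop_spec hS.params hS.levels (lt := redirectLt) h.wf.byUid h.wf.byUidAge s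
  have h₁ := (h.setByUid hS wf₁ (by have := h.wf.byUidAge; omega) hp₁).tick hS
  have hc : Counts S { st with byUid := q } 0 :=
    ⟨c1, c2, by simp only [State.pending]; omega, by simp only [State.pending]; omega,
      by simp only [State.pending]; omega⟩
  cases o with
  | none =>
    refine ⟨{ st with byUid := q }, false, _, ?_, h₁.mono ?_, hc⟩
    · simp only [forward, bind_run, e₁, pure_run]
    · simp only [State.weight]; simp; omega
  | some r =>
    simp only [Option.toList_some, List.length_singleton] at hz₁
    have hg : Good S { st with byUid := q } (tick 1 s₁).2 (κ - 1) := by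
      refine ⟨h₁.mono ?_, hc⟩
      simp only [State.weight]; omega
    obtain ⟨st', s', e₂, h₂⟩ := loopN_spec (body := forwardArc S.P r) (I := Good S) (a := 0) (c := 1)
      le_rfl zero_le_one (fun _ _ _ _ h hk => h.mono hk)
      (fun x s κ hx => by simpa using forwardArc_spec hS r hx) fuel _ _ _ hg
    refine ⟨st', true, s', ?_, h₂.mono (by simp)⟩
    simp only [forward, bind_run, e₁, e₂, pure_run]

/-- The weight falls from `10` for a request to `9` for an arc in `outerQ`, which pays for the
insertion; a request that is carried on keeps its `10`. The term `10 * rs.length` represents the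
requests in hand. -/
theorem giveBack_spec (hS : S.OK) (f : Request → Ptr) (rs : List Request)
    (h : Inv S st s (κ - st.weight - 10 * rs.length)) (hc : Counts S st rs.length) :
    ∃ st' s', giveBack S.P f rs st s = (st', s') ∧ Good S st' s' κ := by
  induction rs generalizing st s with
  | nil => exact ⟨st, s, rfl, by simpa using h, hc⟩
  | cons r rs ih =>
    obtain ⟨c1, c2, c3, c4, c5⟩ := hc
    simp only [State.pending, List.length_cons] at c1 c3 c4 c5
    by_cases hst : stays st.xs.cur.head? r.src
    · obtain ⟨q, s₁, e, wf, hz, ha, hp⟩ :=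
        PQ.push_spec hS.params hS.levels (lt := arcLt) h.wf.outerQ (by omega) ⟨r.src, r.high, f r⟩ s
      obtain ⟨st', s', e', h'⟩ := ih (st := { st with outerQ := q }) (s := s₁)
        ((h.setOuterQ hS wf (by omega) hp).mono
          (by simp only [State.weight, List.length_cons]; push_cast; omega))
        ⟨by simp only; omega, c2, by simp only [State.pending]; omega,
          by simp only [State.pending]; omega, by simp only [State.pending]; omega⟩
      refine ⟨st', s', ?_, h'⟩
      rw [giveBack, if_pos hst, bind_run, e]
      exact e'
    · obtain ⟨st', s', e', h'⟩ := ih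
        (st := { st with carry := ⟨r.src, r.high, .keep (f r)⟩ :: st.carry }) (s := s)
        (by
          have : Inv S { st with carry := ⟨r.src, r.high, .keep (f r)⟩ :: st.carry } s
              (κ - st.weight - 10 * (r :: rs).length) := by
            obtain ⟨h1, h2, h3, h4, h5, h6, h7⟩ := h
            exact ⟨{ h1 with }, h2, h3, h4, h5, h6, h7⟩
          refine this.mono ?_
          simp only [State.weight, List.length_cons]; push_cast; omega)
        ⟨by simp only [List.length_cons]; omega, c2,
          by simp only [State.pending, List.length_cons]; omega,
          by simp only [State.pending, List.length_cons]; omega,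
          by simp only [State.pending, List.length_cons]; omega⟩
      refine ⟨st', s', ?_, h'⟩
      rw [giveBack, if_neg hst]
      exact e'

/-- The upper bound may charge even the uncharged insertions, since every request has paid for them,
and then discard their I/Os and steps. Their effect on disk space and on the potential of `outerQ`
has to be kept. -/
theorem callInner_spec (hS : S.OK) (inner : InnerSweep) (ℓ : ℕ) (h : Good S st s κ) :
    ∃ st' s', callInner S.P inner ℓ st s = (st', s') ∧ Good S st' s' (κ + 1) := by
  obtain ⟨h, c1, c2, c3, c4, c5⟩ := h
  simp only [State.pending] at c3 c4 c5
  obtain ⟨o, x, s₁, e₁, h₁⟩ := h.nextX hS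
  set reqs := st.innerQ.contents ++ st.carry with hreqs
  set ans := inner ℓ (st.base ++ st.out.contents) reqs with hans
  have hlen : reqs.length = st.innerQ.size + st.carry.length := by
    rw [hreqs, List.length_append, h.wf.innerQ.length_contents]
  set s₂ := (release (st.innerQ.blocks + st.out.done.length) s₁).2 with hs₂
  set st₂ : State := { st with xs := x, innerQ := PQ.empty S.P, carry := [], out := ⟨[], []⟩, base := ans.1 }
  have hB := hS.params.B_pos
  have h₂ : Inv S st₂ s₂ (κ - st.weight + 1) := by
    -- The savings of the emptied queue and the prepaid reads of the released blocks are forfeited;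
    -- both are nonnegative, so the invariant survives.
    have hpot := PQ.WF.potential_nonneg (P := S.P) (h.wf.innerQ.length_le hS.levels h.wf.innerAge)
    obtain ⟨w, i1, i2, i3, i4, i5, i6⟩ := h₁
    simp only [State.potential, State.cnt, State.blocks] at i1 i2 i3
    have hblk : (0 : ℤ) ≤ S.P.B * (st.innerQ.blocks + st.out.done.length : ℕ) := by positivity
    have hp' : 0 ≤ (S.P.d + 10 : ℤ) * st.innerQ.potential S.P S.L := by positivity
    have hc' : 0 ≤ (S.P.e + 2 : ℤ) * st.innerQ.cnt := by positivity
    refine ⟨⟨w.arcs, w.terms, w.xs, w.outerQ, PQ.empty_wf _, w.byChild, w.byUid, WriterOK.empty hB,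
      w.outerAge, by simp [st₂], w.byChildAge, w.byUidAge, by simp [Writer.size, st₂], w.input⟩,
      ?_, ?_, ?_, i4, i5, i6⟩
    · simp only [Meter.ioPot, State.potential, st₂, s₂, release, PQ.potential_empty,
        List.length_nil] at i1 ⊢
      push_cast at i1 hblk ⊢
      linarith
    · simp only [Meter.timePot, State.potential, State.cnt, st₂, s₂, release, PQ.potential_empty,
        PQ.cnt_empty, List.length_nil] at i2 ⊢
      push_cast at i2 hblk ⊢
      linarith
    · simp only [State.blocks, st₂, s₂, release, PQ.blocks_empty, List.length_nil] at i3 ⊢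
      push_cast
      linarith
  obtain ⟨st', s', e₃, h₃, hc₃⟩ := giveBack_spec (κ := κ + 1) hS ans.2 reqs
    (h₂.mono (by simp only [State.weight, st₂, hlen, PQ.size_empty]; push_cast; simp; omega))
    ⟨by simp [st₂, hlen]; omega, by simp [st₂]; omega,
      by simp [State.pending, st₂, hlen]; omega, by simp [State.pending, st₂, hlen]; omega,
      by simp [State.pending, st₂, hlen, Writer.size]; omega⟩
  refine ⟨st', { s' with io := s₂.io, time := s₂.time }, ?_, ?_, hc₃⟩
  · simp only [callInner, bind_run, e₁]
    change uncharged (giveBack S.P ans.2 reqs st₂) s₂ = _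
    simp only [uncharged, e₃]
  -- Resetting the two counters to their earlier values can only lower the potentials.
  · have hm := Mono.giveBack S.P ans.2 reqs st₂ s₂
    rw [e₃] at hm
    obtain ⟨m1, m2⟩ := hm
    obtain ⟨w, i1, i2, i3, i4, i5, i6⟩ := h₃
    refine ⟨w, ?_, ?_, i3, i4, i5, i6⟩
    · refine le_trans ?_ i1
      simp only [Meter.ioPot]
      have : (S.P.B : ℤ) * (s₂.io + s'.disk) ≤ S.P.B * (s'.io + s'.disk) :=
        mul_le_mul_of_nonneg_left (by zify at m1; linarith) (by positivity)
      linarith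
    · refine le_trans ?_ i2
      simp only [Meter.timePot]
      zify at m2
      linarith

/-- The work of a level that no record pays for is `2` to find the level, `10 + 2 + 2` for the last
rounds of the three loops, and `1` to advance to the next nested level; `20` is a convenient bound.
-/
theorem processLevel_spec (hS : S.OK) (inner : InnerSweep) (fuel : ℕ) (h : Good S st s κ) :
    ∃ st' b s', processLevel S.P inner fuel st s = ((st', b), s') ∧ Good S st' s' (κ + 20) := by
  obtain ⟨h, c1, c2, c3, c4, c5⟩ := h
  simp only [State.pending] at c3 c4 c5
  obtain ⟨o, q, s₁, e₁, hz₁, ha₁, h₁⟩ := peekArc_spec hS h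
  have hg : Good S { st with outerQ := q } s₁ (κ + 2) := by
    refine ⟨h₁.mono ?_, ?_, c2, ?_, ?_, ?_⟩
    · simp only [State.weight, hz₁]; linarith
    all_goals simp only [State.pending]; omega
  cases hu : o.bind Arc.src with
  | none =>
    refine ⟨_, false, s₁, ?_, hg.mono (by linarith)⟩
    simp only [processLevel, bind_run, e₁, hu, pure_run]
  | some u =>
    obtain ⟨st₂, s₂, e₂, h₂⟩ := loopN_spec (body := gather S.P u.1) (I := Good S) (a := 0) (c := 10)
      le_rfl (by norm_num) (fun _ _ _ _ h hk => h.mono hk)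
      (fun x s κ hx => by simpa using gather_spec hS u.1 hx) fuel _ _ _ hg
    set nested := decide (st.xs.cur.head? = some u.1) with hnested
    obtain ⟨x₃, s₃, e₃, h₃⟩ := loopN_spec (body := dedupe S.P u.1 nested)
      (I := fun x => Good S x.1) (a := 0) (c := 2)
      le_rfl (by norm_num) (fun _ _ _ _ h hk => h.mono hk)
      (fun x s κ hx => by
        obtain ⟨st, prev, i⟩ := x
        simpa using dedupe_spec hS u.1 nested hx) fuel (st₂, none, st₂.byChild.size) _ _ h₂
    obtain ⟨st₄, s₄, e₄, h₄⟩ := loopN_spec (body := forward S.P fuel) (I := Good S) (a := 0) (c := 2)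
      le_rfl (by norm_num) (fun _ _ _ _ h hk => h.mono hk)
      (fun x s κ hx => by simpa using forward_spec hS fuel hx) fuel _ _ _ h₃
    by_cases hn : nested = true
    · obtain ⟨st₅, s₅, e₅, h₅⟩ := callInner_spec hS inner u.1 h₄
      refine ⟨st₅, true, s₅, ?_, h₅.mono (by linarith)⟩
      simp only [processLevel, bind_run, e₁, hu, e₂, ← hnested, e₃, e₄, if_pos hn, e₅, pure_run]
    · refine ⟨st₄, true, s₄, ?_, h₄.mono (by linarith)⟩
      simp only [processLevel, bind_run, e₁, hu, e₂, ← hnested, e₃, e₄, if_neg hn, pure_run]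

end Operations

/-! ### The input -/

theorem toBlocks_cons {α : Type} {B : ℕ} (hB : 1 ≤ B) {l : List α} (h : l ≠ []) :
    toBlocks B l = l.take B :: toBlocks B (l.drop B) := by
  have hl : 0 < l.length := List.length_pos_iff.2 h
  have e : (l.length + B - 1) / B = ((l.drop B).length + B - 1) / B + 1 := by
    rw [List.length_drop]
    rcases le_total l.length B with hle | hle
    · rw [Nat.sub_eq_zero_of_le hle, Nat.div_eq_of_lt (by omega : 0 + B - 1 < B),
        Nat.div_eq_of_lt_le (k := 1) (by omega) (by omega)]
    · rw [← Nat.add_div_right _ (by omega : 0 < B)]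
      congr 1
      omega
  rw [toBlocks, e, List.range_succ_eq_map, List.map_cons, List.map_map]
  simp only [Nat.zero_mul, List.drop_zero, toBlocks]
  congr 1
  refine List.map_congr_left fun i _ => ?_
  simp only [Function.comp, List.drop_drop]
  rw [Nat.succ_mul, add_comm]

theorem toBlocks_nil {α : Type} {B : ℕ} (hB : 1 ≤ B) : toBlocks B ([] : List α) = [] := by
  simp only [toBlocks, List.length_nil, Nat.div_eq_of_lt (by omega : 0 + B - 1 < B)]
  rfl

theorem toBlocks_spec {α : Type} {B : ℕ} (hB : 1 ≤ B) (l : List α) :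
    RunOK B (toBlocks B l) ∧ (toBlocks B l).flatten = l := by
  induction hn : l.length using Nat.strong_induction_on generalizing l with
  | _ n ih =>
    by_cases h : l = []
    · subst h
      rw [toBlocks_nil hB]
      exact ⟨RunOK.nil, rfl⟩
    · have hl : 0 < l.length := List.length_pos_iff.2 h
      obtain ⟨h1, h2⟩ := ih (l.drop B).length (by rw [List.length_drop]; omega) _ rfl
      rw [toBlocks_cons hB h, RunOK.cons]
      refine ⟨⟨⟨?_, by simp⟩, h1⟩, by simp [h2]⟩
      simp only [ne_eq, List.take_eq_nil_iff, h, or_false]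
      omega

theorem mul_length_toBlocks {α : Type} {B : ℕ} (hB : 1 ≤ B) (l : List α) :
    B * (toBlocks B l).length ≤ l.length + B := by
  simp only [toBlocks, List.length_map, List.length_range]
  have := Nat.mul_div_le (l.length + B - 1) B
  omega

theorem OBDD.length_arcs (f : OBDD) : f.arcs.length = 2 * f.size + 1 := by
  have h : 1 ≤ f.nodes.length := List.length_pos_iff.2 f.nonempty
  simp only [OBDD.arcs, List.length_append, List.length_flatMap, List.length_map, List.length_take,
    List.length_cons, List.length_nil, OBDD.size]
  rw [List.map_const']
  simp
  omega

theorem OBDD.length_internalArcs_add (f : OBDD) :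
    f.internalArcs.length + f.terminalArcs.length = 2 * f.size + 1 := by
  rw [← f.length_arcs, OBDD.internalArcs, OBDD.terminalArcs, List.length_mergeSort]
  generalize f.arcs = l
  induction l with
  | nil => rfl
  | cons a l ih =>
    cases h : a.tgt.isTerm <;> simp [h] at ih ⊢ <;> omega

theorem OBDD.length_levels (f : OBDD) (X : Finset ℕ) :
    (f.levels.filter (· ∈ X)).length ≤ f.size := by
  refine (List.length_filter_le _ _).trans ?_
  rw [OBDD.levels, List.length_reverse]
  exact (List.dedup_sublist _).length_le.trans (by simp [OBDD.size])

/-- The number of blocks of the input. -/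
def OBDD.blocks (B : ℕ) (f : OBDD) (X : Finset ℕ) : ℕ :=
  (toBlocks B f.internalArcs).length + (toBlocks B f.terminalArcs).length +
    (toBlocks B (f.levels.filter (· ∈ X))).length

theorem OBDD.mul_blocks_le {B : ℕ} (hB : 1 ≤ B) (f : OBDD) (X : Finset ℕ) :
    B * f.blocks B X ≤ 3 * f.size + 1 + 3 * B := by
  have h1 := mul_length_toBlocks hB f.internalArcs
  have h2 := mul_length_toBlocks hB f.terminalArcs
  have h3 := mul_length_toBlocks hB (f.levels.filter (· ∈ X))
  have h4 := f.length_internalArcs_add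
  have h5 := f.length_levels X
  rw [OBDD.blocks, mul_add, mul_add]
  omega

/-- The state before the first level. -/
def State.initial (P : Params) (arcs terms : Reader Arc) (xs : Reader ℕ) : State :=
  ⟨arcs, terms, xs, PQ.empty P, PQ.empty P, [], PQ.empty P, PQ.empty P, ⟨[], []⟩, []⟩

/-- This isolates the initialisation. The four readers and writers and the four queues reserve `8 *
B + 8 * 2 ^ e` records of memory, and the input blocks account for the whole initial I/O potential.
-/
theorem outerReduce_run {P : Params} (hP : P.OK) (f : OBDD) (X : Finset ℕ) (inner : InnerSweep) :
    ∃ arcs terms xs s₀,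
      (outerReduce P f X inner (Meter.initial P.B f X)).2 =
        ((loopN (f.arcs.length + 1) (processLevel P inner (f.arcs.length + 1))
          (State.initial P arcs terms xs) >>= fun st => peekArc P st >>= fun a =>
            a.2.out.finish P.B) s₀).2 ∧
      ReaderOK P.B arcs ∧ ReaderOK P.B terms ∧ ReaderOK P.B xs ∧
      arcs.size = f.internalArcs.length ∧ terms.size = f.terminalArcs.length ∧
      terms.cur ++ terms.rest.flatten = f.terminalArcs ∧
      s₀.ioPot P.B ≤ P.B * f.blocks P.B X ∧
      s₀.timePot P.B ≤ P.B * f.blocks P.B X + 8 * 2 ^ P.e ∧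
      s₀.disk = arcs.rest.length + terms.rest.length + xs.rest.length ∧
      arcs.rest.length + terms.rest.length + xs.rest.length ≤ f.blocks P.B X ∧
      s₀.diskPeak ≤ f.blocks P.B X ∧
      s₀.mem = 8 * P.B + 8 * 2 ^ P.e ∧ s₀.memPeak ≤ 8 * P.B + 8 * 2 ^ P.e := by
  have hB := hP.B_pos
  obtain ⟨o1, e1⟩ := toBlocks_spec hB f.internalArcs
  obtain ⟨o2, e2⟩ := toBlocks_spec hB f.terminalArcs
  obtain ⟨o3, e3⟩ := toBlocks_spec hB (f.levels.filter (· ∈ X))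
  obtain ⟨arcs, s₁, r1, k1, c1, d1, z1, w1, -⟩ :=
    fetch_spec o1 (alloc (4 * P.B) (Meter.initial P.B f X)).2
  obtain ⟨terms, s₂, r2, k2, c2, d2, z2, w2, -⟩ := fetch_spec o2 s₁
  obtain ⟨xs, s₃, r3, k3, c3, d3, z3, w3, -⟩ := fetch_spec o3 s₂
  -- Only the meter after creating the queues matters, and it does not depend on their record types.
  refine ⟨arcs, terms, xs,
    (do
      let _ ← PQ.new (α := Arc) P; let _ ← PQ.new (α := Arc) P
      let _ ← PQ.new (α := Arc) P; PQ.new (α := Arc) P : Prog (PQ Arc)) s₃ |>.2,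
    ?_, k1, k2, k3, ?_, ?_, ?_, ?_⟩
  · simp only [outerReduce, bind_run, r1, r2, r3, PQ.new, pure_run, State.initial]
  · rw [z1, ← Run.length_flatten, e1]
  · rw [z2, ← Run.length_flatten, e2]
  · rw [c2, d2]
    cases h : toBlocks P.B f.terminalArcs with
    | nil => rw [h] at e2; simpa using e2
    | cons b bs => rw [h] at e2; simpa using e2
  · obtain ⟨i1, i2, i3, i4, i5, i6, i7⟩ := (w1.trans w2).trans w3
    simp only [alloc, Meter.initial, Meter.ioPot, Meter.timePot] at i1 i2 i3 i4 i5 i6 i7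
    have l1 : arcs.rest.length ≤ (toBlocks P.B f.internalArcs).length := by simp [d1]
    have l2 : terms.rest.length ≤ (toBlocks P.B f.terminalArcs).length := by simp [d2]
    have l3 : xs.rest.length ≤ (toBlocks P.B (f.levels.filter (· ∈ X))).length := by simp [d3]
    simp only [PQ.new, bind_run, pure_run, alloc, tick, Meter.ioPot, Meter.timePot, OBDD.blocks,
      pow_succ]
    push_cast at *
    refine ⟨?_, ?_, ?_, ?_, ?_, ?_, ?_⟩
    · simpa using i1
    · linarith
    · linarith
    · omega
    · omega
    · linarith
    · have : (0 : ℤ) ≤ 2 ^ P.e := by positivity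
      omega

/-! ### Upper bounds for the whole sweep -/

theorem Inv.disk_room {S : Limits} {st : State} {s : Meter} {k : ℤ} (hS : S.OK)
    (h : Inv S st s k) : s.disk + transient S.P S.L S.R ≤ S.disk := by
  have e1 := h.wf.blocks_le hS
  have e2 := hS.disk
  rw [← h.disk] at e1
  refine le_of_mul_le_mul_left (a := (S.P.B : ℤ)) ?_ (by exact_mod_cast hS.params.B_pos)
  linarith

theorem State.WF.potential_nonneg {S : Limits} {st : State} (hS : S.OK) (h : st.WF S) :
    0 ≤ st.potential S := by
  have h1 := PQ.WF.potential_nonneg (P := S.P) (h.outerQ.length_le hS.levels h.outerAge)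
  have h2 := PQ.WF.potential_nonneg (P := S.P) (h.innerQ.length_le hS.levels h.innerAge)
  have h3 := PQ.WF.potential_nonneg (P := S.P) (h.byChild.length_le hS.levels h.byChildAge)
  have h4 := PQ.WF.potential_nonneg (P := S.P) (h.byUid.length_le hS.levels h.byUidAge)
  unfold State.potential
  positivity

theorem outerReduce_upper {P : Params} (hP : P.OK) (f : OBDD) (X : Finset ℕ) (inner : InnerSweep)
    {L : ℕ} {D M : ℤ} (hL : ∀ n, (2 ^ P.d - 1) ^ n * 2 ^ P.e ≤ 2 * f.size + 1 → n + 1 ≤ L)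
    (hD : P.B * (f.blocks P.B X + transient P L (2 * f.size + 1)) + 69 * (2 * f.size + 1) ≤ P.B * D)
    (hM : 8 * P.B + 8 * 2 ^ P.e + P.mergeMem ≤ M) :
    ∃ s, (outerReduce P f X inner (Meter.initial P.B f X)).2 = s ∧
      (P.B * s.io : ℤ) ≤ P.B * f.blocks P.B X + 4 * rate L * (68 * f.size + 70) + 2 * P.B ∧
      (s.time : ℤ) ≤ P.B * f.blocks P.B X + 8 * 2 ^ P.e +
        ((P.d + 10) * rate L + 3 * (P.e + 2)) * (68 * f.size + 70) + 2 * P.B ∧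
      s.diskPeak ≤ D ∧ s.memPeak ≤ M := by
  obtain ⟨arcs, terms, xs, s₀, run, k1, k2, k3, z1, z2, -, i1, i2, i3, i4, i5, i6, i7⟩ :=
    outerReduce_run hP f X inner
  have hB := hP.B_pos
  have hZ := f.length_internalArcs_add
  let S : Limits := ⟨P, L, 2 * f.size + 1, f.blocks P.B X, s₀.ioPot P.B, s₀.timePot P.B, D, s₀.mem, M⟩
  have hS : S.OK := ⟨hP, hL, by simp only [S]; push_cast at hD ⊢; linarith,
    by simp only [S, i6]; linarith⟩
  set st := State.initial P arcs terms xs with hst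
  -- The difference is `14` times the number of arcs, which covers the initial weight: `14` per
  -- internal arc and `9` per arc to a terminal. The loop adds `20` per round later.
  have h₀ : Good S st s₀ (34 * (2 * f.size + 1) - 20 * (2 * f.size + 1)) := by
    refine ⟨Inv.mono (k := 0) ⟨⟨k1, k2, k3, PQ.empty_wf _, PQ.empty_wf _, PQ.empty_wf _,
      PQ.empty_wf _, WriterOK.empty hB, ?_, ?_, ?_, ?_, ?_, i4⟩, ?_, ?_, ?_, ?_, rfl, ?_⟩ ?_, ?_⟩
    iterate 4 · simp [hst, State.initial, S]
    · simp [hst, State.initial, Writer.size]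
    · simp [hst, State.initial, S, State.potential]
    · simp [hst, State.initial, S, State.potential, State.cnt]
    · simp [hst, State.initial, State.blocks, i3]
    · simp only [S]
      have : (P.B : ℤ) * f.blocks P.B X ≤ P.B * D := by
        have : (0 : ℤ) ≤ P.B * transient P L (2 * f.size + 1) := by positivity
        rw [mul_add] at hD
        linarith
      exact i5.trans (le_of_mul_le_mul_left this (by exact_mod_cast hB))
    · simp only [S]
      have : (0 : ℤ) ≤ P.mergeMem := by positivity
      linarith
    · simp only [State.weight, hst, State.initial, PQ.size_empty, List.length_nil]
      push_cast
      omega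
    · constructor <;>
        simp [State.pending, hst, State.initial, PQ.size_empty, S, Writer.size] <;> omega
  obtain ⟨st₁, s₁, e₁, h₁⟩ := loopN_spec (body := processLevel P inner (f.arcs.length + 1))
    (I := Good S) (a := 20) (c := 0) (by norm_num) le_rfl (fun _ _ _ _ h hk => h.mono hk)
    (fun x s κ hx => by simpa using processLevel_spec hS inner (f.arcs.length + 1) hx)
    (f.arcs.length + 1) _ _ _ h₀
  obtain ⟨h₁, -⟩ := h₁
  obtain ⟨o, q, s₂, e₂, hz₂, ha₂, h₂⟩ := peekArc_spec hS h₁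
  obtain ⟨r, s₃, e₃, hok₃, hz₃, hs₃, -, hd₃, w₃, -⟩ := finish_spec h₂.wf.out s₂
  have hroom := h₂.disk_room hS
  have hpot := h₂.wf.potential_nonneg hS
  have hwt : 0 ≤ st₁.weight := by unfold State.weight; positivity
  have hcnt : 0 ≤ State.cnt { st₁ with outerQ := q } := by unfold State.cnt; positivity
  have hok := h₂.wf.out.size_eq
  -- Finishing the output writes at most the one partial block.
  have hl₃ : r.length ≤ st₁.out.done.length + 1 := by
    have h5 := h₂.wf.out.cur_lt
    have h6 := hok₃.mul_length
    simp only at hok h5 hz₃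
    by_contra hcon
    have := Nat.mul_le_mul_left P.B (show st₁.out.done.length + 2 ≤ r.length by omega)
    rw [mul_add] at this
    simp only [S] at *
    omega
  have hk : 34 * (2 * (f.size : ℤ) + 1) - 20 * (2 * f.size + 1) + 20 * (f.arcs.length + 1 : ℕ) + 0 -
      st₁.weight + 2 ≤ 68 * f.size + 70 := by
    rw [f.length_arcs]; push_cast; linarith
  obtain ⟨-, j1, j2, j3, j4, j5, j6⟩ := h₂.mono hk
  generalize State.potential S { st₁ with outerQ := q } = p at hpot j1 j2
  generalize State.cnt { st₁ with outerQ := q } = c at hcnt j2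
  obtain ⟨v1, v2, v3, v4, v5, v6, v7⟩ := w₃
  have hdisk : 0 ≤ s₃.disk := by
    rw [v3, j3]
    simp only [State.blocks]
    zify at hd₃
    linarith
  have hcur := Int.natCast_nonneg st₁.out.cur.length
  have hBd := mul_nonneg (Int.natCast_nonneg P.B) hdisk
  have hT : (4 : ℤ) ≤ transient P L (2 * f.size + 1) := by
    unfold transient
    exact_mod_cast le_add_right (Nat.le_add_left 4 _)
  have hlen : (2 * P.B : ℤ) * (r.length - st₁.out.done.length) ≤ 2 * P.B * 1 := by
    zify at hl₃
    exact mul_le_mul_of_nonneg_left (by linarith) (by positivity)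
  have hp' : 0 ≤ (P.d + 10 : ℤ) * p := by positivity
  have hc' : 0 ≤ (P.e + 2 : ℤ) * c := by positivity
  refine ⟨s₃, ?_, ?_, ?_, ?_, ?_⟩
  · rw [run]
    simp only [S] at e₂ e₃
    simp only [bind_run, e₁, e₂, e₃]
  · simp only [Meter.ioPot, S] at i1 j1 v1
    linarith
  · simp only [Meter.timePot, S] at i2 j2 v2
    linarith
  · refine v5.trans (max_le j4 ?_)
    simp only [S] at hroom
    zify at hl₃
    simp only
    linarith
  · refine v7.trans (max_le j6 ?_)
    have : (0 : ℤ) ≤ P.mergeMem := by positivity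
    simp only [S] at j5 i6
    linarith

/-! ### Lower bounds for insertions into a priority queue -/

section Filling

variable {α : Type} {P : Params}

/-- The number of times that records were moved by merges, if there were insertions only. -/
def lvlsWork (ls : List (Lvl α)) : ℤ := lvlsSize ls - pot 0 ls

/-- A priority queue after `i` insertions, and the cost of these. -/
structure PQ.Filled (P : Params) (q : PQ α) (i : ℕ) (s : Meter) : Prop where
  wf : q.WF P
  del : q.del = []
  shape : InsertOnly P 0 q.lvls
  size : q.size = i
  age : q.age P = i
  io : lvlsWork q.lvls ≤ P.B * s.io
  time : (P.d + 1) * lvlsWork q.lvls + (P.e + 1) * i ≤ s.time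

theorem PQ.Filled.mono {q : PQ α} {i : ℕ} {s s' : Meter} (h : q.Filled P i s)
    (hs : AtLeast s s' 0 0) : q.Filled P i s' := by
  obtain ⟨h1, h2, h3, h4, h5, h6, h7⟩ := h
  obtain ⟨i1, i2⟩ := hs
  refine ⟨h1, h2, h3, h4, h5, h6.trans ?_, h7.trans ?_⟩
  · gcongr; omega
  · gcongr; omega

theorem PQ.Filled.empty (P : Params) (s : Meter) : (PQ.empty P : PQ α).Filled P 0 s :=
  ⟨PQ.empty_wf P, rfl, trivial, rfl, by simp,
    by simp only [lvlsWork, PQ.empty, pot, lvlsSize_nil]; positivity,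
    by simp [lvlsWork, PQ.empty, pot]⟩

/-- A flush raises `lvlsWork` by exactly the number `m` of records moved by its merges, because
`del` is empty and the identity for `m` may be used with `w = 0`. Each moved record costs at least
`1 / B` I/Os and `d + 1` steps, and the insertion itself `e + 1` steps. -/
theorem PQ.Filled.push (hP : P.OK) {lt : α → α → Bool} {q : PQ α} {i : ℕ} {s : Meter}
    (h : q.Filled P i s) (x : α) :
    ∃ q' s', q.push P lt x s = (q', s') ∧ q'.Filled P (i + 1) s' := by
  obtain ⟨wf, h2, h3, h4, h5, h6, h7⟩ := h
  by_cases hc : q.cnt < 2 ^ P.e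
  · obtain ⟨t, s', e, ok, sm, hz, hw, ha⟩ :=
      Tree.insert_spec (lt := lt) hP.B_pos wf.ins wf.small (wf.cnt ▸ hc) x (tick 1 s).2
    have hs := (tick_atLeast 1 s).trans ha
    refine ⟨{ q with ins := t, cnt := q.cnt + 1 }, s', ?_, ?_⟩
    · simp only [PQ.push, bind_run, if_pos hc, pure_run, e]
    · obtain ⟨i1, i2⟩ := hs
      refine ⟨⟨ok, sm, by simp [hz, wf.cnt], wf.del, wf.lvls, wf.ext, wf.total⟩, h2, h3, ?_, ?_, ?_, ?_⟩
      · simp only [PQ.size] at h4 ⊢; omega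
      · simp only [PQ.age] at h5 ⊢; omega
      · refine h6.trans ?_
        gcongr; omega
      · zify at i2
        push_cast
        linarith
  · have hcnt := le_antisymm wf.cnt_le (not_lt.1 hc)
    obtain ⟨q', s₁, e₁, ok₁, sm₁, hr₁, hc₁, hd₁, hx₁, hl₁, hz₁, hn₁, hp₁, m, hm, -, i₁, t₁, hi, ht, ha₁⟩ :=
      PQ.flush_spec hP (lt := lt) wf hcnt (tick 1 s).2
    obtain ⟨t, s', e, ok, sm, hz, hw, ha⟩ :=
      Tree.insert_spec (lt := lt) hP.B_pos ok₁ sm₁ (by rw [hr₁]; positivity) x s₁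
    have hs := ((tick_atLeast 1 s).trans ha₁).trans ha
    have hm0 := hm 0
    refine ⟨{ q' with ins := t, cnt := q'.cnt + 1 }, s', ?_, ?_⟩
    · simp only [PQ.push, bind_run, if_neg hc, e₁, e, pure_run]
    · obtain ⟨j1, j2⟩ := hs
      have hwork : lvlsWork q'.lvls = lvlsWork q.lvls + m := by
        rw [h2, List.length_nil] at hx₁ hm0
        have := wf.ext
        simp only [lvlsWork]
        rw [← hz₁, hx₁, hcnt, wf.ext]
        push_cast at hm0 ⊢
        linarith
      refine ⟨⟨ok, sm, by simp [hz, hr₁, hc₁], by simp [hd₁], hl₁, hz₁, ?_⟩, hd₁, hp₁ h2 h3, ?_, ?_, ?_, ?_⟩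
      · have := wf.total
        simp only [hd₁, hx₁, hn₁, add_mul, List.length_nil]
        omega
      · simp only [PQ.size, hd₁, hc₁, h2, List.length_nil] at h4 hx₁ ⊢; omega
      · simp only [PQ.age, hc₁, hn₁] at h5 ⊢
        rw [add_mul]
        omega
      · zify at j1
        simp only [hwork]
        have : (P.B : ℤ) * (s.io + i₁) ≤ P.B * s'.io := by gcongr; linarith
        linarith
      · zify at j2
        simp only [hwork]
        push_cast
        linarith

/-- The numbers of files are digits smaller than the base. -/
theorem counter_lt {ls : List (Lvl α)} (h : LvlsOK P ls) :
    counter (2 ^ P.d - 1) ls < (2 ^ P.d - 1) ^ ls.length := by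
  induction ls with
  | nil => simp [counter]
  | cons l ls ih =>
    obtain ⟨-, -, -, h4, -, h6⟩ := h
    have := Nat.mul_le_mul_left (2 ^ P.d - 1) (ih h6)
    simp only [counter, List.length_cons, pow_succ']
    rw [Nat.mul_succ] at this
    omega

/-- `T` is the size of the deepest level. A counter with nonzero leading digit exceeds all that its
lower digits can contribute, so at least half of the records are there. Each level adds one move to
their history, and for `w ≤ 1` the other levels contribute nonnegative work. -/
theorem InsertOnly.exists_top {ls : List (Lvl α)} {k : ℕ} {w : ℤ} (h : InsertOnly P k ls)
    (hok : LvlsOK P ls) (hne : ls ≠ []) (hw : w ≤ 1) :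
    ∃ T : ℕ, (ls.length - w) * T ≤ lvlsSize ls - pot w ls ∧
      lvlsSize ls + (2 ^ P.d - 1) ^ k * 2 ^ P.e ≤ 2 * T := by
  induction ls generalizing k w with
  | nil => exact absurd rfl hne
  | cons l ls ih =>
    obtain ⟨h1, h2, h3⟩ := h
    obtain ⟨-, -, -, h4, h5, h6⟩ := hok
    have hs := runsSize_eq_mul h2
    set c := (2 ^ P.d - 1) ^ k * 2 ^ P.e with hc
    by_cases hls : ls = []
    · subst hls
      refine ⟨runsSize l.runs, ?_, ?_⟩
      · simp only [pot, h1, lvlsSize_cons, lvlsSize_nil, Run.size_nil, List.length_singleton]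
        push_cast
        linarith
      · simp only [counter, List.length_nil, pow_zero, mul_zero, add_zero] at h5
        have := Nat.mul_le_mul_right c h5
        simp only [h1, lvlsSize_cons, lvlsSize_nil, Run.size_nil]
        omega
    · obtain ⟨T, hT, hT'⟩ := ih (w := w - 1) h3 h6 hls (by linarith)
      refine ⟨T, ?_, ?_⟩
      · have : 0 ≤ (1 - w) * (runsSize l.runs : ℤ) := mul_nonneg (by linarith) (by positivity)
        simp only [pot, h1, lvlsSize_cons, Run.size_nil, List.length_cons]
        push_cast
        linarith
      · have h7 := Nat.mul_le_mul_right c (show l.runs.length + 1 ≤ 2 ^ P.d - 1 by omega)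
        have h8 : (2 ^ P.d - 1) ^ (k + 1) * 2 ^ P.e = (2 ^ P.d - 1) * c := by rw [hc]; ring
        rw [h8] at hT'
        simp only [h1, lvlsSize_cons, Run.size_nil]
        rw [add_mul] at h7
        omega

/-- `K` is the number of levels of the priority queue. -/
theorem PQ.Filled.cost {q : PQ α} {n : ℕ} {s : Meter} (h : q.Filled P n s)
    (hn : 2 ^ P.e < n) :
    ∃ K, 1 ≤ K ∧ n ≤ 2 ^ (P.d * K + P.e) ∧ K * (n - 2 ^ P.e : ℤ) ≤ 2 * P.B * s.io ∧
      (P.d + 1) * (K * (n - 2 ^ P.e : ℤ)) + 2 * (P.e + 1) * n ≤ 2 * s.time := by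
  obtain ⟨wf, h2, h3, h4, h5, h6, h7⟩ := h
  have hcnt := wf.cnt_le
  have hlt := counter_lt wf.lvls
  have hext := wf.ext
  simp only [PQ.size, h2, List.length_nil] at h4
  have hne : q.lvls ≠ [] := by
    intro h0
    rw [h0, lvlsSize_nil] at hext
    omega
  obtain ⟨T, hT, hT'⟩ := h3.exists_top wf.lvls hne (w := 0) (by norm_num)
  -- All but the at most `2 ^ e` records in the insertion buffer are external, so `n - 2 ^ e ≤ 2 *
  -- T`.
  have hwork : q.lvls.length * (n - 2 ^ P.e : ℤ) ≤ 2 * lvlsWork q.lvls := by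
    have : (n - 2 ^ P.e : ℤ) ≤ 2 * T := by
      have : n ≤ 2 ^ P.e + 2 * T := by omega
      zify at this
      linarith
    calc (q.lvls.length * (n - 2 ^ P.e : ℤ)) ≤ q.lvls.length * (2 * T) := by gcongr
      _ = 2 * ((q.lvls.length - 0) * T) := by ring
      _ ≤ _ := by rw [lvlsWork]; linarith
  refine ⟨q.lvls.length, List.length_pos_iff.2 hne, ?_, by linarith, ?_⟩
  · have h8 : (2 ^ P.d - 1) ^ q.lvls.length ≤ (2 ^ P.d) ^ q.lvls.length :=
      Nat.pow_le_pow_left (Nat.sub_le _ _) _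
    have h9 := Nat.mul_le_mul_right (2 ^ P.e) (hlt.trans_le h8)
    rw [pow_add, pow_mul]
    rw [Nat.succ_mul] at h9
    simp only [PQ.age] at h5
    omega
  · have := mul_le_mul_of_nonneg_left hwork (by positivity : (0 : ℤ) ≤ P.d + 1)
    linarith

end Filling

/-! ### Lower bounds for the deepest level -/

theorem atLeast_loopN {σ : Type} {body : σ → Prog (σ × Bool)} (h : ∀ x, Mono (body x)) (n : ℕ) (x : σ)
    (s : Meter) : AtLeast (body x s).2 (loopN (n + 1) body x s).2 0 0 := by
  simp only [loopN, bind_run]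
  split
  exacts [Mono.loopN h n _ _, Mono.pure _ _]

def Reader.contents {α : Type} (r : Reader α) : List α := r.cur ++ r.rest.flatten

theorem ReaderOK.head?_cur {α : Type} {B : ℕ} {r : Reader α} (h : ReaderOK B r) :
    r.cur.head? = r.contents.head? := by
  cases hc : r.cur with
  | nil => simp [Reader.contents, hc, h.rest_nil hc]
  | cons x xs => simp [Reader.contents, hc]

theorem ReaderOK.next {α : Type} {B : ℕ} {r : Reader α} (h : ReaderOK B r) {x : α} {l : List α}
    (hl : r.contents = x :: l) (s : Meter) :
    ∃ r' s', r.next B s = ((some x, r'), s') ∧ ReaderOK B r' ∧ r'.contents = l ∧ AtLeast s s' 0 0 := by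
  obtain ⟨r', s', e, ok, -, -, hc, -, ha⟩ := next_spec h s
  have hh := h.head?_cur
  rw [hl, List.head?_cons] at hh
  refine ⟨r', s', by rw [e, hh], ok, ?_, ha.mono le_rfl (Nat.zero_le _)⟩
  obtain ⟨y, ys, hy⟩ : ∃ y ys, r.cur = y :: ys :=
    ⟨x, List.head?_eq_some_iff.1 hh⟩
  rw [Reader.contents, ← hc]
  rw [Reader.contents, hy] at hl
  rw [hy]
  exact (List.cons.inj hl).2

section Deepest

variable {P : Params} {st : State} {a b : Arc} {l : List Arc} {i : ℕ} {s : Meter}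

theorem PQ.peek_empty {α : Type} (P : Params) (lt : α → α → Bool) (s : Meter) :
    (PQ.empty P).peek P lt s = ((none, PQ.empty P), (tick 2 s).2) := by
  simp only [PQ.peek, PQ.load, PQ.empty, bind_run, lt_self_iff_false, decide_false, Bool.and_false,
    Bool.false_eq_true, if_false, pure_run, Tree.top_empty, better, List.head?_nil]
  rfl

theorem peekArc_terms (hq : st.outerQ = PQ.empty P) (ht : ReaderOK P.B st.terms)
    (hl : st.terms.contents = a :: l) (s : Meter) :
    ∃ s', peekArc P st s = ((some a, st), s') ∧ AtLeast s s' 0 0 := by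
  have hh := ht.head?_cur
  rw [hl, List.head?_cons] at hh
  refine ⟨(peekArc P st s).2, ?_, Mono.peekArc P st s⟩
  simp only [peekArc, bind_run, hq, PQ.peek_empty, pure_run, better, hh]
  rw [← hq]
  rfl

theorem popArc_terms (hq : st.outerQ = PQ.empty P) (ht : ReaderOK P.B st.terms)
    (hl : st.terms.contents = a :: l) (s : Meter) :
    ∃ r s', popArc P st s = ((some a, { st with terms := r }), s') ∧ ReaderOK P.B r ∧
      r.contents = l ∧ AtLeast s s' 0 0 := by
  obtain ⟨r, s', e, ok, hc, ha⟩ := ht.next hl (tick 1 (tick 2 s).2).2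
  refine ⟨r, s', ?_, ok, hc, ((Mono.tick 2 s).trans (Mono.tick 1 _)).trans ha⟩
  simp only [popArc, bind_run, hq, PQ.peek_empty, pure_run, better, Bool.false_eq_true, if_false, e]

theorem gather_terms (hP : P.OK) {u : Uid} {lo hi : Ptr} (hne : lo ≠ hi)
    (hq : st.outerQ = PQ.empty P) (ht : ReaderOK P.B st.terms)
    (hl : st.terms.contents = ⟨some u, true, hi⟩ :: ⟨some u, false, lo⟩ :: l)
    (hc : st.byChild.Filled P i s) :
    ∃ r q s', gather P u.1 st s = (({ st with terms := r, byChild := q }, true), s') ∧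
      ReaderOK P.B r ∧ r.contents = l ∧ q.Filled P (i + 1) s' := by
  obtain ⟨s₁, e₁, a₁⟩ := peekArc_terms hq ht hl s
  obtain ⟨r₂, s₂, e₂, ok₂, hc₂, a₂⟩ := popArc_terms hq ht hl s₁
  obtain ⟨r₃, s₃, e₃, ok₃, hc₃, a₃⟩ := popArc_terms (st := { st with terms := r₂ }) hq ok₂ hc₂ s₂
  obtain ⟨q, s', e₄, h₄⟩ := (hc.mono (((a₁.trans a₂).trans a₃).trans (Mono.tick 1 s₃))).push hP
    (lt := nodeLt) ⟨u, lo, hi⟩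
  refine ⟨r₃, q, s', ?_, ok₃, hc₃, h₄⟩
  simp only [gather, bind_run, e₁, Option.bind_some, if_true, e₂, e₃, if_neg hne, e₄, pure_run]

/-- The two arcs out of a node. -/
def Node.arcs (v : Node) : List Arc := [⟨some v.uid, true, v.high⟩, ⟨some v.uid, false, v.low⟩]

/-- While `outerQ` is empty, arcs come from the file of arcs to terminals alone. Every node has two
distinct children, so none is suppressed and each is inserted into `byChild`, without a removal in
between. Nested levels and inner sweeps play no role here. -/
theorem gather_loop (hP : P.OK) {ℓ : ℕ} (vs : List Node) (hvs : ∀ v ∈ vs, v.uid.1 = ℓ ∧ v.low ≠ v.high)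
    (fuel : ℕ) (hf : vs.length ≤ fuel) (hq : st.outerQ = PQ.empty P) (ht : ReaderOK P.B st.terms)
    (hl : st.terms.contents = vs.flatMap Node.arcs ++ l) (hc : st.byChild.Filled P i s) :
    ∃ (q : PQ Node) (s' : Meter), q.Filled P (i + vs.length) s' ∧
      AtLeast s' (loopN fuel (gather P ℓ) st s).2 0 0 := by
  induction vs generalizing st s i fuel with
  | nil => exact ⟨_, s, hc, Mono.loopN (Mono.gather P ℓ) _ _ _⟩
  | cons v vs ih =>
    obtain ⟨⟨hv, hne⟩, hvs⟩ := List.forall_mem_cons.1 hvs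
    obtain ⟨fuel, rfl⟩ : ∃ k, fuel = k + 1 := ⟨fuel - 1, by simp at hf; omega⟩
    obtain ⟨r, q, s₁, e₁, ok, hr, h₁⟩ := gather_terms hP hne hq ht
      (l := vs.flatMap Node.arcs ++ l) (by simpa [Node.arcs] using hl) hc
    obtain ⟨q', s', h', a'⟩ := ih hvs fuel (by simpa using hf)
      (st := { st with terms := r, byChild := q }) hq ok hr h₁
    refine ⟨q', s', by rwa [List.length_cons, ← add_assoc, add_right_comm], ?_⟩
    rw [hv] at e₁
    simpa only [loopN, bind_run, e₁, if_true] using a'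

/-- Only the deepest level is accounted for. -/
theorem processLevel_lower (hP : P.OK) {ℓ : ℕ} {vs : List Node} (hne : vs ≠ [])
    (hvs : ∀ v ∈ vs, v.uid.1 = ℓ ∧ v.low ≠ v.high) (inner : InnerSweep) (fuel : ℕ)
    (hf : vs.length ≤ fuel) (hq : st.outerQ = PQ.empty P) (hq' : st.byChild = PQ.empty P)
    (ht : ReaderOK P.B st.terms) (hl : st.terms.contents = vs.flatMap Node.arcs ++ l) (s : Meter) :
    ∃ (q : PQ Node) (s' : Meter), q.Filled P vs.length s' ∧
      AtLeast s' (processLevel P inner fuel st s).2 0 0 := by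
  obtain ⟨v, vs', rfl⟩ := List.exists_cons_of_ne_nil hne
  obtain ⟨s₁, e₁, a₁⟩ := peekArc_terms (a := ⟨some v.uid, true, v.high⟩)
    (l := ⟨some v.uid, false, v.low⟩ :: (vs'.flatMap Node.arcs ++ l)) hq ht
    (by simpa [Node.arcs] using hl) s
  obtain ⟨q, s', h', a'⟩ := gather_loop hP _ hvs fuel hf hq ht hl
    (i := 0) (s := s₁) (by rw [hq']; exact PQ.Filled.empty P s₁)
  refine ⟨q, s', by simpa using h', AtLeast.trans (i₂ := 0) (t₂ := 0) a' ?_⟩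
  have hℓ := (hvs v (by simp)).1
  simp only [processLevel, bind_run, e₁, Option.bind_some, hℓ]
  set nested := decide (st.xs.cur.head? = some ℓ)
  generalize loopN fuel (gather P ℓ) st s₁ = x
  have h₂ := Mono.loopN (Mono.dedupe P ℓ nested) fuel (x.1, none, x.1.byChild.size) x.2
  generalize loopN fuel (dedupe P ℓ nested) (x.1, none, x.1.byChild.size) x.2 = y at h₂ ⊢
  have h₃ := Mono.loopN (Mono.forward P fuel) fuel y.1.1 y.2
  generalize loopN fuel (forward P fuel) y.1.1 y.2 = z at h₃ ⊢
  refine (h₂.trans h₃).trans (i₂ := 0) (t₂ := 0) ?_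
  split
  exacts [Mono.bind (.callInner P _ _ _) (fun _ => .pure _) _,
    Mono.bind (.pure _) (fun _ => .pure _) _]

end Deepest

/-- If the deepest level has the nodes `vs`, which are followed by the terminals only. -/
theorem outerReduce_lower {P : Params} (hP : P.OK) (f : OBDD) {ℓ : ℕ} {vs : List Node} {l : List Arc}
    (hne : vs ≠ []) (hvs : ∀ v ∈ vs, v.uid.1 = ℓ ∧ v.low ≠ v.high) (hlen : vs.length ≤ f.size)
    (hl : f.terminalArcs = vs.flatMap Node.arcs ++ l) (X : Finset ℕ) (inner : InnerSweep) :
    ∃ (q : PQ Node) (s' : Meter), q.Filled P vs.length s' ∧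
      AtLeast s' (outerReduce P f X inner (Meter.initial P.B f X)).2 0 0 := by
  obtain ⟨arcs, terms, xs, s₀, run, k1, k2, k3, -, -, hc, -⟩ := outerReduce_run hP f X inner
  obtain ⟨q, s', h', a'⟩ := processLevel_lower (l := l) hP hne hvs inner (f.arcs.length + 1)
    (by rw [f.length_arcs]; omega) (st := State.initial P arcs terms xs) rfl rfl k2
    (by rw [← hl]; exact hc) s₀
  refine ⟨q, s', h', ?_⟩
  rw [run, bind_run]
  exact (a'.trans (atLeast_loopN (Mono.processLevel P inner _) _ _ _)).trans
    ((Mono.bind (.peekArc P _) fun _ => .finish _ _) _)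

/-! ### A hard input: a binary tree whose leaves are the nodes of the deepest level -/

/-- Nodes are numbered as in a binary heap. With `m = N / 2`, each node `k < m` has a level of its
own, and all others share level `m`. -/
def treeUid (m k : ℕ) : Uid := (min k m, k)

def treePtr (N k : ℕ) (b : Bool) : Ptr := if k < N then .node (treeUid (N / 2) k) else .term b

def treeNode (N k : ℕ) : Node :=
  if k < N / 2 then ⟨treeUid (N / 2) k, treePtr N (2 * k + 1) false, treePtr N (2 * k + 2) true⟩
  else ⟨treeUid (N / 2) k, .term false, .term true⟩

theorem treeNode_uid (N k : ℕ) : (treeNode N k).uid = treeUid (N / 2) k := by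
  unfold treeNode; split <;> rfl

theorem treeUid_lt {m j k : ℕ} (h : j < k) : (treeUid m j).lt (treeUid m k) = true := by
  have : min j m < min k m ∨ min j m = min k m ∧ j < k := by omega
  exact (Bool.or_eq_true _ _).mpr (this.imp decide_eq_true fun h =>
    (Bool.and_eq_true _ _).mpr ⟨decide_eq_true h.1, decide_eq_true h.2⟩)

theorem treePtr_eq {N k : ℕ} {b : Bool} {u : Uid} (h : treePtr N k b = .node u) :
    k < N ∧ treeUid (N / 2) k = u := by
  unfold treePtr at h
  split at h
  · exact ⟨by assumption, Ptr.node.inj h⟩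
  · cases h

theorem mem_treeNodes {N : ℕ} {v : Node} :
    v ∈ (List.range N).map (treeNode N) ↔ ∃ k < N, treeNode N k = v := by simp

theorem treeNode_ordered {N k : ℕ} {u : Uid}
    (hu : (treeNode N k).low = .node u ∨ (treeNode N k).high = .node u) :
    (treeNode N k).uid.1 < u.1 ∧ ∃ w ∈ (List.range N).map (treeNode N), w.uid = u := by
  by_cases hk : k < N / 2
  · obtain ⟨j, hj, hjN, rfl⟩ : ∃ j, k < j ∧ j < N ∧ treeUid (N / 2) j = u := by
      simp only [treeNode, if_pos hk] at hu
      rcases hu with hu | hu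
      · exact ⟨2 * k + 1, by omega, treePtr_eq hu⟩
      · exact ⟨2 * k + 2, by omega, treePtr_eq hu⟩
    refine ⟨?_, _, mem_treeNodes.2 ⟨j, hjN, rfl⟩, treeNode_uid N j⟩
    rw [treeNode_uid]
    simp only [treeUid]
    omega
  · simp [treeNode, if_neg hk] at hu

/-- The parent of `j + 1` in the heap is `j / 2`; the parity of `j` tells which child it is. -/
theorem treeNode_rooted {N j : ℕ} (hj : j + 1 < N) :
    ∃ p ∈ (List.range N).map (treeNode N), p.low = .node (treeNode N (j + 1)).uid ∨
      p.high = .node (treeNode N (j + 1)).uid := by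
  refine ⟨_, mem_treeNodes.2 ⟨j / 2, by omega, rfl⟩, ?_⟩
  rw [treeNode_uid, treeNode, if_pos (by omega)]
  rcases Nat.mod_two_eq_zero_or_one j with h | h
  · exact .inl (by rw [show 2 * (j / 2) + 1 = j + 1 by omega]; exact if_pos hj)
  · exact .inr (by rw [show 2 * (j / 2) + 2 = j + 1 by omega]; exact if_pos hj)

def OBDD.tree (N : ℕ) (hN : 1 ≤ N) : OBDD where
  nodes := (List.range N).map (treeNode N)
  nonempty := by simp; omega
  sorted := by
    rw [List.pairwise_map]
    refine List.pairwise_lt_range.imp fun h => ?_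
    rw [treeNode_uid, treeNode_uid]
    exact treeUid_lt h
  ordered := by
    intro v hv u hu
    obtain ⟨k, -, rfl⟩ := mem_treeNodes.1 hv
    exact treeNode_ordered hu
  rooted := by
    intro v hv
    obtain ⟨n, rfl⟩ : ∃ n, N = n + 1 := ⟨N - 1, by omega⟩
    rw [← List.map_tail, List.range_succ_eq_map, List.tail_cons, List.map_map] at hv
    obtain ⟨j, hj, rfl⟩ := List.mem_map.1 hv
    exact treeNode_rooted (by simpa using hj)

theorem OBDD.size_tree (N : ℕ) (hN : 1 ≤ N) : (OBDD.tree N hN).size = N := by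
  simp [OBDD.tree, OBDD.size]

/-- The nodes of the deepest level of the tree, last node first. -/
def treeLeaves (N : ℕ) : List Node := (((List.range N).map (treeNode N)).drop (N / 2)).reverse

theorem length_treeLeaves (N : ℕ) : (treeLeaves N).length = N - N / 2 := by simp [treeLeaves]

theorem treeLeaves_spec {N : ℕ} {v : Node} (hv : v ∈ treeLeaves N) :
    v.uid.1 = N / 2 ∧ v.low = .term false ∧ v.high = .term true := by
  simp only [treeLeaves, List.mem_reverse, ← List.map_drop, List.mem_map] at hv
  obtain ⟨k, hk, rfl⟩ := hv
  have hk' : ¬ k < N / 2 := by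
    rw [List.range_eq_range', List.drop_range', List.mem_range'_1] at hk
    omega
  simp only [treeNode, if_neg hk', treeUid, and_self, and_true]
  omega

/-- Arcs are listed by deepest source first, and both arcs of every node on the deepest level
survive the filter. Hence they form a prefix. -/
theorem terminalArcs_tree (N : ℕ) (hN : 1 ≤ N) :
    ∃ l, (OBDD.tree N hN).terminalArcs = (treeLeaves N).flatMap Node.arcs ++ l := by
  have h : (OBDD.tree N hN).nodes.reverse = treeLeaves N ++
      ((OBDD.tree N hN).nodes.take (N / 2)).reverse := by
    rw [treeLeaves, ← List.reverse_append]
    simp only [OBDD.tree, List.take_append_drop]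
  rw [OBDD.terminalArcs, OBDD.arcs, h, List.flatMap_append, List.append_assoc, List.filter_append,
    List.filter_eq_self.2]
  · exact ⟨_, rfl⟩
  · intro a ha
    obtain ⟨v, hv, ha⟩ := List.mem_flatMap.1 ha
    obtain ⟨-, h1, h2⟩ := treeLeaves_spec hv
    simp only [List.mem_cons, List.not_mem_nil, or_false] at ha
    rcases ha with rfl | rfl
    · simp [h2, Ptr.isTerm]
    · simp [h1, Ptr.isTerm]

theorem outerReduce_tree_lower {P : Params} (hP : P.OK) {N : ℕ} (hN : 1 ≤ N)
    (he : 2 ^ P.e < N - N / 2) (X : Finset ℕ) (inner : InnerSweep) :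
    ∃ K s, (outerReduce P (OBDD.tree N hN) X inner (Meter.initial P.B (OBDD.tree N hN) X)).2 = s ∧
      1 ≤ K ∧ N - N / 2 ≤ 2 ^ (P.d * K + P.e) ∧
      K * ((N - N / 2 : ℕ) - 2 ^ P.e : ℤ) ≤ 2 * P.B * s.io ∧
      (P.d + 1) * (K * ((N - N / 2 : ℕ) - 2 ^ P.e : ℤ)) + 2 * (P.e + 1) * (N - N / 2 : ℕ) ≤
        2 * s.time := by
  obtain ⟨l, hl⟩ := terminalArcs_tree N hN
  have hlen := length_treeLeaves N
  obtain ⟨q, s', h', h1, h2⟩ := outerReduce_lower hP (OBDD.tree N hN) (vs := treeLeaves N)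
    (ℓ := N / 2) (l := l) (by rw [← List.length_pos_iff]; omega)
    (fun v hv => by
      obtain ⟨e1, e2, e3⟩ := treeLeaves_spec hv
      exact ⟨e1, by simp [e2, e3]⟩)
    (by rw [OBDD.size_tree]; omega) hl X inner
  rw [hlen] at h'
  obtain ⟨K, k1, k2, k3, k4⟩ := h'.cost he
  generalize (outerReduce P (OBDD.tree N hN) X inner (Meter.initial P.B (OBDD.tree N hN) X)).2 = s
    at h1 h2 ⊢
  refine ⟨K, s, rfl, k1, k2, k3.trans ?_, k4.trans ?_⟩
  · gcongr; omega
  · gcongr; omega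

/-! ### The parameters -/

/-- `l` is the logarithm of `R / 2 ^ e` to the base `2 ^ d - 1`. Since `2 ^ (d - 1) ≤ 2 ^ d - 1`,
the last bound is a power of two and easily turned into logarithms. -/
theorem exists_levels {P : Params} (hP : P.OK) {R : ℕ} (hR : 2 ^ P.e ≤ R) :
    ∃ l, (∀ n, (2 ^ P.d - 1) ^ n * 2 ^ P.e ≤ R → n + 1 ≤ l + 1) ∧ (l + 1) * 2 ^ P.e ≤ R ∧
      2 ^ ((P.d - 1) * l + P.e) ≤ R := by
  have h4 := hP.four_le
  have hE : 0 < 2 ^ P.e := by positivity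
  have hpos : 1 ≤ R / 2 ^ P.e := (Nat.one_le_div_iff hE).2 hR
  have hl : (2 ^ P.d - 1) ^ Nat.log (2 ^ P.d - 1) (R / 2 ^ P.e) * 2 ^ P.e ≤ R :=
    (Nat.le_div_iff_mul_le hE).1 (Nat.pow_log_le_self _ (by omega))
  refine ⟨Nat.log (2 ^ P.d - 1) (R / 2 ^ P.e), ?_, ?_, ?_⟩
  · intro n hn
    exact Nat.succ_le_succ (Nat.le_log_of_pow_le (by omega) ((Nat.le_div_iff_mul_le hE).2 hn))
  · exact (Nat.mul_le_mul_right _ (Nat.lt_pow_self (by omega))).trans hl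
  · refine le_trans ?_ hl
    rw [pow_add, pow_mul]
    gcongr
    have : 2 ^ P.d = 2 * 2 ^ (P.d - 1) := by
      rw [← pow_succ', Nat.sub_add_cancel (by have := hP.two_le_d; omega)]
    omega

section Memory

variable {M B : ℕ} (hB : 1 ≤ B) (hM : 32 * B ≤ M)
include hB hM

theorem Params.ofMemory_bounds : 8 * B * 2 ^ (Params.ofMemory M B).d ≤ M ∧
    M < 16 * B * 2 ^ (Params.ofMemory M B).d ∧ 32 * 2 ^ (Params.ofMemory M B).e ≤ M ∧
    M < 64 * 2 ^ (Params.ofMemory M B).e ∧ 2 ≤ (Params.ofMemory M B).d := by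
  have h1 : 4 ≤ M / (8 * B) := (Nat.le_div_iff_mul_le (by omega)).2 (by omega)
  have h2 : 1 ≤ M / 32 := by omega
  have h3 : 2 ^ (Params.ofMemory M B).d ≤ M / (8 * B) := Nat.pow_log_le_self 2 (by omega)
  have h4 : M / (8 * B) < 2 ^ ((Params.ofMemory M B).d + 1) :=
    Nat.lt_pow_succ_log_self (by norm_num) _
  have h5 : 2 ^ (Params.ofMemory M B).e ≤ M / 32 := Nat.pow_log_le_self 2 (by omega)
  have h6 : M / 32 < 2 ^ ((Params.ofMemory M B).e + 1) := Nat.lt_pow_succ_log_self (by norm_num) _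
  rw [Nat.le_div_iff_mul_le (by omega)] at h3
  rw [Nat.div_lt_iff_lt_mul (by omega), pow_succ] at h4
  rw [pow_succ] at h6
  refine ⟨by linarith, by linarith, by omega, by omega, ?_⟩
  exact Nat.le_log_of_pow_le Nat.one_lt_two h1

theorem Params.ofMemory_ok : (Params.ofMemory M B).OK := by
  obtain ⟨h1, h2, h3, h4, h5⟩ := Params.ofMemory_bounds hB hM
  refine ⟨hB, h5, ?_, ?_⟩
  · change 2 ^ (Params.ofMemory M B).d * B ≤ _
    linarith
  · change B ≤ _
    linarith

/-- In units of `M / 32`, the nine blocks take at most `9`, the insertion buffers at most `8`, and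
the merge streams at most `4 + 4`, which is `25` in total. -/
theorem Params.ofMemory_mem : 8 * B + 8 * 2 ^ (Params.ofMemory M B).e +
    (Params.ofMemory M B).mergeMem ≤ M := by
  obtain ⟨h1, h2, h3, h4, h5⟩ := Params.ofMemory_bounds hB hM
  have h6 := Nat.mul_le_mul_right (2 ^ (Params.ofMemory M B).d) hB
  change _ + (2 ^ (Params.ofMemory M B).d * B + 2 ^ (Params.ofMemory M B).d + B) ≤ M
  linarith

end Memory

/-! ### Logarithms -/

theorem le_logb_of_pow_le {n x : ℕ} (h : 2 ^ n ≤ x) : (n : ℝ) ≤ Real.logb 2 x := by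
  rw [Real.le_logb_iff_rpow_le (by norm_num) (by exact_mod_cast (Nat.two_pow_pos n).trans_le h),
    Real.rpow_natCast]
  exact_mod_cast h

theorem logb_le_of_le_pow {n x : ℕ} (hx : 0 < x) (h : x ≤ 2 ^ n) : Real.logb 2 x ≤ n := by
  rw [Real.logb_le_iff_le_rpow (by norm_num) (by exact_mod_cast hx), Real.rpow_natCast]
  exact_mod_cast h

theorem logb_two_pow_mul (n : ℕ) {x : ℝ} (hx : 0 < x) :
    Real.logb 2 (2 ^ n * x) = n + Real.logb 2 x := by
  rw [Real.logb_mul (by positivity) hx.ne', Real.logb_pow, Real.logb_self_eq_one (by norm_num), mul_one]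

/-- The parameters, in terms of the logarithms of the numbers of nodes and of records in memory. -/
structure LogBounds (d e : ℕ) (B M N : ℕ) : Prop where
  two_le_d : (2 : ℝ) ≤ d
  fan_le : Real.logb 2 M - Real.logb 2 B ≤ d + 4
  le_fan : (d : ℝ) + 3 ≤ Real.logb 2 M - Real.logb 2 B
  buffer_le : Real.logb 2 M ≤ e + 6
  le_buffer : (e : ℝ) + 5 ≤ Real.logb 2 M
  block_nonneg : 0 ≤ Real.logb 2 B
  memory_le : Real.logb 2 M ≤ Real.logb 2 N
  sortIO : NestedSweep.sortIO M B N =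
    N / B * ((Real.logb 2 N - Real.logb 2 B) / (Real.logb 2 M - Real.logb 2 B))

theorem Params.ofMemory_log {M B N : ℕ} (hB : 1 ≤ B) (hM : 32 * B ≤ M) (hN : M < N) :
    LogBounds (Params.ofMemory M B).d (Params.ofMemory M B).e B M N := by
  obtain ⟨h1, h2, h3, h4, h5⟩ := Params.ofMemory_bounds hB hM
  set d := (Params.ofMemory M B).d
  set e := (Params.ofMemory M B).e
  have b0 : (0 : ℝ) < B := by exact_mod_cast hB
  have m0 : (0 : ℝ) < M := by exact_mod_cast (by omega : 0 < M)
  have n0 : (0 : ℝ) < N := by exact_mod_cast (by omega : 0 < N)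
  have mono : ∀ {x y : ℝ}, 0 < x → x ≤ y → Real.logb 2 x ≤ Real.logb 2 y := fun hx hxy =>
    Real.logb_le_logb_of_le (by norm_num) hx hxy
  refine ⟨by exact_mod_cast h5, ?_, ?_, ?_, ?_, ?_, mono m0 (by exact_mod_cast hN.le), ?_⟩
  · have : (M : ℝ) ≤ 2 ^ (d + 4) * B := by
      rw [pow_add]; exact_mod_cast (by linarith : M ≤ 2 ^ d * 2 ^ 4 * B)
    have := mono m0 this
    rw [logb_two_pow_mul _ b0] at this
    push_cast at this
    linarith
  · have : (2 ^ (d + 3) * B : ℝ) ≤ M := by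
      rw [pow_add]; exact_mod_cast (by linarith : 2 ^ d * 2 ^ 3 * B ≤ M)
    have := mono (by positivity) this
    rw [logb_two_pow_mul _ b0] at this
    push_cast at this
    linarith
  · exact_mod_cast logb_le_of_le_pow (n := e + 6) (x := M) (by omega) (by rw [pow_add]; omega)
  · exact_mod_cast le_logb_of_pow_le (n := e + 5) (x := M) (by rw [pow_add]; omega)
  · exact Real.logb_nonneg (by norm_num) (by exact_mod_cast hB)
  · rw [NestedSweep.sortIO, ← Real.logb_div n0.ne' b0.ne', ← Real.logb_div m0.ne' b0.ne',
      Real.logb, Real.logb, Real.logb, div_div_div_cancel_right₀]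
    exact (Real.log_pos (by norm_num)).ne'

/-- `ν`, `μ` and `β` are the binary logarithms of the numbers of nodes, of records in memory and in
a block. As `d` agrees with `μ - β` and `e` with `μ` up to constants, the hypothesis on `l` bounds
the levels by a multiple of `(ν - β) / (μ - β)` and the steps of an operation by a multiple of `ν`.
-/
theorem rate_le_log {d e l μ ν β : ℝ} (h1 : 2 ≤ d) (h2 : μ - β ≤ d + 4) (h3 : d + 3 ≤ μ - β)
    (h4 : μ ≤ e + 6) (h6 : 0 ≤ β) (h7 : μ ≤ ν) (hl : 0 ≤ l)
    (h : (d - 1) * l + e ≤ ν + 2) :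
    1 ≤ (ν - β) / (μ - β) ∧ l + 2 ≤ 12 * ((ν - β) / (μ - β)) ∧
      (d + 10) * (60 * (l + 2)) + 3 * (e + 2) ≤ 3000 * ν := by
  -- `d ≤ 2 * (d - 1)` removes the loss from the base `2 ^ d - 1`.
  have hdl : d * l + 2 * e ≤ 2 * ν + 4 := by
    have := mul_nonneg (by linarith : (0 : ℝ) ≤ d - 2) hl
    linarith
  refine ⟨?_, ?_, ?_⟩
  · rw [one_le_div (by linarith)]
    linarith
  · rw [mul_div_assoc', le_div_iff₀ (by linarith)]
    have : l * (μ - β) ≤ l * (3 * d) := by gcongr; linarith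
    linarith
  · have : (d + 10) * (60 * (l + 2)) ≤ 6 * d * (60 * (l + 2)) := by gcongr; linarith
    linarith

/-! ### The two bounds -/

theorem outerCost_upper {M B N : ℕ} (hB : 1 ≤ B) (hM : 32 * B ≤ M) (hN : M < N) {f : OBDD}
    (hf : f.size = N) (X : Finset ℕ) (inner : InnerSweep) :
    ((outerCost M B f X inner).io : ℝ) ≤ 1000000 * sortIO M B N ∧
    ((outerCost M B f X inner).time : ℝ) ≤ 1000000 * sortTime N ∧
    ((outerCost M B f X inner).diskPeak : ℝ) * B ≤ 1000000 * N ∧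
    (outerCost M B f X inner).memPeak ≤ M := by
  have hP := Params.ofMemory_ok hB hM
  obtain ⟨p1, p2, p3, p4, p5⟩ := Params.ofMemory_bounds hB hM
  have hmem := Params.ofMemory_mem hB hM
  obtain ⟨g1, g2, g3, g4, g5, g6, g7, hsort⟩ := Params.ofMemory_log hB hM hN
  have hPB : (Params.ofMemory M B).B = B := rfl
  rw [outerCost]
  set P := Params.ofMemory M B
  obtain ⟨l, hl, hl₂, hl₃⟩ := exists_levels hP (R := 2 * f.size + 1) (by omega)
  have hblk := f.mul_blocks_le hB X
  -- The transient space of a refill grows with the number of levels, but `(l + 1) * 2 ^ e` is at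
  -- most the number of arcs, so it stays linear.
  have hcap : 2 * (l + 1 + 1) * P.cap ≤ 20 * (2 * N + 1) := by
    have h1 := hP.cap_le
    have h2 := Nat.mul_le_mul_left (2 * (l + 1 + 1)) h1
    have h3 : 2 * (l + 1 + 1) * (8 * 2 ^ P.e) = 16 * ((l + 1) * 2 ^ P.e) + 16 * 2 ^ P.e := by ring
    omega
  have htr : B * transient P (l + 1) (2 * f.size + 1) ≤ 24 * (2 * N + 1) := by
    have h1 := Nat.mul_div_le (2 * f.size + 1) B
    have h2 := Nat.mul_div_le (2 ^ P.e) B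
    have h3 : B * transient P (l + 1) (2 * f.size + 1) = B * ((2 * f.size + 1) / B) +
        B * (2 ^ P.e / B) + 4 * B + 2 * (l + 1 + 1) * P.cap := by
      simp only [transient, Params.cap, hPB]; ring
    omega
  -- The peak is bounded in whole blocks, hence the rounded-up quotient.
  set D := f.blocks B X + transient P (l + 1) (2 * f.size + 1) + (69 * (2 * f.size + 1) / B + 1) with hD
  have hD₁ : B * (f.blocks B X + transient P (l + 1) (2 * f.size + 1)) + 69 * (2 * f.size + 1) ≤
      B * D := by
    have h1 := Nat.lt_mul_div_succ (69 * (2 * f.size + 1)) (by omega : 0 < B)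
    rw [hD, mul_add B _ (_ + 1)]
    omega
  have hD₂ : B * D ≤ 1000 * N := by
    have h1 := Nat.mul_div_le (69 * (2 * f.size + 1)) B
    rw [hD, mul_add, mul_add, mul_add]
    omega
  obtain ⟨s, run, u1, u2, u3, u4⟩ := outerReduce_upper hP f X inner (L := l + 1) (D := D) (M := M) hl
    (by rw [hPB]; exact_mod_cast hD₁) (by rw [hPB]; exact_mod_cast hmem)
  rw [hPB] at run u1 u2
  rw [run]
  have b0 : (1 : ℝ) ≤ B := by exact_mod_cast hB
  have hBM : (32 * B : ℝ) ≤ M := by exact_mod_cast hM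
  have hMN : (M : ℝ) ≤ N := by exact_mod_cast hN.le
  have heM : (32 * 2 ^ P.e : ℝ) ≤ M := by exact_mod_cast p3
  have hblk' : (B * f.blocks B X : ℝ) ≤ 3 * N + 1 + 3 * B := by rw [← hf]; exact_mod_cast hblk
  rw [hf] at u1 u2 hl₃
  set ν := Real.logb 2 N
  set μ := Real.logb 2 M
  set β := Real.logb 2 B
  have hlog : ((P.d : ℝ) - 1) * l + P.e ≤ ν + 2 := by
    have h1 := le_logb_of_pow_le (n := (P.d - 1) * l + P.e) (x := 2 ^ 2 * N) (hl₃.trans (by omega))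
    rw [Nat.cast_mul, Nat.cast_pow, Nat.cast_ofNat, logb_two_pow_mul 2 (by linarith)] at h1
    push_cast [Nat.cast_sub (by omega : 1 ≤ P.d)] at h1
    linarith
  have v1 : (B * s.io : ℝ) ≤ B * f.blocks B X + 4 * (60 * (l + 1 + 1)) * (68 * N + 70) + 2 * B := by
    simp only [rate] at u1; exact_mod_cast u1
  have v2 : (s.time : ℝ) ≤ B * f.blocks B X + 8 * 2 ^ P.e +
      ((P.d + 10) * (60 * (l + 1 + 1)) + 3 * (P.e + 2)) * (68 * N + 70) + 2 * B := by
    simp only [rate] at u2; exact_mod_cast u2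
  obtain ⟨hρ, hlρ, hlν⟩ := rate_le_log g1 g2 g3 g4 g6 g7 (Nat.cast_nonneg l) hlog
  refine ⟨?_, ?_, ?_, u4⟩
  · rw [hsort]
    generalize (ν - β) / (μ - β) = ρ at hρ hlρ ⊢
    rw [show 1000000 * (N / B * ρ : ℝ) = 1000000 * (N * ρ) / B by ring, le_div_iff₀ (by linarith)]
    have h3 : ((l : ℝ) + 2) * (68 * N + 70) ≤ 12 * ρ * (138 * N) := by gcongr; linarith
    have h4 : (N : ℝ) ≤ N * ρ := le_mul_of_one_le_right (by linarith) hρ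
    linarith
  · rw [sortTime]
    have hν : 1 ≤ ν := by linarith [Nat.cast_nonneg (α := ℝ) P.e]
    have h2 : (((P.d : ℝ) + 10) * (60 * (l + 1 + 1)) + 3 * (P.e + 2)) * (68 * N + 70) ≤
        3000 * ν * (138 * N) := by
      refine mul_le_mul (by linarith) (by linarith) (by positivity) (by linarith)
    have h3 : (N : ℝ) ≤ N * ν := le_mul_of_one_le_right (by linarith) hν
    linarith
  · have h1 : (s.diskPeak : ℝ) ≤ D := by exact_mod_cast u3
    have h2 : (B * D : ℝ) ≤ 1000 * N := by exact_mod_cast hD₂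
    nlinarith

theorem outerCost_lower {M B N : ℕ} (hB : 1 ≤ B) (hM : 32 * B ≤ M) (hN : M < N) :
    ∃ f : OBDD, f.size = N ∧ ∀ (X : Finset ℕ) (inner : InnerSweep),
      1 / 32 * sortIO M B N ≤ ((outerCost M B f X inner).io : ℝ) ∧
      1 / 32 * sortTime N ≤ ((outerCost M B f X inner).time : ℝ) := by
  have hP := Params.ofMemory_ok hB hM
  obtain ⟨p1, p2, p3, p4, p5⟩ := Params.ofMemory_bounds hB hM
  obtain ⟨g1, g2, g3, g4, g5, g6, g7, hsort⟩ := Params.ofMemory_log hB hM hN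
  refine ⟨OBDD.tree N (by omega), OBDD.size_tree _ _, fun X inner => ?_⟩
  rw [outerCost]
  set P := Params.ofMemory M B
  have hPB : P.B = B := rfl
  obtain ⟨K, s, run, k1, k2, k3, k4⟩ := outerReduce_tree_lower hP (by omega : 1 ≤ N)
    (by omega) X inner
  rw [hPB] at run k3
  rw [run]
  have b0 : (1 : ℝ) ≤ B := by exact_mod_cast hB
  have hBM : (32 * B : ℝ) ≤ M := by exact_mod_cast hM
  have hMN : (M : ℝ) ≤ N := by exact_mod_cast hN.le
  have heM : (32 * 2 ^ P.e : ℝ) ≤ M := by exact_mod_cast p3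
  have hn : (N : ℝ) ≤ 2 * (N - N / 2 : ℕ) := by
    exact_mod_cast (by omega : N ≤ 2 * (N - N / 2))
  have hk : (1 : ℝ) ≤ K := by exact_mod_cast k1
  have v1 : (K : ℝ) * ((N - N / 2 : ℕ) - 2 ^ P.e) ≤ 2 * B * s.io := by exact_mod_cast k3
  have v2 : ((P.d : ℝ) + 1) * (K * ((N - N / 2 : ℕ) - 2 ^ P.e)) + 2 * (P.e + 1) * (N - N / 2 : ℕ) ≤
      2 * s.time := by exact_mod_cast k4
  have hlog : Real.logb 2 N ≤ P.d * K + P.e + 1 := by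
    exact_mod_cast logb_le_of_le_pow (n := P.d * K + P.e + 1) (x := N) (by omega)
      (by rw [pow_succ]; omega)
  set n := N - N / 2
  -- `n` is at least `N / 2`, and the insertion buffer has at most `N / 32` records.
  have hwork : (K : ℝ) * (N / 4) ≤ K * (n - 2 ^ P.e) := by gcongr; linarith
  set ν := Real.logb 2 N
  set μ := Real.logb 2 M
  set β := Real.logb 2 B
  constructor
  -- Since `ν ≤ d * K + e + 1` and `e + 5 ≤ μ`, the difference `ν - β` is at most `K * (μ - β)` plus
  -- one further `μ - β`, and `1 ≤ K` absorbs the latter.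
  · have hρ : (ν - β) / (μ - β) ≤ 2 * K := by
      rw [div_le_iff₀ (by linarith)]
      nlinarith
    rw [hsort, ← mul_assoc, mul_comm (1 / 32 : ℝ), mul_assoc, div_mul_eq_mul_div,
      div_le_iff₀ (by linarith)]
    have : (N : ℝ) * (1 / 32 * ((ν - β) / (μ - β))) ≤ N * (1 / 32 * (2 * K)) := by gcongr
    nlinarith
  · rw [sortTime]
    have h1 : (N : ℝ) * ν ≤ N * (P.d * K + P.e + 1) := by gcongr
    have h2 : (P.d : ℝ) * (K * (N / 4)) ≤ P.d * (K * (n - 2 ^ P.e)) := by gcongr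
    have h3 : (P.e + 1 : ℝ) * N ≤ (P.e + 1) * (2 * n) := by gcongr
    nlinarith

end NestedSweep

theorem mainTheorem3 :
    ∃ c C : ℝ, 0 < c ∧ 0 < C ∧
      ∀ M B N : ℕ, 1 ≤ B → 32 * B ≤ M → M < N →
        (∀ f : NestedSweep.OBDD, f.size = N →
          ∀ (X : Finset ℕ) (inner : NestedSweep.InnerSweep),
            ((NestedSweep.outerCost M B f X inner).io : ℝ) ≤ C * NestedSweep.sortIO M B N ∧
            ((NestedSweep.outerCost M B f X inner).time : ℝ) ≤ C * NestedSweep.sortTime N ∧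
            ((NestedSweep.outerCost M B f X inner).diskPeak : ℝ) * B ≤ C * N ∧
            (NestedSweep.outerCost M B f X inner).memPeak ≤ M) ∧
        (∃ f : NestedSweep.OBDD, f.size = N ∧
          ∀ (X : Finset ℕ) (inner : NestedSweep.InnerSweep),
            c * NestedSweep.sortIO M B N ≤ ((NestedSweep.outerCost M B f X inner).io : ℝ) ∧
            c * NestedSweep.sortTime N ≤ ((NestedSweep.outerCost M B f X inner).time : ℝ)) :=
  ⟨1 / 32, 1000000, by norm_num, by norm_num, fun _ _ _ hB hM hN =>
    ⟨fun _ hf X inner => NestedSweep.outerCost_upper hB hM hN hf X inner,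
      NestedSweep.outerCost_lower hB hM hN⟩⟩
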